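/- **Setting.** Let $G=(V,E)$ be a connected simple graph on $n$ nodes with unknown labels $y:V\to\{0,1\}$. In self-directed learning the learner knows $G$ and repeatedly selects a not yet selected node $v$, predicts a label $\hat y(v)$, and then observes $y(v)$; a mistake is a trial with $\hat y(v)\ne y(v)$. Let $I(u,v)$ be the set of all nodes on shortest $u$-$v$ paths. A set $C\subseteq V$ is convex if $I(a,b)\subseteq C$ for all $a,b\in C$, and $y$ is a convex bipartition (halfspace) if $\{y=1\}$ and $\{y=0\}$ are both convex. The Hadwiger number $h(G)$ is the largest $w$ such that the complete graph $K_w$ is a minor of $G$. For $U\subseteq V$, let $Q_{\mathrm{good}}(U)$ be the set of good quadruples in $U$, i.e. of all unordered pairs $\{(a,b),(c,d)\}$ of unordered pairs of nodes with $a,b,c,d\in U$ distinct and $I(a,b)\cap I(c,d)\neq\emptyset$. **Algorithm Good4.** Start with $U=V$; every selected node is removed from $U$. While $Q_{\mathrm{good}}(U)\ne\emptyset$, do one round: 1. Select a node $a\in U$ that is contained in the maximum number of good quadruples in $U$, predict its label arbitrarily, and observe $y(a)$. 2. For $b'\in U$ let $N(b')$ be the number of pairs $(c,d)$ with $\{(a,b'),(c,d)\}\in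 Q_{\mathrm{good}}(U\cup\{a\})$. Select nodes $b\in U$ in decreasing order of $N$ (computed once, at the start of this step), predicting $1-y(a)$ for each, until a mistake occurs or $U=\emptyset$. If no mistake occurs, the round ends; otherwise let $b$ be the node on which the mistake occurred. 3. For $c'\in U$ let $N'(c')$ be the number of nodes $d$ with $\{(a,b),(c',d)\}\in Q_{\mathrm{good}}(U\cup\{a,b\})$. Select nodes $c\in U$ in decreasing order of $N'$ (computed once, at the start of this step), predicting $y(a)$ for each, until a mistake occurs or $U=\emptyset$. If no mistake occurs, the round ends; otherwise let $c$ be the node on which the mistake occurred. 4. Select, in any order, the nodes $d\in U$ with $\{(a,b),(c,d)\}\in Q_{\mathrm{good}}(U\cup\{a,b,c\})$, predicting $y(a)$ for each, until they are exhausted or a mistake occurs. When $Q_{\mathrm{good}}(U)=\emptyset$, predict arbitrary labels for the remaining nodes of $U$ in any order. Ties, orders and arbitrary predictions may be resolved in any way; each resolution gives a run of Good4. **Theorem.** (i) Good4 runs in time polynomial in $n$: there are a program for a random access machine (unit-cost addition, truncated subtraction, tests and memory access, with access to the adjacency matrix of $G$ and an instruction that predicts the label of a node and receives the true one) and a polynomial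 $p$ such that, for every $n$, every connected simple graph $G$ on $n$ nodes and every labeling $y:V\to\{0,1\}$, the program halts after at most $p(n)$ steps and its sequence of trials is a run of Good4 on $G$ and $y$. (ii) For every connected simple graph $G$ on $n\ge 2$ nodes and every convex bipartition $y$ of $G$, every run of Good4 makes at most $3\,(h(G)+1)^4\ln n$ mistakes. -/

import Mathlib

namespace Good4

/-! ### Geodesic convexity and the Hadwiger number -/

section Graph

variable {V : Type*}

/-- The geodesic interval `I(u, v)`: all nodes lying on some shortest `u`-`v` path. -/
def interval (G : SimpleGraph V) (u v : V) : Set V :=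
  {x | ∃ p : G.Walk u v, p.length = G.dist u v ∧ x ∈ p.support}

/-- A set of nodes is geodesically convex if it contains every shortest path between any two of
its nodes. -/
def IsConvex (G : SimpleGraph V) (C : Set V) : Prop :=
  ∀ a ∈ C, ∀ b ∈ C, interval G a b ⊆ C

/-- A `0/1`-labeling is a convex bipartition (halfspace) if both of its clusters are convex.
The labelings with an empty cluster are included. -/
def IsConvexBipartition (G : SimpleGraph V) (y : V → Bool) : Prop :=
  IsConvex G {v | y v = true} ∧ IsConvex G {v | y v = false}

/-- `H` is a minor of `G`: there are pairwise disjoint (nonempty) connected branch sets in `G`,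
one for every node of `H`, such that the branch sets of adjacent nodes are joined by an edge. -/
def IsMinor {W : Type*} (H : SimpleGraph W) (G : SimpleGraph V) : Prop :=
  ∃ B : W → Set V,
    (∀ i, (G.induce (B i)).Connected) ∧
    (∀ i j, i ≠ j → Disjoint (B i) (B j)) ∧
    ∀ i j, H.Adj i j → ∃ u ∈ B i, ∃ v ∈ B j, G.Adj u v

/-- The Hadwiger number: the largest `w` such that the complete graph `K_w` is a minor of `G`.
(For a finite graph the set is bounded, as the branch sets are disjoint and nonempty.) -/
noncomputable def hadwiger (G : SimpleGraph V) : ℕ :=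
  sSup {w : ℕ | IsMinor (⊤ : SimpleGraph (Fin w)) G}

/-! ### Good quadruples -/

/-- `Q_good(U)`: the good quadruples `{(a,b),(c,d)}` in `U`, i.e. unordered pairs of unordered
pairs with `a, b, c, d ∈ U` distinct and `I(a,b) ∩ I(c,d) ≠ ∅`. -/
def goodQuads (G : SimpleGraph V) (U : Finset V) : Set (Sym2 (Sym2 V)) :=
  {q | ∃ a ∈ U, ∃ b ∈ U, ∃ c ∈ U, ∃ d ∈ U,
    [a, b, c, d].Nodup ∧ (interval G a b ∩ interval G c d).Nonempty ∧ q = s(s(a, b), s(c, d))}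

/-- The number of good quadruples `{(a,b),(c,d)}` in `U` in which `a` participates. -/
noncomputable def score₁ (G : SimpleGraph V) (U : Finset V) (a : V) : ℕ :=
  {q | q ∈ goodQuads G U ∧ ∃ b c d, q = s(s(a, b), s(c, d))}.ncard

/-- The number of pairs `(c,d)` such that `{(a,b),(c,d)}` is a good quadruple in `U`. -/
noncomputable def score₂ (G : SimpleGraph V) (U : Finset V) (a b : V) : ℕ :=
  {e : Sym2 V | s(s(a, b), e) ∈ goodQuads G U}.ncard

/-- The number of nodes `d` such that `{(a,b),(c,d)}` is a good quadruple in `U`. -/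
noncomputable def score₃ (G : SimpleGraph V) (U : Finset V) (a b c : V) : ℕ :=
  {d : V | s(s(a, b), s(c, d)) ∈ goodQuads G U}.ncard

/-! ### The algorithm, with all its arbitrary choices left open -/

/-- One trial of self-directed learning: the selected node, its predicted label, and the true
label observed afterwards. -/
structure Trial (V : Type*) where
  node : V
  pred : Bool
  label : Bool

/-- The number of mistakes in a sequence of trials. -/
def mistakes (τ : List (Trial V)) : ℕ :=
  τ.countP fun t => t.pred != t.label

variable [DecidableEq V]

/-- The inner loop of Steps 2 and 3: as long as no mistake was made and unlabeled nodes remain,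
select an unlabeled node of maximum `score` (ties broken arbitrarily), predict the label `guess`,
and observe the true label. `Scan y score guess U τ U' r`: starting with the unlabeled set `U`
the trials `τ` are made, `U'` remains unlabeled, and `r` is the node on which a mistake was made
(`none` if there was no mistake). -/
inductive Scan (y : V → Bool) (score : V → ℕ) (guess : Bool) :
    Finset V → List (Trial V) → Finset V → Option V → Prop
  | done : Scan y score guess ∅ [] ∅ none
  | correct (U : Finset V) (v : V) (τ : List (Trial V)) (U' : Finset V) (r : Option V) :
      v ∈ U → (∀ v' ∈ U, score v' ≤ score v) → y v = guess →
      Scan y score guess (U.erase v) τ U' r →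
      Scan y score guess U (⟨v, guess, y v⟩ :: τ) U' r
  | mistake (U : Finset V) (v : V) :
      v ∈ U → (∀ v' ∈ U, score v' ≤ score v) → y v ≠ guess →
      Scan y score guess U [⟨v, guess, y v⟩] (U.erase v) (some v)

/-- The loop of Step 4: go through the nodes of `D` in an arbitrary order, predict `guess` and
observe, and stop at the first mistake. `Sweep y guess D U τ U'`: starting with the unlabeled set
`U` the trials `τ` are made and `U'` remains unlabeled. -/
inductive Sweep (y : V → Bool) (guess : Bool) :
    Finset V → Finset V → List (Trial V) → Finset V → Prop
  | done (U : Finset V) : Sweep y guess ∅ U [] U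
  | correct (D U : Finset V) (d : V) (τ : List (Trial V)) (U' : Finset V) :
      d ∈ D → y d = guess → Sweep y guess (D.erase d) (U.erase d) τ U' →
      Sweep y guess D U (⟨d, guess, y d⟩ :: τ) U'
  | mistake (D U : Finset V) (d : V) :
      d ∈ D → y d ≠ guess → Sweep y guess D U [⟨d, guess, y d⟩] (U.erase d)

/-- Step 5: predict arbitrary labels for the nodes of `U`, in an arbitrary order. -/
inductive Rest (y : V → Bool) : Finset V → List (Trial V) → Prop
  | done : Rest y ∅ []
  | predict (U : Finset V) (v : V) (guess : Bool) (τ : List (Trial V)) :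
      v ∈ U → Rest y (U.erase v) τ → Rest y U (⟨v, guess, y v⟩ :: τ)

/-- One iteration of the main loop (Steps 1 to 4), from the unlabeled set `U` to `U'`. In Step 1
a node `a` participating in the most good quadruples in `U` gets an arbitrary prediction `guess`.
Step 2 scans for a node `b` with prediction `1 - y(a)`, Step 3 for a node `c` with prediction
`y(a)`; if one of these scans makes no mistake, the iteration is over. Otherwise Step 4 goes
through all unlabeled `d` for which `{(a,b),(c,d)}` is good. -/
inductive Round (G : SimpleGraph V) (y : V → Bool) :
    Finset V → List (Trial V) → Finset V → Prop
  | stop₂ (U : Finset V) (a : V) (guess : Bool) (τ₂ : List (Trial V)) (U₂ : Finset V) :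
      a ∈ U → (∀ a' ∈ U, score₁ G U a' ≤ score₁ G U a) →
      Scan y (score₂ G (insert a (U.erase a)) a) (!y a) (U.erase a) τ₂ U₂ none →
      Round G y U (⟨a, guess, y a⟩ :: τ₂) U₂
  | stop₃ (U : Finset V) (a : V) (guess : Bool) (τ₂ : List (Trial V)) (U₂ : Finset V)
      (b : V) (τ₃ : List (Trial V)) (U₃ : Finset V) :
      a ∈ U → (∀ a' ∈ U, score₁ G U a' ≤ score₁ G U a) →
      Scan y (score₂ G (insert a (U.erase a)) a) (!y a) (U.erase a) τ₂ U₂ (some b) →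
      Scan y (score₃ G (insert a (insert b U₂)) a b) (y a) U₂ τ₃ U₃ none →
      Round G y U (⟨a, guess, y a⟩ :: (τ₂ ++ τ₃)) U₃
  | full (U : Finset V) (a : V) (guess : Bool) (τ₂ : List (Trial V)) (U₂ : Finset V)
      (b : V) (τ₃ : List (Trial V)) (U₃ : Finset V)
      (c : V) (D : Finset V) (τ₄ : List (Trial V)) (U₄ : Finset V) :
      a ∈ U → (∀ a' ∈ U, score₁ G U a' ≤ score₁ G U a) →
      Scan y (score₂ G (insert a (U.erase a)) a) (!y a) (U.erase a) τ₂ U₂ (some b) →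
      Scan y (score₃ G (insert a (insert b U₂)) a b) (y a) U₂ τ₃ U₃ (some c) →
      (∀ d, d ∈ D ↔
        d ∈ U₃ ∧ s(s(a, b), s(c, d)) ∈ goodQuads G (insert a (insert b (insert c U₃)))) →
      Sweep y (y a) D U₃ τ₄ U₄ →
      Round G y U (⟨a, guess, y a⟩ :: (τ₂ ++ τ₃ ++ τ₄)) U₄

/-- The main loop: iterate as long as there is a good quadruple of unlabeled nodes, then predict
the remaining labels arbitrarily. -/
inductive Loop (G : SimpleGraph V) (y : V → Bool) : Finset V → List (Trial V) → Prop
  | finish (U : Finset V) (τ : List (Trial V)) :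
      goodQuads G U = ∅ → Rest y U τ → Loop G y U τ
  | round (U U' : Finset V) (τ τ' : List (Trial V)) :
      (goodQuads G U).Nonempty → Round G y U τ U' → Loop G y U' τ' → Loop G y U (τ ++ τ')

/-- `τ` is the sequence of trials of some run of Good4 on the graph `G` with true labels `y`, for
some way of making the arbitrary choices (predictions, ties, orders). -/
def IsRun [Fintype V] (G : SimpleGraph V) (y : V → Bool) (τ : List (Trial V)) : Prop :=
  Loop G y Finset.univ τ

end Graph

/-! ### The machine model: a unit-cost random access machine with structured control

The arithmetic consists of addition and truncated subtraction only, so that unit cost is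
polynomially equivalent to the cost on a Turing machine. The graph is given by random access to
its adjacency matrix, and the interaction with the environment is a single instruction that
predicts the label of a node and then receives the true label. -/

/-- Basic instructions; registers are numbered by `ℕ`. -/
inductive Op where
  | const (r k : ℕ)
  | copy (r i : ℕ)
  | add (r i j : ℕ)
  | sub (r i j : ℕ)
  | load (r i : ℕ)
  | store (i j : ℕ)
  | adj (r i j : ℕ)
  | predict (r i j : ℕ)

/-- Programs: a single program serves all graphs and all `n`. -/
inductive Prog where
  | skip
  | op (o : Op)
  | seq (P Q : Prog)
  | ite (r : ℕ) (P Q : Prog)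
  | while (r : ℕ) (P : Prog)

/-- Machine state: the registers, the memory, and the trials made so far. -/
structure State (n : ℕ) where
  reg : ℕ → ℕ
  mem : ℕ → ℕ
  trials : List (Trial (Fin n))

/-- Initially register `0` holds `n`, and all other registers and memory cells hold `0`. -/
def State.init (n : ℕ) : State n where
  reg := fun r => if r = 0 then n else 0
  mem := fun _ => 0
  trials := []

/-- Write the value `x` to the register `r`. -/
def State.set {n : ℕ} (s : State n) (r x : ℕ) : State n :=
  { s with reg := Function.update s.reg r x }

open Classical in
/-- The entry `(i, j)` of the adjacency matrix of `G` (`0` out of range). -/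
noncomputable def adjBit {n : ℕ} (G : SimpleGraph (Fin n)) (i j : ℕ) : ℕ :=
  if ∃ (hi : i < n) (hj : j < n), G.Adj ⟨i, hi⟩ ⟨j, hj⟩ then 1 else 0

/-- The effect of the basic instructions. `predict r i j` predicts for the node whose number is
in register `i` the label `1` if register `j` is nonzero and the label `0` otherwise, and then
stores the true label of the node in register `r` (no effect if there is no such node). -/
noncomputable def Op.exec {n : ℕ} (G : SimpleGraph (Fin n)) (y : Fin n → Bool) :
    Op → State n → State n
  | .const r k, s => s.set r k
  | .copy r i, s => s.set r (s.reg i)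
  | .add r i j, s => s.set r (s.reg i + s.reg j)
  | .sub r i j, s => s.set r (s.reg i - s.reg j)
  | .load r i, s => s.set r (s.mem (s.reg i))
  | .store i j, s => { s with mem := Function.update s.mem (s.reg i) (s.reg j) }
  | .adj r i j, s => s.set r (adjBit G (s.reg i) (s.reg j))
  | .predict r i j, s =>
      if h : s.reg i < n then
        { s with
          reg := Function.update s.reg r (y ⟨s.reg i, h⟩).toNat
          trials := s.trials ++ [⟨⟨s.reg i, h⟩, decide (s.reg j ≠ 0), y ⟨s.reg i, h⟩⟩] }
      else s

/-- `Exec G y P s t s'`: on the graph `G` with true labels `y`, the program `P` started in the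
state `s` halts in the state `s'` after exactly `t` steps. Every basic instruction and every
evaluation of a test (`register r ≠ 0`) is one step. -/
inductive Exec {n : ℕ} (G : SimpleGraph (Fin n)) (y : Fin n → Bool) :
    Prog → State n → ℕ → State n → Prop
  | skip (s : State n) : Exec G y .skip s 0 s
  | op (o : Op) (s : State n) : Exec G y (.op o) s 1 (o.exec G y s)
  | seq (P Q : Prog) (s s' s'' : State n) (t t' : ℕ) :
      Exec G y P s t s' → Exec G y Q s' t' s'' → Exec G y (.seq P Q) s (t + t') s''
  | ite_true (r : ℕ) (P Q : Prog) (s s' : State n) (t : ℕ) :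
      s.reg r ≠ 0 → Exec G y P s t s' → Exec G y (.ite r P Q) s (t + 1) s'
  | ite_false (r : ℕ) (P Q : Prog) (s s' : State n) (t : ℕ) :
      s.reg r = 0 → Exec G y Q s t s' → Exec G y (.ite r P Q) s (t + 1) s'
  | while_true (r : ℕ) (P : Prog) (s s' s'' : State n) (t t' : ℕ) :
      s.reg r ≠ 0 → Exec G y P s t s' → Exec G y (.while r P) s' t' s'' →
      Exec G y (.while r P) s (t + t' + 1) s''
  | while_false (r : ℕ) (P : Prog) (s : State n) :
      s.reg r = 0 → Exec G y (.while r P) s 1 s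

end Good4

namespace Good4

/-! ### Total correctness of machine programs -/

section Machine

variable {n : ℕ} {G : SimpleGraph (Fin n)} {y : Fin n → Bool}

/-! Mistake bound. A round errs at most on `a`, `b` and `c`. A mistake on `b` means `y b = y a`, and
a mistake on `c` means `y c ≠ y a`. If some `d` of Step 4 had the label of `c`, a common node of
I(a,b) and I(c,d) would lie in both clusters (`Good.label_eq`), so Step 4 removes all its nodes
without a mistake. As nodes are scanned by decreasing score, in such a round the score of `a` is at
most 3m²/2 times the number of removed nodes, where m = |U| (`two_mul_score₁_le`, `Round.bound`); a
round whose scan meets no mistake removes everything.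

For a lower bound on that score, a set without good quadruples has fewer than 2h elements: colour
its nodes alternately, divide the shortest paths between the two colours among their ends, and merge
the resulting regions in pairs to get a complete minor (`isMinor_of_not_good`). De Caen's Turán-type
argument then forces many four-sets with a good quadruple (`choose_three_mul_le`), and `a` has at
least the average score. Comparing the two bounds, a round removes at least the fraction 1/(h+1)^4
of U while m > (h+1)^4 (`Round.card_le`). So 3(h+1)^4 ln |U| drops by at least 3 per round, and once
U is small one mistake per node is affordable (`Loop.mistakes_le`).

Running time. A small language of expressions and bounded loops gets a total functional semantics
and a compiler, verified once together with a polynomial time bound (`Stmt.exec_compile`); the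
algorithm is then analysed as a function on states. Distances are computed by Bellman–Ford
(`distances_spec`), which makes goodness decidable by arithmetic. The main loop makes one trial per
pass and remembers its phase. Each node stores the time of its labelling, with time running
backwards, so every earlier unlabelled set is a threshold set and the scores fixed at the start of a
step can be recomputed later. The program never tests for the absence of good quadruples: a
superfluous round is itself an admissible sequence of arbitrary predictions (`completes_start`). -/

/-- Started in `s`, the program `P` halts after at most `T` steps in a state satisfying `Q`. -/
def Halts (G : SimpleGraph (Fin n)) (y : Fin n → Bool) (P : Prog) (s : State n) (T : ℕ)
    (Q : State n → Prop) : Prop :=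
  ∃ t s', Exec G y P s t s' ∧ t ≤ T ∧ Q s'

theorem Halts.mono {P : Prog} {s : State n} {T T' : ℕ} {Q Q' : State n → Prop}
    (h : Halts G y P s T Q) (hT : T ≤ T') (hQ : ∀ s', Q s' → Q' s') : Halts G y P s T' Q' := by
  obtain ⟨t, s', h1, h2, h3⟩ := h
  exact ⟨t, s', h1, h2.trans hT, hQ _ h3⟩

theorem Halts.op {o : Op} {s : State n} {Q : State n → Prop} (h : Q (o.exec G y s)) :
    Halts G y (.op o) s 1 Q :=
  ⟨1, _, .op o s, le_rfl, h⟩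

theorem Halts.seq {P P' : Prog} {s : State n} {T T' : ℕ} {Q : State n → Prop}
    (h : Halts G y P s T fun s' => Halts G y P' s' T' Q) : Halts G y (.seq P P') s (T + T') Q := by
  obtain ⟨t, s', h1, h2, t', s'', h3, h4, h5⟩ := h
  exact ⟨t + t', s'', .seq _ _ _ _ _ _ _ h1 h3, by omega, h5⟩

theorem Halts.op_seq {o : Op} {P' : Prog} {s : State n} {T' : ℕ} {Q : State n → Prop}
    (h : Halts G y P' (o.exec G y s) T' Q) : Halts G y (.seq (.op o) P') s (T' + 1) Q := by
  rw [add_comm]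
  exact Halts.seq (Halts.op h)

theorem Halts.ite {r : ℕ} {P P' : Prog} {s : State n} {T T' : ℕ} {Q : State n → Prop}
    (h1 : s.reg r ≠ 0 → Halts G y P s T Q) (h2 : s.reg r = 0 → Halts G y P' s T' Q) :
    Halts G y (.ite r P P') s (T + T' + 1) Q := by
  by_cases h : s.reg r = 0
  · obtain ⟨t, s', h3, h4, h5⟩ := h2 h
    exact ⟨t + 1, s', .ite_false _ _ _ _ _ _ h h3, by omega, h5⟩
  · obtain ⟨t, s', h3, h4, h5⟩ := h1 h
    exact ⟨t + 1, s', .ite_true _ _ _ _ _ _ h h3, by omega, h5⟩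

/-- The rule for a loop that is controlled by a register counting down from `N`. -/
theorem Halts.countdown {c : ℕ} {P : Prog} {T N : ℕ} {I : ℕ → State n → Prop}
    (hI : ∀ k s, k < N → I k s → s.reg c = N - k →
      Halts G y P s T fun s' => I (k + 1) s' ∧ s'.reg c = N - (k + 1))
    {s : State n} (h0 : I 0 s) (hc : s.reg c = N) :
    Halts G y (.while c P) s (N * (T + 1) + 1) (I N) := by
  suffices H : ∀ j k s, j + k = N → I k s → s.reg c = j →
      Halts G y (.while c P) s (j * (T + 1) + 1) (I N) from H N 0 s (by omega) h0 hc
  intro j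
  induction j with
  | zero =>
    intro k s hk hs hc
    exact ⟨1, s, .while_false _ _ _ hc, by omega, (show k = N by omega) ▸ hs⟩
  | succ j ih =>
    intro k s hk hs hc
    obtain ⟨t, s', h1, h2, h3, h4⟩ := hI k s (by omega) hs (by omega)
    obtain ⟨t', s'', h5, h6, h7⟩ := ih (k + 1) s' (by omega) h3 (by omega)
    refine ⟨t + t' + 1, s'', .while_true _ _ _ _ _ _ _ (by omega) h1 h5, ?_, h7⟩
    have : (j + 1) * (T + 1) = j * (T + 1) + (T + 1) := by ring
    omega

/-! ### Expressions -/

/-- Registers below `numVars` serve as variables, the others as temporary storage. -/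
def numVars : ℕ := 40

/-- Expressions; `sum i a` is the sum of `a` over all values of the variable `i` below `n`. -/
inductive Exp where
  | const (k : ℕ)
  | var (i : ℕ)
  | add (a b : Exp)
  | sub (a b : Exp)
  | load (a : Exp)
  | adj (a b : Exp)
  | ite (c a b : Exp)
  | sum (i : ℕ) (a : Exp)

/-- The value of an expression. -/
noncomputable def Exp.eval (G : SimpleGraph (Fin n)) (m : ℕ → ℕ) : Exp → (ℕ → ℕ) → ℕ
  | .const k, _ => k
  | .var i, ρ => ρ i
  | .add a b, ρ => a.eval G m ρ + b.eval G m ρ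
  | .sub a b, ρ => a.eval G m ρ - b.eval G m ρ
  | .load a, ρ => m (a.eval G m ρ)
  | .adj a b, ρ => adjBit G (a.eval G m ρ) (b.eval G m ρ)
  | .ite c a b, ρ => if c.eval G m ρ = 0 then b.eval G m ρ else a.eval G m ρ
  | .sum i a, ρ => ∑ k ∈ Finset.range n, a.eval G m (Function.update ρ i k)

/-- All variables are below `numVars`, and the variable `0` is not bound. -/
def Exp.wf : Exp → Bool
  | .const _ => true
  | .var i => decide (i < numVars)
  | .add a b => a.wf && b.wf
  | .sub a b => a.wf && b.wf
  | .load a => a.wf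
  | .adj a b => a.wf && b.wf
  | .ite c a b => c.wf && (a.wf && b.wf)
  | .sum i a => decide (0 < i) && (decide (i < numVars) && a.wf)

/-- The program that evaluates an expression and leaves the value in register `r`, using only
registers from `r` on and restoring the bound variables. -/
def Exp.compile : Exp → ℕ → Prog
  | .const k, r => .op (.const r k)
  | .var i, r => .op (.copy r i)
  | .add a b, r => .seq (a.compile r) (.seq (b.compile (r + 1)) (.op (.add r r (r + 1))))
  | .sub a b, r => .seq (a.compile r) (.seq (b.compile (r + 1)) (.op (.sub r r (r + 1))))
  | .load a, r => .seq (a.compile r) (.op (.load r r))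
  | .adj a b, r => .seq (a.compile r) (.seq (b.compile (r + 1)) (.op (.adj r r (r + 1))))
  | .ite c a b, r => .seq (c.compile r) (.ite r (a.compile r) (b.compile r))
  | .sum i a, r =>
    .seq (.op (.copy (r + 1) i)) <| .seq (.op (.const i 0)) <| .seq (.op (.const r 0)) <|
    .seq (.op (.copy (r + 2) 0)) <|
    .seq (.while (r + 2) <| .seq (a.compile (r + 3)) <| .seq (.op (.add r r (r + 3))) <|
      .seq (.op (.const (r + 3) 1)) <| .seq (.op (.add i i (r + 3))) <|
      .op (.sub (r + 2) (r + 2) (r + 3))) <|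
    .op (.copy i (r + 1))

/-- A bound for the running time of a compiled expression. -/
noncomputable def Exp.time : Exp → Polynomial ℕ
  | .const _ => 1
  | .var _ => 1
  | .add a b => a.time + (b.time + 1)
  | .sub a b => a.time + (b.time + 1)
  | .load a => a.time + 1
  | .adj a b => a.time + (b.time + 1)
  | .ite c a b => c.time + (a.time + b.time + 1)
  | .sum _ a => Polynomial.X * (a.time + 5) + 6

/-- This makes temporaries harmless: intermediate evaluations disturb only registers from `numVars`
on. -/
theorem Exp.eval_congr {m : ℕ → ℕ} {e : Exp} (he : e.wf = true) {ρ ρ' : ℕ → ℕ}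
    (h : ∀ j < numVars, ρ j = ρ' j) : e.eval G m ρ = e.eval G m ρ' := by
  induction e generalizing ρ ρ' with
  | const k => rfl
  | var i => exact h i (by simpa [Exp.wf] using he)
  | add a b iha ihb | sub a b iha ihb | adj a b iha ihb =>
    simp only [Exp.wf, Bool.and_eq_true] at he
    simp only [Exp.eval, iha he.1 h, ihb he.2 h]
  | load a iha =>
    simp only [Exp.wf] at he
    simp only [Exp.eval, iha he h]
  | ite c a b ihc iha ihb =>
    simp only [Exp.wf, Bool.and_eq_true] at he
    simp only [Exp.eval, ihc he.1 h, iha he.2.1 h, ihb he.2.2 h]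
  | sum i a iha =>
    simp only [Exp.wf, Bool.and_eq_true] at he
    simp only [Exp.eval]
    refine Finset.sum_congr rfl fun k _ => iha he.2.2 fun j hj => ?_
    by_cases hji : j = i <;> simp [hji, h j hj]

/-- The states `s` and `s'` differ at most in the registers from `r` on. -/
def SameBelow (r : ℕ) (s s' : State n) : Prop :=
  (∀ j < r, s'.reg j = s.reg j) ∧ s'.mem = s.mem ∧ s'.trials = s.trials

/-- The frame condition drives the induction: a second operand works from `r + 1` on, so the value
of the first one survives in `r`. -/
theorem Exp.compile_spec {e : Exp} (he : e.wf = true) {r : ℕ} (hr : numVars ≤ r) {s : State n}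
    (hs : s.reg 0 = n) :
    Halts G y (e.compile r) s (e.time.eval n)
      fun s' => s'.reg r = e.eval G s.mem s.reg ∧ SameBelow r s s' := by
  have hpos : 0 < numVars := by decide
  induction e generalizing r s with
  | const k =>
    simp only [Exp.time, Polynomial.eval_one]
    refine Halts.op ⟨?_, ?_, rfl, rfl⟩
    · simp [Op.exec, State.set, Exp.eval]
    · intro j hj
      simp [Op.exec, State.set, hj.ne]
  | var i =>
    simp only [Exp.time, Polynomial.eval_one]
    refine Halts.op ⟨?_, ?_, rfl, rfl⟩
    · simp [Op.exec, State.set, Exp.eval]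
    · intro j hj
      simp [Op.exec, State.set, hj.ne]
  | add a b iha ihb | sub a b iha ihb | adj a b iha ihb =>
    simp only [Exp.wf, Bool.and_eq_true] at he
    simp only [Exp.time, Polynomial.eval_add, Polynomial.eval_one]
    refine Halts.seq ((iha he.1 hr hs).mono le_rfl ?_)
    rintro s1 ⟨h1, h2, h3, h4⟩
    refine Halts.seq ((ihb he.2 (r := r + 1) (by omega)
      (by rw [h2 0 (by omega), hs])).mono le_rfl ?_)
    rintro s2 ⟨h5, h6, h7, h8⟩
    have hb := Exp.eval_congr (G := G) (m := s.mem) he.2 (ρ := s1.reg) (ρ' := s.reg)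
      fun j hj => h2 j (by omega)
    refine Halts.op ⟨?_, fun j hj => ?_, by simp [Op.exec, State.set, h7, h3],
      by simp [Op.exec, State.set, h8, h4]⟩
    · simp [Op.exec, State.set, Exp.eval, h5, h6 r (by omega), h1, h3, hb]
    · simp [Op.exec, State.set, hj.ne, h6 j (by omega), h2 j hj]
  | load a iha =>
    simp only [Exp.wf] at he
    simp only [Exp.time, Polynomial.eval_add, Polynomial.eval_one]
    refine Halts.seq ((iha he hr hs).mono le_rfl ?_)
    rintro s1 ⟨h1, h2, h3, h4⟩
    refine Halts.op ⟨?_, fun j hj => ?_, by simp [Op.exec, State.set, h3],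
      by simp [Op.exec, State.set, h4]⟩
    · simp [Op.exec, State.set, Exp.eval, h1, h3]
    · simp [Op.exec, State.set, hj.ne, h2 j hj]
  | ite c a b ihc iha ihb =>
    simp only [Exp.wf, Bool.and_eq_true] at he
    simp only [Exp.time, Polynomial.eval_add, Polynomial.eval_one]
    refine Halts.seq ((ihc he.1 hr hs).mono le_rfl ?_)
    rintro s1 ⟨h1, h2, h3, h4⟩
    have hs1 : s1.reg 0 = n := by rw [h2 0 (by omega), hs]
    refine Halts.ite (fun h => (iha he.2.1 hr hs1).mono le_rfl ?_)
      (fun h => (ihb he.2.2 hr hs1).mono le_rfl ?_)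
    · rintro s2 ⟨h5, h6, h7, h8⟩
      have hb := Exp.eval_congr (G := G) (m := s.mem) he.2.1 (ρ := s1.reg) (ρ' := s.reg)
        fun j hj => h2 j (by omega)
      rw [h1] at h
      refine ⟨by simp [Exp.eval, h, h5, h3, hb], fun j hj => ?_, h7.trans h3, h8.trans h4⟩
      rw [h6 j hj, h2 j hj]
    · rintro s2 ⟨h5, h6, h7, h8⟩
      have hb := Exp.eval_congr (G := G) (m := s.mem) he.2.2 (ρ := s1.reg) (ρ' := s.reg)
        fun j hj => h2 j (by omega)
      rw [h1] at h
      refine ⟨by simp [Exp.eval, h, h5, h3, hb], fun j hj => ?_, h7.trans h3, h8.trans h4⟩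
      rw [h6 j hj, h2 j hj]
  | sum i a iha =>
    simp only [Exp.wf, Bool.and_eq_true, decide_eq_true_eq] at he
    obtain ⟨hi0, hi, ha⟩ := he
    -- Each pass costs the body, four instructions and a test. The other six steps are four initial
    -- instructions, the last test and the copy that restores `i`.
    have htime : (Exp.sum i a).time.eval n =
        n * ((a.time.eval n + 1 + 1 + 1 + 1) + 1) + 1 + 1 + 1 + 1 + 1 + 1 := by
      simp [Exp.time]
    rw [htime]
    refine Halts.op_seq (Halts.op_seq (Halts.op_seq (Halts.op_seq ?_)))
    -- Register `r` accumulates, `r + 1` saves the old value of `i`, and `r + 2` counts down. The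
    -- variable `i` is exempt from the frame condition until the final copy.
    set I : ℕ → State n → Prop := fun k s' =>
      s'.reg r = ∑ j ∈ Finset.range k, a.eval G s.mem (Function.update s.reg i j) ∧
      s'.reg i = k ∧ s'.reg (r + 1) = s.reg i ∧ (∀ j < r, j ≠ i → s'.reg j = s.reg j) ∧
      s'.mem = s.mem ∧ s'.trials = s.trials with hI
    refine Halts.seq (T := n * (a.time.eval n + 1 + 1 + 1 + 1 + 1) + 1) (T' := 1)
      ((Halts.countdown (I := I) (N := n)
      (T := a.time.eval n + 1 + 1 + 1 + 1) ?_ ?_ ?_).mono le_rfl ?_)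
    · rintro k s1 hk ⟨h1, h2, h3, h4, h5, h6⟩ hc
      rw [show a.time.eval n + 1 + 1 + 1 + 1 = a.time.eval n + (1 + 1 + 1 + 1) by ring]
      refine Halts.seq ((iha ha (r := r + 3) (s := s1) (by omega)
        (by rw [h4 0 (by omega) (by omega), hs])).mono le_rfl ?_)
      rintro s2 ⟨g1, g2, g3, g4⟩
      refine Halts.op_seq (Halts.op_seq (Halts.op_seq (Halts.op ?_)))
      have hb := Exp.eval_congr (G := G) (m := s.mem) ha (ρ := s1.reg)
        (ρ' := Function.update s.reg i k) (fun j hj => by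
          by_cases hji : j = i
          · simp [hji, h2]
          · simp [hji, h4 j (by omega) hji])
      have hir : i ≠ r := by omega
      refine ⟨⟨?_, ?_, ?_, fun j hj hji => ?_, ?_, ?_⟩, ?_⟩
      · rw [Finset.sum_range_succ, ← h1, ← hb]
        simp [Op.exec, State.set, Function.update_apply, hir.symm, g1, g2 r (by omega), h5]
      · simp [Op.exec, State.set, Function.update_apply, hir, g2 i (by omega), h2,
          show i ≠ r + 2 by omega, show i ≠ r + 3 by omega]
      · simp [Op.exec, State.set, Function.update_apply, g2 (r + 1) (by omega), h3,
          show r + 1 ≠ i by omega]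
      · simp [Op.exec, State.set, Function.update_apply, g2 j (by omega), h4 j hj hji, hji,
          hj.ne, show j ≠ r + 2 by omega, show j ≠ r + 3 by omega]
      · simp [Op.exec, State.set, g3, h5]
      · simp [Op.exec, State.set, g4, h6]
      · simp [Op.exec, State.set, Function.update_apply, g2 (r + 2) (by omega), hc,
          show r + 2 ≠ i by omega, show r + 3 ≠ i by omega, Nat.sub_sub]
    · refine ⟨?_, ?_, ?_, fun j hj hji => ?_, rfl, rfl⟩
      · simp [Op.exec, State.set, Function.update_apply]
      · simp [Op.exec, State.set, Function.update_apply, show i ≠ r + 2 by omega,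
          show i ≠ r by omega]
      · simp [Op.exec, State.set, Function.update_apply, show r + 1 ≠ i by omega]
      · simp [Op.exec, State.set, Function.update_apply, hji, hj.ne,
          show j ≠ r + 2 by omega, show j ≠ r + 1 by omega]
    · simp [Op.exec, State.set, hs, show 0 ≠ r by omega, hi0.ne]
    · rintro s1 ⟨h1, h2, h3, h4, h5, h6⟩
      refine Halts.op ⟨?_, fun j hj => ?_, ?_, ?_⟩
      · simp [Op.exec, State.set, show r ≠ i by omega, h1, Exp.eval]
      · by_cases hji : j = i
        · simp [Op.exec, State.set, hji, h3]
        · simp [Op.exec, State.set, hji, h4 j hj hji]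
      · simp [Op.exec, State.set, h5]
      · simp [Op.exec, State.set, h6]

end Machine

end Good4

namespace Good4

/-! ### Statements -/

section Stmt

variable {n : ℕ} {G : SimpleGraph (Fin n)} {y : Fin n → Bool}

/-- A small imperative language; `loop i S` runs `S` for all values of `i` below `n`. -/
inductive Stmt where
  | assign (i : ℕ) (e : Exp)
  | store (a b : Exp)
  | predict (i : ℕ) (a b : Exp)
  | seq (S S' : Stmt)
  | ite (c : Exp) (S S' : Stmt)
  | loop (i : ℕ) (S : Stmt)

/-- Write `x` to the memory cell `p`. -/
def State.put (s : State n) (p x : ℕ) : State n :=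
  { s with mem := Function.update s.mem p x }

/-- Predict a label for node `v`, and store the true label in register `i`. -/
def State.ask (y : Fin n → Bool) (s : State n) (i v x : ℕ) : State n :=
  if h : v < n then
    { s with
      reg := Function.update s.reg i (y ⟨v, h⟩).toNat
      trials := s.trials ++ [⟨⟨v, h⟩, decide (x ≠ 0), y ⟨v, h⟩⟩] }
  else s

/-- Apply `f 0`, `f 1`, ..., `f (k - 1)` in this order. -/
def iter {α : Type*} (f : ℕ → α → α) : ℕ → α → α
  | 0, s => s
  | k + 1, s => f k (iter f k s)

/-- The value of an expression in a state. -/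
noncomputable def State.val (G : SimpleGraph (Fin n)) (s : State n) (e : Exp) : ℕ :=
  e.eval G s.mem s.reg

/-- The effect of a statement. -/
noncomputable def Stmt.run (G : SimpleGraph (Fin n)) (y : Fin n → Bool) :
    Stmt → State n → State n
  | .assign i e, s => s.set i (s.val G e)
  | .store a b, s => s.put (s.val G a) (s.val G b)
  | .predict i a b, s => s.ask y i (s.val G a) (s.val G b)
  | .seq S S', s => S'.run G y (S.run G y s)
  | .ite c S S', s => if s.val G c = 0 then S'.run G y s else S.run G y s
  | .loop i S, s => iter (fun k s => S.run G y (s.set i k)) n s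

/-- All variables are below `numVars`, and the variable `0` is not written to. -/
def Stmt.wf : Stmt → Bool
  | .assign i e => decide (0 < i) && (decide (i < numVars) && e.wf)
  | .store a b => a.wf && b.wf
  | .predict i a b => decide (0 < i) && (decide (i < numVars) && (a.wf && b.wf))
  | .seq S S' => S.wf && S'.wf
  | .ite c S S' => c.wf && (S.wf && S'.wf)
  | .loop i S => decide (0 < i) && (decide (i < numVars) && S.wf)

/-- The program for a statement, with temporary storage in the registers from `r` on. -/
def Stmt.compile : Stmt → ℕ → Prog
  | .assign i e, r => .seq (e.compile r) (.op (.copy i r))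
  | .store a b, r => .seq (a.compile r) (.seq (b.compile (r + 1)) (.op (.store r (r + 1))))
  | .predict i a b, r =>
    .seq (a.compile r) (.seq (b.compile (r + 1)) (.op (.predict i r (r + 1))))
  | .seq S S', r => .seq (S.compile r) (S'.compile r)
  | .ite c S S', r => .seq (c.compile r) (.ite r (S.compile r) (S'.compile r))
  | .loop i S, r =>
    .seq (.op (.copy r 0)) <| .seq (.op (.const (r + 1) 0)) <|
    .while r <| .seq (.op (.copy i (r + 1))) <| .seq (S.compile (r + 2)) <|
      .seq (.op (.const (r + 2) 1)) <| .seq (.op (.add (r + 1) (r + 1) (r + 2))) <|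
      .op (.sub r r (r + 2))

/-- A bound for the running time of a compiled statement. -/
noncomputable def Stmt.time : Stmt → Polynomial ℕ
  | .assign _ e => e.time + 1
  | .store a b => a.time + (b.time + 1)
  | .predict _ a b => a.time + (b.time + 1)
  | .seq S S' => S.time + S'.time
  | .ite c S S' => c.time + (S.time + S'.time + 1)
  | .loop _ S => Polynomial.X * (S.time + 5) + 3

/-- The states `s` and `s'` differ at most in the temporary storage. -/
def Similar (s s' : State n) : Prop :=
  (∀ j < numVars, s.reg j = s'.reg j) ∧ s.mem = s'.mem ∧ s.trials = s'.trials

theorem Similar.val_eq {s s' : State n} (h : Similar s s') {e : Exp} (he : e.wf = true) :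
    s.val G e = s'.val G e := by
  rw [State.val, State.val, h.2.1]
  exact Exp.eval_congr he h.1

theorem SameBelow.similar {s s' s'' : State n} {r : ℕ} (h : SameBelow r s s')
    (hr : numVars ≤ r) (hs : Similar s s'') : Similar s' s'' :=
  ⟨fun j hj => (h.1 j (hj.trans_le hr)).trans (hs.1 j hj), h.2.1.trans hs.2.1,
    h.2.2.trans hs.2.2⟩

theorem Exp.compile_val {e : Exp} (he : e.wf = true) {r : ℕ} (hr : numVars ≤ r) {s σ : State n}
    (hs : Similar s σ) (h0 : σ.reg 0 = n) :
    Halts G y (e.compile r) s (e.time.eval n)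
      fun s' => s'.reg r = σ.val G e ∧ Similar s' σ ∧ ∀ j < r, s'.reg j = s.reg j := by
  refine (Exp.compile_spec he hr ((hs.1 0 (by decide)).trans h0)).mono le_rfl ?_
  rintro s' ⟨h1, h2⟩
  exact ⟨h1.trans (hs.val_eq he), h2.similar hr hs, h2.1⟩

theorem Stmt.run_reg_zero {S : Stmt} (hS : S.wf = true) {s : State n} (h0 : s.reg 0 = n) :
    (S.run G y s).reg 0 = n := by
  induction S generalizing s with
  | assign i e =>
    simp only [Stmt.wf, Bool.and_eq_true, decide_eq_true_eq] at hS
    simpa [Stmt.run, State.set, hS.1.ne] using h0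
  | store a b => exact h0
  | predict i a b =>
    simp only [Stmt.wf, Bool.and_eq_true, decide_eq_true_eq] at hS
    simp only [Stmt.run, State.ask]
    split_ifs
    · simpa [hS.1.ne] using h0
    · exact h0
  | seq S S' ih ih' =>
    simp only [Stmt.wf, Bool.and_eq_true] at hS
    exact ih' hS.2 (ih hS.1 h0)
  | ite c S S' ih ih' =>
    simp only [Stmt.wf, Bool.and_eq_true] at hS
    simp only [Stmt.run]
    split_ifs
    exacts [ih' hS.2.2 h0, ih hS.2.1 h0]
  | loop i S ih =>
    simp only [Stmt.wf, Bool.and_eq_true, decide_eq_true_eq] at hS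
    simp only [Stmt.run]
    suffices H : ∀ k, (iter (fun k s => S.run G y (s.set i k)) k s).reg 0 = n from H n
    intro k
    induction k with
    | zero => exact h0
    | succ k ihk => exact ih hS.2.2 (by simpa [State.set, hS.1.ne] using ihk)

/-- The machine follows the functional semantics only up to temporaries. The second conclusion
protects those temporaries below `r` that hold the counters of enclosing loops. -/
theorem Stmt.compile_spec {S : Stmt} (hS : S.wf = true) {r : ℕ} (hr : numVars ≤ r)
    {s σ : State n} (hs : Similar s σ) (h0 : σ.reg 0 = n) :
    Halts G y (S.compile r) s (S.time.eval n)
      fun s' => Similar s' (S.run G y σ) ∧ ∀ j < r, numVars ≤ j → s'.reg j = s.reg j := by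
  induction S generalizing r s σ with
  | assign i e =>
    simp only [Stmt.wf, Bool.and_eq_true, decide_eq_true_eq] at hS
    simp only [Stmt.time, Polynomial.eval_add, Polynomial.eval_one]
    refine Halts.seq ((Exp.compile_val hS.2.2 hr hs h0).mono le_rfl ?_)
    rintro s1 ⟨h1, h2, h3⟩
    refine Halts.op ⟨⟨fun j hj => ?_, h2.2.1, h2.2.2⟩, fun j hj hj' => ?_⟩
    · by_cases hji : j = i <;> simp [Op.exec, Stmt.run, State.set, hji, h1, h2.1 j hj]
    · simp [Op.exec, State.set, show j ≠ i by omega, h3 j hj]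
  | store a b =>
    simp only [Stmt.wf, Bool.and_eq_true] at hS
    simp only [Stmt.time, Polynomial.eval_add, Polynomial.eval_one]
    refine Halts.seq ((Exp.compile_val hS.1 hr hs h0).mono le_rfl ?_)
    rintro s1 ⟨h1, h2, h3⟩
    refine Halts.seq ((Exp.compile_val hS.2 (r := r + 1) (by omega) h2 h0).mono le_rfl ?_)
    rintro s2 ⟨h4, h5, h6⟩
    refine Halts.op ⟨⟨h5.1, ?_, h5.2.2⟩, fun j hj hj' => ?_⟩
    · simp [Op.exec, Stmt.run, State.put, h4, h6 r (by omega), h1, h5.2.1]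
    · simp [Op.exec, h6 j (by omega), h3 j hj]
  | predict i a b =>
    simp only [Stmt.wf, Bool.and_eq_true, decide_eq_true_eq] at hS
    simp only [Stmt.time, Polynomial.eval_add, Polynomial.eval_one]
    refine Halts.seq ((Exp.compile_val hS.2.2.1 hr hs h0).mono le_rfl ?_)
    rintro s1 ⟨h1, h2, h3⟩
    refine Halts.seq ((Exp.compile_val hS.2.2.2 (r := r + 1) (by omega) h2 h0).mono le_rfl ?_)
    rintro s2 ⟨h4, h5, h6⟩
    have h1' : s2.reg r = σ.val G a := (h6 r (by omega)).trans h1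
    by_cases hv : σ.val G a < n
    · refine Halts.op ⟨⟨fun j hj => ?_, ?_, ?_⟩, fun j hj hj' => ?_⟩
      · by_cases hji : j = i <;>
          simp [Op.exec, Stmt.run, State.ask, h1', hv, hji, h5.1 j hj]
      · simp [Op.exec, Stmt.run, State.ask, h1', hv, h5.2.1]
      · simp [Op.exec, Stmt.run, State.ask, h1', hv, h5.2.2, h4]
      · simp [Op.exec, h1', hv, show j ≠ i by omega, h6 j (by omega), h3 j hj]
    · refine Halts.op ⟨⟨fun j hj => ?_, ?_, ?_⟩, fun j hj hj' => ?_⟩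
      · simp [Op.exec, Stmt.run, State.ask, h1', hv, h5.1 j hj]
      · simp [Op.exec, Stmt.run, State.ask, h1', hv, h5.2.1]
      · simp [Op.exec, Stmt.run, State.ask, h1', hv, h5.2.2]
      · simp [Op.exec, h1', hv, h6 j (by omega), h3 j hj]
  | seq S S' ih ih' =>
    simp only [Stmt.wf, Bool.and_eq_true] at hS
    simp only [Stmt.time, Polynomial.eval_add]
    refine Halts.seq ((ih hS.1 hr hs h0).mono le_rfl ?_)
    rintro s1 ⟨h1, h2⟩
    refine (ih' hS.2 hr h1 (Stmt.run_reg_zero hS.1 h0)).mono le_rfl ?_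
    rintro s2 ⟨h3, h4⟩
    exact ⟨h3, fun j hj hj' => (h4 j hj hj').trans (h2 j hj hj')⟩
  | ite c S S' ih ih' =>
    simp only [Stmt.wf, Bool.and_eq_true] at hS
    simp only [Stmt.time, Polynomial.eval_add, Polynomial.eval_one]
    refine Halts.seq ((Exp.compile_val hS.1 hr hs h0).mono le_rfl ?_)
    rintro s1 ⟨h1, h2, h3⟩
    refine Halts.ite (fun h => (ih hS.2.1 hr h2 h0).mono le_rfl ?_)
      (fun h => (ih' hS.2.2 hr h2 h0).mono le_rfl ?_)
    · rintro s2 ⟨h4, h5⟩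
      rw [h1] at h
      exact ⟨by simpa [Stmt.run, h] using h4, fun j hj hj' => (h5 j hj hj').trans (h3 j hj)⟩
    · rintro s2 ⟨h4, h5⟩
      rw [h1] at h
      exact ⟨by simpa [Stmt.run, h] using h4, fun j hj hj' => (h5 j hj hj').trans (h3 j hj)⟩
  | loop i S ih =>
    simp only [Stmt.wf, Bool.and_eq_true, decide_eq_true_eq] at hS
    obtain ⟨hi0, hi, hS⟩ := hS
    have htime : (Stmt.loop i S).time.eval n =
        n * ((S.time.eval n + (1 + 1 + 1) + 1) + 1) + 1 + 1 + 1 := by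
      simp [Stmt.time]
    rw [htime]
    refine Halts.op_seq (Halts.op_seq ?_)
    set f : ℕ → State n → State n := fun k s => S.run G y (s.set i k) with hf
    have hreg0 : ∀ k, (iter f k σ).reg 0 = n := by
      intro k
      induction k with
      | zero => exact h0
      | succ k ihk => exact Stmt.run_reg_zero hS (by simpa [State.set, hi0.ne] using ihk)
    have hsn : s.reg 0 = n := (hs.1 0 (by decide)).trans h0
    -- The index lives in `r + 1` and is copied to `i` before each pass, so the body may overwrite
    -- `i`.
    refine (Halts.countdown (N := n) (T := S.time.eval n + (1 + 1 + 1) + 1)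
      (I := fun k s' => Similar s' (iter f k σ) ∧ s'.reg (r + 1) = k ∧
        ∀ j < r, numVars ≤ j → s'.reg j = s.reg j) ?_ ?_ ?_).mono le_rfl ?_
    · rintro k s1 hk ⟨h1, h2, h3⟩ hc
      refine Halts.op_seq ?_
      have hsim : Similar ((Op.copy i (r + 1)).exec G y s1) ((iter f k σ).set i k) := by
        refine ⟨fun j hj => ?_, h1.2.1, h1.2.2⟩
        by_cases hji : j = i <;> simp [Op.exec, State.set, hji, h2, h1.1 j hj]
      refine Halts.seq ((ih hS (r := r + 2) (by omega) hsim
        (by simpa [State.set, hi0.ne] using hreg0 k)).mono le_rfl ?_)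
      rintro s2 ⟨g1, g2⟩
      have e1 := g2 (r + 1) (by omega) (by omega)
      have e0 := g2 r (by omega) (by omega)
      simp only [Op.exec, State.set, ne_eq, show r + 1 ≠ i by omega, show r ≠ i by omega,
        not_false_eq_true, Function.update_of_ne, h2, hc] at e1 e0
      refine Halts.op_seq (Halts.op_seq (Halts.op ⟨⟨⟨fun j hj => ?_, g1.2.1, g1.2.2⟩, ?_,
        fun j hj hj' => ?_⟩, ?_⟩))
      · simp [Op.exec, State.set, show j ≠ r by omega,
          show j ≠ r + 1 by omega, show j ≠ r + 2 by omega, g1.1 j hj, iter, hf]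
      · simp [Op.exec, State.set, e1]
      · have := g2 j (by omega) hj'
        simp [Op.exec, State.set, show j ≠ i by omega] at this
        simp [Op.exec, State.set, show j ≠ r by omega,
          show j ≠ r + 1 by omega, show j ≠ r + 2 by omega, this, h3 j hj hj']
      · simp [Op.exec, State.set, e0, Nat.sub_sub]
    · refine ⟨⟨fun j hj => ?_, hs.2.1, hs.2.2⟩, ?_, fun j hj hj' => ?_⟩
      · simp [Op.exec, State.set, show j ≠ r by omega, show j ≠ r + 1 by omega, iter,
          hs.1 j hj]
      · simp [Op.exec, State.set]
      · simp [Op.exec, State.set, show j ≠ r by omega, show j ≠ r + 1 by omega]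
    · simp [Op.exec, State.set, hsn]
    · rintro s1 ⟨h1, -, h3⟩
      exact ⟨h1, h3⟩

/-- A statement runs on the machine in polynomial time. -/
theorem Stmt.exec_compile {S : Stmt} (hS : S.wf = true) (G : SimpleGraph (Fin n))
    (y : Fin n → Bool) :
    ∃ t s, Exec G y (S.compile numVars) (State.init n) t s ∧ t ≤ S.time.eval n ∧
      s.trials = (S.run G y (State.init n)).trials := by
  obtain ⟨t, s, h1, h2, h3, -⟩ := Stmt.compile_spec (G := G) (y := y) hS le_rfl
    (s := State.init n) (σ := State.init n) ⟨fun _ _ => rfl, rfl, rfl⟩ rfl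
  exact ⟨t, s, h1, h2, h3.2.2⟩

end Stmt

end Good4

namespace Good4

/-! ### Good quadruples and scores -/

section Scores

open scoped Classical in
/-- The number of elements of a finite set with a given property. -/
noncomputable def count {α : Type*} (U : Finset α) (P : α → Prop) : ℕ := (U.filter P).card

variable {V : Type*} {G : SimpleGraph V}

/-- The four nodes are distinct, and the intervals `I(a,b)` and `I(c,d)` intersect. -/
def Good (G : SimpleGraph V) (a b c d : V) : Prop :=
  [a, b, c, d].Nodup ∧ (interval G a b ∩ interval G c d).Nonempty

theorem interval_comm (G : SimpleGraph V) (u v : V) : interval G u v = interval G v u := by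
  have H : ∀ u v, interval G u v ⊆ interval G v u := by
    rintro u v x ⟨p, hp, hx⟩
    exact ⟨p.reverse, by rw [SimpleGraph.Walk.length_reverse, hp, SimpleGraph.dist_comm],
      by simpa using hx⟩
  exact (H u v).antisymm (H v u)

/-- A node on a shortest path cuts it into two shortest pieces, and shortest pieces with the right
total length can be concatenated. This reduces intervals to arithmetic on distances, both for the
minor and for the machine. -/
theorem mem_interval_iff (hG : G.Connected) {u v x : V} :
    x ∈ interval G u v ↔ G.dist u x + G.dist x v = G.dist u v := by
  classical
  constructor
  · rintro ⟨p, hp, hx⟩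
    have h1 := congrArg SimpleGraph.Walk.length (p.take_spec hx)
    rw [SimpleGraph.Walk.length_append] at h1
    have h2 := SimpleGraph.dist_le (p.takeUntil x hx)
    have h3 := SimpleGraph.dist_le (p.dropUntil x hx)
    have h4 := hG.dist_triangle (u := u) (v := x) (w := v)
    omega
  · intro h
    obtain ⟨p, hp⟩ := (hG u x).exists_walk_length_eq_dist
    obtain ⟨q, hq⟩ := (hG x v).exists_walk_length_eq_dist
    exact ⟨p.append q, by rw [SimpleGraph.Walk.length_append, hp, hq, h], by simp⟩

theorem Good.comm_left {a b c d : V} : Good G a b c d ↔ Good G b a c d := by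
  unfold Good
  rw [interval_comm G a b]
  simp only [List.nodup_cons, List.mem_cons]
  aesop

theorem Good.comm_right {a b c d : V} : Good G a b c d ↔ Good G a b d c := by
  unfold Good
  rw [interval_comm G c d]
  simp only [List.nodup_cons, List.mem_cons]
  aesop

theorem Good.swap {a b c d : V} : Good G a b c d ↔ Good G c d a b := by
  unfold Good
  rw [Set.inter_comm]
  simp only [List.nodup_cons, List.mem_cons]
  aesop

/-- Goodness is invariant under the eight symmetries of a pair of pairs, so any ordered
representative may be tested. -/
theorem mem_goodQuads {U : Finset V} {a b c d : V} :
    s(s(a, b), s(c, d)) ∈ goodQuads G U ↔ a ∈ U ∧ b ∈ U ∧ c ∈ U ∧ d ∈ U ∧ Good G a b c d := by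
  constructor
  · rintro ⟨a', ha, b', hb, c', hc, d', hd, h1, h2, h3⟩
    have hg : Good G a' b' c' d' := ⟨h1, h2⟩
    have hg1 := Good.comm_left.1 hg
    have hg2 := Good.comm_right.1 hg
    have hg3 := Good.comm_right.1 hg1
    have hg4 := Good.swap.1 hg
    have hg5 := Good.swap.1 hg1
    have hg6 := Good.swap.1 hg2
    have hg7 := Good.swap.1 hg3
    simp only [Sym2.eq, Sym2.rel_iff', Prod.mk.injEq, Prod.swap_prod_mk] at h3
    rcases h3 with ⟨⟨rfl, rfl⟩ | ⟨rfl, rfl⟩, ⟨rfl, rfl⟩ | ⟨rfl, rfl⟩⟩ |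
      ⟨⟨rfl, rfl⟩ | ⟨rfl, rfl⟩, ⟨rfl, rfl⟩ | ⟨rfl, rfl⟩⟩ <;>
      refine ⟨?_, ?_, ?_, ?_, ?_⟩ <;> assumption
  · rintro ⟨ha, hb, hc, hd, h1, h2⟩
    exact ⟨a, ha, b, hb, c, hc, d, hd, h1, h2, rfl⟩

theorem goodQuads_eq_empty {U : Finset V} :
    goodQuads G U = ∅ ↔ ∀ a ∈ U, ∀ b ∈ U, ∀ c ∈ U, ∀ d ∈ U, ¬ Good G a b c d := by
  constructor
  · intro h a ha b hb c hc d hd hg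
    have := mem_goodQuads.2 ⟨ha, hb, hc, hd, hg⟩
    rw [h] at this
    exact this
  · rintro h
    refine Set.eq_empty_iff_forall_notMem.2 ?_
    rintro q ⟨a, ha, b, hb, c, hc, d, hd, h1, h2, -⟩
    exact h a ha b hb c hc d hd ⟨h1, h2⟩

theorem Good.ne {a b c d : V} (h : Good G a b c d) :
    a ≠ b ∧ a ≠ c ∧ a ≠ d ∧ b ≠ c ∧ b ≠ d ∧ c ≠ d := by
  simpa [and_assoc] using h.1

theorem score₃_eq {U : Finset V} {a b c : V} (ha : a ∈ U) (hb : b ∈ U) (hc : c ∈ U) :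
    score₃ G U a b c = count U (Good G a b c) := by
  classical
  rw [score₃, count, ← Set.ncard_coe_finset]
  congr 1
  ext d
  simp [mem_goodQuads, ha, hb, hc]

/-- Forgetting the order of `(c, d)` is two-to-one, since a good quadruple has `c ≠ d`. -/
theorem two_mul_score₂ {U : Finset V} {a b : V} (ha : a ∈ U) (hb : b ∈ U) :
    2 * score₂ G U a b = ∑ c ∈ U, count U (Good G a b c) := by
  classical
  set P := (U ×ˢ U).filter fun p => Good G a b p.1 p.2 with hP
  have h1 : ∑ c ∈ U, count U (Good G a b c) = P.card := by
    simp only [hP, count, Finset.card_filter, Finset.sum_product]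
  have h2 : score₂ G U a b = (P.image fun p => s(p.1, p.2)).card := by
    rw [score₂, ← Set.ncard_coe_finset]
    congr 1
    ext e
    induction e with
    | _ c d =>
      simp only [Set.mem_ofPred_eq, mem_goodQuads, ha, hb, true_and, Finset.coe_image,
        Set.mem_image, Finset.mem_coe, hP, Finset.mem_filter, Finset.mem_product, Prod.exists]
      constructor
      · rintro ⟨hc, hd, h⟩
        exact ⟨c, d, ⟨⟨hc, hd⟩, h⟩, rfl⟩
      · rintro ⟨c', d', ⟨⟨hc, hd⟩, h⟩, h'⟩
        rcases Sym2.eq_iff.1 h' with ⟨rfl, rfl⟩ | ⟨rfl, rfl⟩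
        exacts [⟨hc, hd, h⟩, ⟨hd, hc, Good.comm_right.1 h⟩]
  rw [h1, h2, Finset.card_eq_sum_card_image (fun p => s(p.1, p.2)) P, Finset.sum_const_nat
    (m := 2), mul_comm]
  intro e he
  obtain ⟨⟨c, d⟩, hp, rfl⟩ := Finset.mem_image.1 he
  simp only [hP, Finset.mem_filter, Finset.mem_product] at hp
  have : (P.filter fun p => s(p.1, p.2) = s(c, d)) = {(c, d), (d, c)} := by
    ext ⟨c', d'⟩
    simp only [hP, Finset.mem_filter, Finset.mem_product, Finset.mem_insert,
      Finset.mem_singleton, Sym2.eq_iff, Prod.mk.injEq, and_iff_right_iff_imp]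
    rintro (⟨rfl, rfl⟩ | ⟨rfl, rfl⟩)
    exacts [hp, ⟨⟨hp.1.2, hp.1.1⟩, Good.comm_right.1 hp.2⟩]
  rw [this, Finset.card_pair]
  simp [hp.2.ne.2.2.2.2.2]

/-- A good quadruple determines the partner `b` of `a`, because `a` cannot occur in the other pair
as well. -/
theorem score₁_eq {U : Finset V} {a : V} (ha : a ∈ U) :
    score₁ G U a = ∑ b ∈ U, score₂ G U a b := by
  classical
  set P := (U ×ˢ U ×ˢ U).filter fun p => Good G a p.1 p.2.1 p.2.2 with hP
  set Q : V → Finset (Sym2 V) := fun b =>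
    ((U ×ˢ U).filter fun p => Good G a b p.1 p.2).image fun p => s(p.1, p.2) with hQ
  have hmem : ∀ b c d, b ∈ U → (s(c, d) ∈ Q b ↔ s(s(a, b), s(c, d)) ∈ goodQuads G U) := by
    intro b c d hb
    simp only [hQ, mem_goodQuads, Finset.mem_image, Finset.mem_filter, Finset.mem_product,
      Prod.exists, ha, hb, true_and]
    constructor
    · rintro ⟨c', d', ⟨⟨hc, hd⟩, h⟩, h'⟩
      rcases Sym2.eq_iff.1 h' with ⟨rfl, rfl⟩ | ⟨rfl, rfl⟩
      exacts [⟨hc, hd, h⟩, ⟨hd, hc, Good.comm_right.1 h⟩]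
    · rintro ⟨hc, hd, h⟩
      exact ⟨c, d, ⟨⟨hc, hd⟩, h⟩, rfl⟩
  have h2 : ∀ b ∈ U, score₂ G U a b = (Q b).card := by
    intro b hb
    rw [score₂, ← Set.ncard_coe_finset]
    congr 1
    ext e
    induction e with
    | _ c d => exact (hmem b c d hb).symm
  have h1 : score₁ G U a = (U.biUnion fun b => (Q b).image fun e => s(s(a, b), e)).card := by
    rw [score₁, ← Set.ncard_coe_finset]
    congr 1
    ext q
    simp only [Set.mem_ofPred_eq, Finset.coe_biUnion, Finset.mem_coe, Set.mem_iUnion,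
      Finset.coe_image, Set.mem_image, exists_prop]
    constructor
    · rintro ⟨hq, b, c, d, rfl⟩
      have hb := (mem_goodQuads.1 hq).2.1
      exact ⟨b, hb, s(c, d), (hmem b c d hb).2 hq, rfl⟩
    · rintro ⟨b, hb, e, he, rfl⟩
      induction e with
      | _ c d => exact ⟨(hmem b c d hb).1 he, b, c, d, rfl⟩
  rw [h1, Finset.card_biUnion]
  · refine Finset.sum_congr rfl fun b hb => ?_
    rw [h2 b hb, Finset.card_image_of_injOn]
    intro e he e' he' h
    rcases Sym2.eq_iff.1 h with ⟨-, h⟩ | ⟨h, h'⟩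
    exacts [h, h'.trans h]
  · intro b hb b' hb' hne
    rw [Function.onFun, Finset.disjoint_left]
    intro q hq hq'
    obtain ⟨e, he, rfl⟩ := Finset.mem_image.1 hq
    obtain ⟨e', he', h⟩ := Finset.mem_image.1 hq'
    rcases Sym2.eq_iff.1 h with ⟨h, -⟩ | ⟨h, -⟩
    · rcases Sym2.eq_iff.1 h with ⟨-, h⟩ | ⟨h, h'⟩
      exacts [hne h.symm, hne (h.symm.trans h'.symm)]
    -- Here the two pairs are interchanged, which would put `a` into `e`.
    · induction e with
      | _ c d =>
        have := ((mem_goodQuads.1 ((hmem b c d hb).1 he)).2.2.2.2).ne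
        rcases Sym2.eq_iff.1 h with ⟨h, -⟩ | ⟨h, -⟩
        exacts [this.2.1 h, this.2.2.1 h]

end Scores

end Good4

namespace Good4

/-! ### A set without good quadruples yields a complete minor -/

section Minor

variable {V : Type*} {G : SimpleGraph V}

/-- There is a walk from `x` to `y` inside `C`. -/
def JoinedIn (G : SimpleGraph V) (C : Set V) (x y : V) : Prop :=
  ∃ p : G.Walk x y, ∀ z ∈ p.support, z ∈ C

theorem JoinedIn.symm {C : Set V} {x y : V} (h : JoinedIn G C x y) : JoinedIn G C y x := by
  obtain ⟨p, hp⟩ := h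
  exact ⟨p.reverse, by simpa using hp⟩

theorem JoinedIn.trans {C : Set V} {x y z : V} (h : JoinedIn G C x y) (h' : JoinedIn G C y z) :
    JoinedIn G C x z := by
  obtain ⟨p, hp⟩ := h
  obtain ⟨q, hq⟩ := h'
  refine ⟨p.append q, fun w hw => ?_⟩
  rcases SimpleGraph.Walk.mem_support_append_iff _ _ |>.1 hw with h | h
  exacts [hp w h, hq w h]

theorem JoinedIn.mono {C C' : Set V} {x y : V} (h : JoinedIn G C x y) (hC : C ⊆ C') :
    JoinedIn G C' x y := by
  obtain ⟨p, hp⟩ := h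
  exact ⟨p, fun z hz => hC (hp z hz)⟩

theorem joinedIn_of_interval_subset (hG : G.Connected) {C : Set V} {x y : V}
    (h : interval G x y ⊆ C) : JoinedIn G C x y := by
  obtain ⟨p, hp⟩ := (hG x y).exists_walk_length_eq_dist
  exact ⟨p, fun z hz => h ⟨p, hp, hz⟩⟩

theorem induce_connected_of_joinedIn {C : Set V} {x : V} (hx : x ∈ C)
    (h : ∀ z ∈ C, JoinedIn G C z x) : (G.induce C).Connected := by
  have : Nonempty C := ⟨⟨x, hx⟩⟩
  refine ⟨?_⟩
  rintro ⟨u, hu⟩ ⟨v, hv⟩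
  obtain ⟨p, hp⟩ := (h u hu).trans (h v hv).symm
  exact ⟨p.induce C hp⟩

/-- The walk must leave `C` along some edge, and inside the union that edge can only end in `D`. -/
theorem JoinedIn.exists_adj {C D : Set V} {x y : V} (h : JoinedIn G (C ∪ D) x y) (hx : x ∈ C)
    (hy : y ∈ D) (hCD : Disjoint C D) : ∃ u ∈ C, ∃ v ∈ D, G.Adj u v := by
  obtain ⟨p, hp⟩ := h
  obtain ⟨d, hd, h1, h2⟩ := p.exists_boundary_dart C hx (Set.disjoint_right.1 hCD hy)
  exact ⟨d.fst, h1, d.snd, (hp _ (p.dart_snd_mem_support_of_mem_darts hd)).resolve_left h2, d.adj⟩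

theorem left_mem_interval (hG : G.Connected) (u v : V) : u ∈ interval G u v := by
  rw [mem_interval_iff hG]
  simp

theorem right_mem_interval (hG : G.Connected) (u v : V) : v ∈ interval G u v := by
  rw [mem_interval_iff hG]
  simp

theorem interval_subset_left (hG : G.Connected) {u v x : V} (hx : x ∈ interval G u v) :
    interval G u x ⊆ interval G u v := by
  intro z hz
  rw [mem_interval_iff hG] at *
  have h1 := hG.dist_triangle (u := z) (v := x) (w := v)
  have h2 := hG.dist_triangle (u := u) (v := z) (w := v)
  omega

theorem interval_subset_right (hG : G.Connected) {u v x : V} (hx : x ∈ interval G u v) :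
    interval G x v ⊆ interval G u v := by
  rw [interval_comm G x v, interval_comm G u v] at *
  exact interval_subset_left hG hx

/-- If `z` lies between `u` and `x`, and `x` between `u` and `v`, then `x` lies between `z`
and `v`. -/
theorem mem_interval_of_mem (hG : G.Connected) {u v x z : V} (hx : x ∈ interval G u v)
    (hz : z ∈ interval G u x) : x ∈ interval G z v := by
  rw [mem_interval_iff hG] at *
  have h1 := hG.dist_triangle (u := z) (v := x) (w := v)
  have h2 := hG.dist_triangle (u := u) (v := z) (w := v)
  omega

variable {ι : Type*}

/-- The region of the node `e j`, for nodes `e i` that are colored by `A`, consists of nodes on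
shortest paths between nodes of different colors. -/
def region (G : SimpleGraph V) (e : ι → V) (A : Set ι) (j : ι) : Set V :=
  {x | (j ∈ A ∧ (∃ b ∉ A, x ∈ interval G (e j) (e b)) ∧
      ∀ a ∈ A, a ≠ j → ∀ b ∉ A, x ∉ interval G (e a) (e b)) ∨
    (j ∉ A ∧ ∃ a ∈ A, ∃ a' ∈ A, a ≠ a' ∧ x ∈ interval G (e a) (e j) ∧ x ∈ interval G (e a') (e j))}

section Region

variable {e : ι → V} {A : Set ι}

/-- The hypothesis says that intervals between the colours meet only if they share an end. A node in
the region of `j ∉ A` is reached from two nodes of `A`. One of them differs from any given `i ∈ A`,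
which the exclusion clause of `i` forbids; and if the node also belonged to another index outside
`A`, the hypothesis would identify the two. -/
theorem region_disjoint
    (h : ∀ a ∈ A, ∀ a' ∈ A, ∀ b ∉ A, ∀ b' ∉ A, ∀ x, x ∈ interval G (e a) (e b) →
      x ∈ interval G (e a') (e b') → a = a' ∨ b = b') {i j : ι} (hij : i ≠ j) :
    Disjoint (region G e A i) (region G e A j) := by
  rw [Set.disjoint_left]
  rintro x (⟨hi, ⟨b, hb, hx⟩, hi'⟩ | ⟨hi, a, ha, a', ha', hne, hx, hx'⟩)
    (⟨hj, ⟨c, hc, hz⟩, hj'⟩ | ⟨hj, c, hc, c', hc', hne', hz, hz'⟩)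
  · exact hj' i hi hij b hb hx
  · by_cases hci : c = i
    · exact hi' c' hc' (by rintro rfl; exact hne' hci) j hj hz'
    · exact hi' c hc hci j hj hz
  · by_cases haj : a = j
    · exact hj' a' ha' (by rintro rfl; exact hne haj) i hi hx'
    · exact hj' a ha haj i hi hx
  · have h1 := (h a ha c hc i hi j hj x hx hz).resolve_right hij
    have h2 := (h a ha c' hc' i hi j hj x hx hz').resolve_right hij
    exact hne' (h1.symm.trans h2)

/-- A node of the interval that also lies on an interval from some other `a ∈ A` forces, by the
hypothesis, that interval to end in `j` too. So two nodes of `A` assign it to `j`. -/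
theorem interval_subset_region
    (h : ∀ a ∈ A, ∀ a' ∈ A, ∀ b ∉ A, ∀ b' ∉ A, ∀ x, x ∈ interval G (e a) (e b) →
      x ∈ interval G (e a') (e b') → a = a' ∨ b = b') {i j : ι} (hi : i ∈ A) (hj : j ∉ A) :
    interval G (e i) (e j) ⊆ region G e A i ∪ region G e A j := by
  intro x hx
  by_cases H : ∀ a ∈ A, a ≠ i → ∀ b ∉ A, x ∉ interval G (e a) (e b)
  · exact Or.inl (Or.inl ⟨hi, ⟨j, hj, hx⟩, H⟩)
  · push Not at H
    obtain ⟨a, ha, hai, b, hb, hz⟩ := H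
    obtain rfl := (h a ha i hi b hb j hj x hz hx).resolve_left hai
    exact Or.inr (Or.inr ⟨hj, a, ha, i, hi, hai, hz, hx⟩)

/-- Both colours need two nodes: a second end outside `A` excludes a foreign interval through `e j`
for `j ∈ A`, and an index outside `A` needs two nodes of `A` to reach it. -/
theorem mem_region (hG : G.Connected)
    (h : ∀ a ∈ A, ∀ a' ∈ A, ∀ b ∉ A, ∀ b' ∉ A, ∀ x, x ∈ interval G (e a) (e b) →
      x ∈ interval G (e a') (e b') → a = a' ∨ b = b') (hA : A.Nontrivial) (hB : Aᶜ.Nontrivial)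
    (j : ι) : e j ∈ region G e A j := by
  by_cases hj : j ∈ A
  · refine Or.inl ⟨hj, ?_, fun a ha haj b hb hx => ?_⟩
    · obtain ⟨b, hb⟩ := hB.nonempty
      exact ⟨b, hb, left_mem_interval hG _ _⟩
    · obtain ⟨b', hb', hne⟩ := hB.exists_ne b
      rcases h a ha j hj b hb b' hb' _ hx (left_mem_interval hG _ _) with h | h
      exacts [haj h, hne h.symm]
  · obtain ⟨a, ha, a', ha', hne⟩ := hA
    exact Or.inr ⟨hj, a, ha, a', ha', hne, right_mem_interval hG _ _, right_mem_interval hG _ _⟩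

/-- For `j ∈ A`, walk from `e j` towards `x`. A foreign interval through a node `z` on the way would
end in the same `b`, and as `x` lies between `z` and `b` it would contain `x` too. For `j ∉ A`,
shortest paths from `x` to `e j` stay on both intervals that define the region. -/
theorem region_joinedIn (hG : G.Connected)
    (h : ∀ a ∈ A, ∀ a' ∈ A, ∀ b ∉ A, ∀ b' ∉ A, ∀ x, x ∈ interval G (e a) (e b) →
      x ∈ interval G (e a') (e b') → a = a' ∨ b = b') {j : ι} {x : V}
    (hx : x ∈ region G e A j) : JoinedIn G (region G e A j) x (e j) := by
  rcases hx with ⟨hj, ⟨b, hb, hx⟩, hj'⟩ | ⟨hj, a, ha, a', ha', hne, hx, hx'⟩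
  · refine (joinedIn_of_interval_subset hG fun z hz => ?_).symm
    have hz' := interval_subset_left hG hx hz
    refine Or.inl ⟨hj, ⟨b, hb, hz'⟩, fun a ha haj c hc hac => ?_⟩
    obtain rfl := (h a ha j hj c hc b hb z hac hz').resolve_left haj
    exact hj' a ha haj c hc (interval_subset_right hG hac (mem_interval_of_mem hG hx hz))
  · refine joinedIn_of_interval_subset hG fun z hz => ?_
    exact Or.inr ⟨hj, a, ha, a', ha', hne, interval_subset_right hG hx hz,
      interval_subset_right hG hx' hz⟩

end Region

/-- Nodes `e 0, ..., e (k - 1)` without good quadruples yield a complete minor on `k / 2 + 1`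
nodes. -/
theorem isMinor_of_not_good (hG : G.Connected) {k : ℕ} (hk : 4 ≤ k) {e : Fin k → V}
    (he : Function.Injective e) (h : ∀ a b c d, ¬ Good G (e a) (e b) (e c) (e d)) :
    IsMinor (⊤ : SimpleGraph (Fin (k / 2 + 1))) G := by
  set A : Set (Fin k) := {j | (j : ℕ) % 2 = 0} with hA
  have hmem : ∀ j, j ∈ A ↔ (j : ℕ) % 2 = 0 := fun _ => Iff.rfl
  have key : ∀ a ∈ A, ∀ a' ∈ A, ∀ b ∉ A, ∀ b' ∉ A, ∀ x, x ∈ interval G (e a) (e b) →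
      x ∈ interval G (e a') (e b') → a = a' ∨ b = b' := by
    intro a ha a' ha' b hb b' hb' x hx hx'
    by_contra! hne
    have hAB : ∀ i ∈ A, ∀ j ∉ A, i ≠ j := by
      rintro i hi j hj rfl
      exact hj hi
    refine h a b a' b' ⟨?_, x, hx, hx'⟩
    simp [he.eq_iff, hne, hAB a ha b hb, hAB a ha b' hb', (hAB a' ha' b hb).symm,
      hAB a' ha' b' hb']
  have hA2 : A.Nontrivial := ⟨⟨0, by omega⟩, by simp [hmem], ⟨2, by omega⟩, by simp [hmem],
    by simp⟩
  have hB2 : Aᶜ.Nontrivial := ⟨⟨1, by omega⟩, by simp [hmem], ⟨3, by omega⟩, by simp [hmem],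
    by simp⟩
  have hin := mem_region hG key hA2 hB2
  have hjoin : ∀ i ∈ A, ∀ j ∉ A, JoinedIn G (region G e A i ∪ region G e A j) (e i) (e j) :=
    fun i hi j hj => joinedIn_of_interval_subset hG (interval_subset_region key hi hj)
  -- Branch set `i` merges the regions of the odd index `2i - 1` and the even index `2i`. Index `0`
  -- stands alone, and so does `k - 1` when `k` is even; this gives the `+ 1`.
  set B : Fin (k / 2 + 1) → Set V := fun i => {x | ∃ j : Fin k, ((j : ℕ) + 1) / 2 = i ∧
    x ∈ region G e A j} with hBdef
  have hsub : ∀ j : Fin k, ∀ i : Fin (k / 2 + 1), ((j : ℕ) + 1) / 2 = i →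
      region G e A j ⊆ B i := fun j i hij x hx => ⟨j, hij, hx⟩
  have hdisj : ∀ i j, i ≠ j → Disjoint (B i) (B j) := by
    intro i j hij
    rw [Set.disjoint_left]
    rintro x ⟨p, hp, hx⟩ ⟨q, hq, hx'⟩
    have hpq : p ≠ q := by
      rintro rfl
      exact hij (Fin.ext (hp.symm.trans hq))
    exact Set.disjoint_left.1 (region_disjoint key hpq) hx hx'
  -- For `i < j` the even index `2i` and the odd index `2j - 1` always exist, and the interval
  -- between them lies in the two branch sets.
  have hadj : ∀ i j : Fin (k / 2 + 1), i < j → ∃ u ∈ B i, ∃ v ∈ B j, G.Adj u v := by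
    intro i j hij
    have hij' : (i : ℕ) < j := hij
    have hp : 2 * (i : ℕ) < k := by omega
    have hq : 2 * (j : ℕ) - 1 < k := by omega
    have h1 : (⟨2 * i, hp⟩ : Fin k) ∈ A := by simp [hmem]
    have h2 : (⟨2 * j - 1, hq⟩ : Fin k) ∉ A := by
      simp only [hmem]
      omega
    have s1 := hsub ⟨2 * i, hp⟩ i (by simp only; omega)
    have s2 := hsub ⟨2 * j - 1, hq⟩ j (by simp only; omega)
    exact ((hjoin _ h1 _ h2).mono (Set.union_subset_union s1 s2)).exists_adj
      (s1 (hin _)) (s2 (hin _)) (hdisj i j hij.ne)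
  refine ⟨B, fun i => ?_, hdisj, fun i j hij => ?_⟩
  · obtain ⟨j, hj⟩ : ∃ j : Fin k, ((j : ℕ) + 1) / 2 = i := by
      rcases Nat.lt_or_ge (2 * i) k with h | h
      · exact ⟨⟨2 * i, h⟩, by simp only; omega⟩
      · exact ⟨⟨2 * i - 1, by omega⟩, by simp only; omega⟩
    refine induce_connected_of_joinedIn (hsub j i hj (hin j)) ?_
    rintro z ⟨q, hq, hz⟩
    refine ((region_joinedIn hG key hz).mono (hsub q i hq)).trans ?_
    by_cases hqj : q = j
    · subst hqj
      exact ⟨.nil, by simpa using hsub q i hq (hin q)⟩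
    -- Two different indices in one branch set have opposite parity, so an interval between the
    -- colours connects their regions.
    · have hne : (q : ℕ) ≠ j := fun h => hqj (Fin.ext h)
      by_cases hqA : q ∈ A
      · refine (hjoin q hqA j ?_).mono (Set.union_subset (hsub q i hq) (hsub j i hj))
        simp only [hmem] at hqA ⊢
        omega
      · refine ((hjoin j ?_ q hqA).mono (Set.union_subset (hsub j i hj) (hsub q i hq))).symm
        simp only [hmem] at hqA ⊢
        omega
  · rcases lt_or_gt_of_ne ((SimpleGraph.top_adj i j).1 hij) with h | h
    · exact hadj i j h
    · obtain ⟨u, hu, v, hv, huv⟩ := hadj j i h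
      exact ⟨v, hv, u, hu, huv.symm⟩

/-! ### Consequences for the Hadwiger number -/

theorem IsMinor.le_hadwiger [Fintype V] {w : ℕ} (h : IsMinor (⊤ : SimpleGraph (Fin w)) G) :
    w ≤ hadwiger G := by
  refine le_csSup ⟨Fintype.card V, ?_⟩ h
  rintro w ⟨B, h1, h2, -⟩
  choose f hf using fun i => (Set.nonempty_coe_sort.1 (h1 i).nonempty)
  have hinj : Function.Injective f := by
    intro i j hij
    by_contra hne
    exact Set.disjoint_left.1 (h2 i j hne) (hf i) (hij ▸ hf j)
  simpa using Fintype.card_le_of_injective f hinj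

theorem two_le_hadwiger [Fintype V] (hG : G.Connected) (hV : 2 ≤ Fintype.card V) :
    2 ≤ hadwiger G := by
  refine IsMinor.le_hadwiger ?_
  have : Nontrivial V := Fintype.one_lt_card_iff_nontrivial.1 hV
  obtain ⟨u⟩ := hG.nonempty
  obtain ⟨v, huv⟩ := hG.preconnected.exists_adj_of_nontrivial u
  have hsing : ∀ x : V, (G.induce {x}).Connected := fun x =>
    induce_connected_of_joinedIn (x := x) rfl (by rintro z rfl; exact ⟨.nil, by simp⟩)
  refine ⟨fun i => if i = 0 then {u} else {v}, fun i => ?_, fun i j hij => ?_, fun i j hij => ?_⟩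
  · fin_cases i
    exacts [hsing u, hsing v]
  · fin_cases i <;> fin_cases j <;> simp [huv.ne, huv.ne'] at hij ⊢
  · fin_cases i <;> fin_cases j <;> simp [huv, huv.symm] at hij ⊢

/-- With at least 2h nodes the minor would have at least h + 1 branch sets; `2 ≤ hadwiger G`
supplies the four nodes that the construction needs. -/
theorem card_lt_of_goodQuads_eq_empty [Fintype V] (hG : G.Connected) (hV : 2 ≤ Fintype.card V)
    {S : Finset V} (hS : goodQuads G S = ∅) : S.card < 2 * hadwiger G := by
  have h2 := two_le_hadwiger hG hV
  by_contra! hc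
  have h := (isMinor_of_not_good hG (k := S.card) (by omega)
    (e := fun i => (S.equivFin.symm i : V))
    (Subtype.val_injective.comp S.equivFin.symm.injective) (fun a b c d => goodQuads_eq_empty.1 hS
      _ (Subtype.mem _) _ (Subtype.mem _) _ (Subtype.mem _) _ (Subtype.mem _))).le_hadwiger
  omega

end Minor

end Good4

namespace Good4

/-! ### A Turán-type bound for dependent sets of size four -/

section Turan

variable {V : Type*}

open scoped Classical in
/-- The `k`-element subsets of `U` with property `I`. -/
noncomputable def indepSets (U : Finset V) (I : Finset V → Prop) (k : ℕ) : Finset (Finset V) :=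
  (U.powersetCard k).filter I

theorem mem_indepSets {U : Finset V} {I : Finset V → Prop} {k : ℕ} {A : Finset V} :
    A ∈ indepSets U I k ↔ (A ⊆ U ∧ A.card = k) ∧ I A := by
  simp [indepSets, Finset.mem_powersetCard]

theorem count_eq {α : Type*} (U : Finset α) (P : α → Prop) [DecidablePred P] :
    count U P = (U.filter P).card := by
  unfold count
  congr

theorem count_mono {α : Type*} {U U' : Finset α} {P P' : α → Prop} (hU : U ⊆ U')
    (hP : ∀ x ∈ U, P x → P' x) : count U P ≤ count U' P' := by
  classical
  refine Finset.card_le_card fun x hx => ?_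
  rw [Finset.mem_filter] at hx ⊢
  exact ⟨hU hx.1, hP x hx.1 hx.2⟩

theorem count_add_count_not {α : Type*} (U : Finset α) (P : α → Prop) :
    count U P + count U (fun x => ¬ P x) = U.card := by
  classical
  rw [count_eq U P, count_eq U fun x => ¬ P x]
  exact Finset.card_filter_add_card_filter_not P

theorem count_le_card {α : Type*} (U : Finset α) (P : α → Prop) : count U P ≤ U.card := by
  classical
  rw [count_eq U P]
  exact Finset.card_filter_le U P

variable [DecidableEq V]

/-- Double counting of independent sets with a marked element, sorted by what remains when that
element is removed. -/
theorem sum_indepSets_erase {U : Finset V} {I : Finset V → Prop}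
    (hI : ∀ A B, A ⊆ B → I B → I A) (w : Finset V → ℕ) (j : ℕ) :
    ∑ A ∈ indepSets U I (j + 1), ∑ u ∈ A, w (A.erase u) =
      ∑ C ∈ indepSets U I j, count (U \ C) (fun u => I (insert u C)) * w C := by
  classical
  have hr : ∀ C, count (U \ C) (fun u => I (insert u C)) * w C =
      ∑ u ∈ (U \ C).filter (fun u => I (insert u C)), w C := by
    intro C
    rw [Finset.sum_const, smul_eq_mul, count_eq]
  simp_rw [hr]
  rw [Finset.sum_sigma', Finset.sum_sigma']
  refine Finset.sum_bij' (fun p _ => ⟨p.1.erase p.2, p.2⟩) (fun p _ => ⟨insert p.2 p.1, p.2⟩)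
    ?_ ?_ ?_ ?_ ?_
  · rintro ⟨A, u⟩ hp
    simp only [Finset.mem_sigma, mem_indepSets, Finset.mem_filter, Finset.mem_sdiff] at hp ⊢
    obtain ⟨⟨⟨h1, h2⟩, h3⟩, hu⟩ := hp
    exact ⟨⟨⟨(Finset.erase_subset _ _).trans h1, by rw [Finset.card_erase_of_mem hu, h2]; rfl⟩,
      hI _ _ (Finset.erase_subset _ _) h3⟩, ⟨h1 hu, by simp⟩, by rwa [Finset.insert_erase hu]⟩
  · rintro ⟨C, u⟩ hp
    simp only [Finset.mem_sigma, mem_indepSets, Finset.mem_filter, Finset.mem_sdiff] at hp ⊢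
    obtain ⟨⟨⟨h1, h2⟩, h3⟩, ⟨hu, huC⟩, h4⟩ := hp
    exact ⟨⟨⟨Finset.insert_subset hu h1, by rw [Finset.card_insert_of_notMem huC, h2]⟩, h4⟩,
      Finset.mem_insert_self _ _⟩
  · rintro ⟨A, u⟩ hp
    simp only [Finset.mem_sigma] at hp
    simp [Finset.insert_erase hp.2]
  · rintro ⟨C, u⟩ hp
    simp only [Finset.mem_sigma, Finset.mem_filter, Finset.mem_sdiff] at hp
    simp [Finset.erase_insert hp.2.1.2]
  · rintro ⟨A, u⟩ -
    rfl

/-- The number of pairs of a `k`-element set with property `I` and an element whose addition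
destroys that property. -/
noncomputable def badPairs (U : Finset V) (I : Finset V → Prop) (k : ℕ) : ℕ :=
  ∑ A ∈ indepSets U I k, count (U \ A) fun v => ¬ I (insert v A)

/-- For `j ≥ 3`, the average number of bad elements of an independent set grows at most by the
factor (j+1)/(j-2) from size j to j+1. If `v` is bad for `A` because of the triple `T`, it stays bad
after the removal of any of the j-2 elements of `A \ T`. Double counting turns this into a sum of
products `ext C * bad C`, which Chebyshev's inequality separates. -/
theorem badPairs_succ_mul_le {U : Finset V} {I : Finset V → Prop}
    (hI : ∀ A B, A ⊆ B → I B → I A)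
    (h4 : ∀ A v, v ∉ A → I A → ¬ I (insert v A) → ∃ T ⊆ A, T.card = 3 ∧ ¬ I (insert v T))
    (j : ℕ) :
    (j - 2) * badPairs U I (j + 1) * (indepSets U I j).card ≤
      (j + 1) * (indepSets U I (j + 1)).card * badPairs U I j := by
  classical
  set bad : Finset V → ℕ := fun C => count (U \ C) fun v => ¬ I (insert v C) with hbad
  set ext : Finset V → ℕ := fun C => count (U \ C) fun v => I (insert v C) with hext
  have h1 : (j - 2) * badPairs U I (j + 1) ≤ ∑ C ∈ indepSets U I j, ext C * bad C := by
    rw [← sum_indepSets_erase hI bad j, badPairs, Finset.mul_sum]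
    refine Finset.sum_le_sum fun A hA => ?_
    obtain ⟨⟨hAU, hAc⟩, hAI⟩ := mem_indepSets.1 hA
    calc (j - 2) * count (U \ A) (fun v => ¬ I (insert v A))
        = ∑ v ∈ (U \ A).filter (fun v => ¬ I (insert v A)), (j - 2) := by
          rw [Finset.sum_const, smul_eq_mul, mul_comm, count_eq]
      _ ≤ ∑ v ∈ (U \ A).filter (fun v => ¬ I (insert v A)),
            (A.filter fun u => ¬ I (insert v (A.erase u))).card := by
          refine Finset.sum_le_sum fun v hv => ?_
          rw [Finset.mem_filter, Finset.mem_sdiff] at hv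
          obtain ⟨T, hT, hT3, hTI⟩ := h4 A v hv.1.2 hAI hv.2
          calc j - 2 = (A \ T).card := by
                rw [Finset.card_sdiff_of_subset hT, hAc, hT3]
                omega
            _ ≤ _ := by
                refine Finset.card_le_card fun u hu => ?_
                rw [Finset.mem_sdiff] at hu
                rw [Finset.mem_filter]
                refine ⟨hu.1, fun h => hTI (hI _ _ (Finset.insert_subset_insert _ ?_) h)⟩
                exact fun x hx => Finset.mem_erase.2
                  ⟨fun h => hu.2 (h ▸ hx), hT hx⟩
      _ = ∑ u ∈ A, (((U \ A).filter (fun v => ¬ I (insert v A))).filter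
            fun v => ¬ I (insert v (A.erase u))).card := by
          simp only [Finset.card_filter]
          exact Finset.sum_comm
      _ ≤ ∑ u ∈ A, bad (A.erase u) := by
          simp only [hbad, count_eq]
          refine Finset.sum_le_sum fun u hu => Finset.card_le_card fun v hv => ?_
          simp only [Finset.mem_filter, Finset.mem_sdiff] at hv ⊢
          exact ⟨⟨hv.1.1.1, fun h => hv.1.1.2 (Finset.mem_of_mem_erase h)⟩, hv.2⟩
  have h2 : (j + 1) * (indepSets U I (j + 1)).card = ∑ C ∈ indepSets U I j, ext C := by
    have := sum_indepSets_erase (U := U) hI (fun _ => 1) j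
    simp only [mul_one, Finset.sum_const, smul_eq_mul] at this
    rw [← this, Finset.sum_congr rfl fun A hA => (mem_indepSets.1 hA).1.2, Finset.sum_const,
      smul_eq_mul, mul_comm]
  have h3 : ∀ C ∈ indepSets U I j, ext C + bad C = U.card - j := by
    intro C hC
    obtain ⟨⟨hCU, hCc⟩, -⟩ := mem_indepSets.1 hC
    rw [hext, hbad]
    simp only
    rw [count_add_count_not, Finset.card_sdiff_of_subset hCU, hCc]
  have h5 : (indepSets U I j).card * ∑ C ∈ indepSets U I j, ext C * bad C ≤
      (∑ C ∈ indepSets U I j, ext C) * ∑ C ∈ indepSets U I j, bad C := by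
    -- The sum `ext C + bad C` is constant by `h3`, so one decreases as the other increases.
    have hanti : AntivaryOn (fun C => (ext C : ℤ)) (fun C => (bad C : ℤ))
        (indepSets U I j : Set (Finset V)) := by
      intro C hC C' hC' hlt
      have e1 := h3 C hC
      have e2 := h3 C' hC'
      simp only [Nat.cast_lt, Nat.cast_le] at hlt ⊢
      omega
    exact_mod_cast hanti.card_mul_sum_le_sum_mul_sum
  calc (j - 2) * badPairs U I (j + 1) * (indepSets U I j).card
      ≤ (∑ C ∈ indepSets U I j, ext C * bad C) * (indepSets U I j).card := by gcongr
    _ ≤ (∑ C ∈ indepSets U I j, ext C) * ∑ C ∈ indepSets U I j, bad C := by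
      rw [mul_comm]
      exact h5
    _ = _ := by rw [h2]; rfl

/-- The factors (j+1)/(j-2) for j from 3 to k-1 multiply to `k.choose 3`. -/
theorem badPairs_mul_le {U : Finset V} {I : Finset V → Prop}
    (hI : ∀ A B, A ⊆ B → I B → I A)
    (h4 : ∀ A v, v ∉ A → I A → ¬ I (insert v A) → ∃ T ⊆ A, T.card = 3 ∧ ¬ I (insert v T))
    {k : ℕ} (hk : 3 ≤ k) :
    badPairs U I k * (indepSets U I 3).card ≤
      k.choose 3 * (indepSets U I k).card * badPairs U I 3 := by
  induction k, hk using Nat.le_induction with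
  | base => simp [mul_comm]
  | succ k hk ih =>
    -- The number of independent `k`-sets is cancelled below, so its vanishing is treated
    -- separately.
    rcases Nat.eq_zero_or_pos (indepSets U I k).card with h0 | hpos
    · have : indepSets U I (k + 1) = ∅ := by
        refine Finset.eq_empty_iff_forall_notMem.2 fun A hA => ?_
        obtain ⟨⟨hAU, hAc⟩, hAI⟩ := mem_indepSets.1 hA
        obtain ⟨B, hB, hBc⟩ := Finset.exists_subset_card_eq (s := A) (n := k) (by omega)
        have : B ∈ indepSets U I k :=
          mem_indepSets.2 ⟨⟨hB.trans hAU, hBc⟩, hI _ _ hB hAI⟩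
        rw [Finset.card_eq_zero.1 h0] at this
        simp at this
      simp [badPairs, this]
    · have h1 := badPairs_succ_mul_le (U := U) hI h4 k
      have hch : (k + 1) * k.choose 3 = (k - 2) * (k + 1).choose 3 := by
        have h := Nat.choose_mul_succ_eq k 3
        rw [show k + 1 - 3 = k - 2 by omega] at h
        linarith
      refine le_of_mul_le_mul_left (a := (k - 2) * (indepSets U I k).card) ?_
        (Nat.mul_pos (by omega) hpos)
      calc (k - 2) * (indepSets U I k).card * (badPairs U I (k + 1) * (indepSets U I 3).card)
          = ((k - 2) * badPairs U I (k + 1) * (indepSets U I k).card) *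
              (indepSets U I 3).card := by ring
        _ ≤ ((k + 1) * (indepSets U I (k + 1)).card * badPairs U I k) *
              (indepSets U I 3).card := by gcongr
        _ = (k + 1) * (indepSets U I (k + 1)).card *
              (badPairs U I k * (indepSets U I 3).card) := by ring
        _ ≤ (k + 1) * (indepSets U I (k + 1)).card *
              (k.choose 3 * (indepSets U I k).card * badPairs U I 3) := by gcongr
        _ = ((k + 1) * k.choose 3) * ((indepSets U I (k + 1)).card *
              (indepSets U I k).card * badPairs U I 3) := by ring
        _ = _ := by rw [hch]; ring

/-- All triples are independent, so a dependent four-set is counted once for each choice of its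
added element. -/
theorem badPairs_three {U : Finset V} {I : Finset V → Prop} (h3 : ∀ A, A.card ≤ 3 → I A) :
    badPairs U I 3 = 4 * count (U.powersetCard 4) fun A => ¬ I A := by
  classical
  have hr : 4 * count (U.powersetCard 4) (fun A => ¬ I A) =
      ∑ A ∈ (U.powersetCard 4).filter (fun A => ¬ I A), ∑ u ∈ A, 1 := by
    rw [Finset.sum_congr rfl (g := fun _ => 4), Finset.sum_const, smul_eq_mul, mul_comm, count_eq]
    · intro A hA
      rw [Finset.mem_filter, Finset.mem_powersetCard] at hA
      simp [hA.1.2]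
  rw [hr, badPairs]
  simp_rw [count_eq, Finset.card_eq_sum_ones]
  rw [Finset.sum_sigma', Finset.sum_sigma']
  refine Finset.sum_bij' (fun p _ => ⟨insert p.2 p.1, p.2⟩) (fun p _ => ⟨p.1.erase p.2, p.2⟩)
    ?_ ?_ ?_ ?_ ?_
  · rintro ⟨C, u⟩ hp
    simp only [Finset.mem_sigma, mem_indepSets, Finset.mem_filter, Finset.mem_sdiff,
      Finset.mem_powersetCard] at hp ⊢
    obtain ⟨⟨⟨h1, h2⟩, h3⟩, ⟨hu, huC⟩, h4⟩ := hp
    exact ⟨⟨⟨Finset.insert_subset hu h1, by rw [Finset.card_insert_of_notMem huC, h2]⟩, h4⟩,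
      Finset.mem_insert_self _ _⟩
  · rintro ⟨A, u⟩ hp
    simp only [Finset.mem_sigma, mem_indepSets, Finset.mem_filter, Finset.mem_sdiff,
      Finset.mem_powersetCard] at hp ⊢
    obtain ⟨⟨⟨h1, h2⟩, h⟩, hu⟩ := hp
    have hc : (A.erase u).card = 3 := by rw [Finset.card_erase_of_mem hu, h2]
    exact ⟨⟨⟨(Finset.erase_subset _ _).trans h1, hc⟩, h3 _ hc.le⟩, ⟨h1 hu, by simp⟩,
      by rwa [Finset.insert_erase hu]⟩
  · rintro ⟨C, u⟩ hp
    simp only [Finset.mem_sigma, Finset.mem_filter, Finset.mem_sdiff] at hp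
    simp [Finset.erase_insert hp.2.1.2]
  · rintro ⟨A, u⟩ hp
    simp only [Finset.mem_sigma] at hp
    simp [Finset.insert_erase hp.2]
  · rintro ⟨A, u⟩ -
    rfl

/-- **De Caen's bound** for the number of dependent sets of size four, if all independent sets
have at most `α` elements. -/
theorem choose_three_mul_le {U : Finset V} {I : Finset V → Prop}
    (hI : ∀ A B, A ⊆ B → I B → I A) (h3 : ∀ A, A.card ≤ 3 → I A)
    (h4 : ∀ A v, v ∉ A → I A → ¬ I (insert v A) → ∃ T ⊆ A, T.card = 3 ∧ ¬ I (insert v T))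
    {α : ℕ} (hα : ∀ A ⊆ U, I A → A.card ≤ α) :
    U.card.choose 3 * (U.card - α) ≤
      α.choose 3 * (4 * count (U.powersetCard 4) fun A => ¬ I A) := by
  classical
  rcases Nat.lt_or_ge U.card 3 with hU | hU
  · simp [Nat.choose_eq_zero_of_lt hU]
  have hN3 : (indepSets U I 3).card = U.card.choose 3 := by
    rw [indepSets, Finset.filter_true_of_mem, Finset.card_powersetCard]
    intro A hA
    exact h3 A (Finset.mem_powersetCard.1 hA).2.le
  -- At the last nonempty level every further element is bad, so `badPairs` is known there exactly.
  obtain ⟨k, hk, hpos, hzero⟩ : ∃ k, 3 ≤ k ∧ (indepSets U I k).Nonempty ∧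
      indepSets U I (k + 1) = ∅ := by
    by_contra! hcon
    have : ∀ k, 3 ≤ k → (indepSets U I k).Nonempty := by
      intro k hk
      induction k, hk using Nat.le_induction with
      | base =>
        rw [← Finset.card_pos, hN3]
        exact Nat.choose_pos hU
      | succ k hk ih => exact hcon k hk ih
    obtain ⟨A, hA⟩ := this (α + 3) (by omega)
    obtain ⟨⟨hAU, hAc⟩, hAI⟩ := mem_indepSets.1 hA
    have := hα A hAU hAI
    omega
  have hkα : k ≤ α := by
    obtain ⟨A, hA⟩ := hpos
    obtain ⟨⟨hAU, hAc⟩, hAI⟩ := mem_indepSets.1 hA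
    exact hAc ▸ hα A hAU hAI
  have hbad : badPairs U I k = (indepSets U I k).card * (U.card - k) := by
    rw [badPairs, Finset.sum_const_nat]
    intro A hA
    obtain ⟨⟨hAU, hAc⟩, hAI⟩ := mem_indepSets.1 hA
    rw [count_eq, Finset.filter_true_of_mem, Finset.card_sdiff_of_subset hAU, hAc]
    intro v hv h
    rw [Finset.mem_sdiff] at hv
    have : insert v A ∈ indepSets U I (k + 1) := mem_indepSets.2
      ⟨⟨Finset.insert_subset hv.1 hAU, by rw [Finset.card_insert_of_notMem hv.2, hAc]⟩, h⟩
    rw [hzero] at this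
    simp at this
  have key := badPairs_mul_le (U := U) hI h4 hk
  rw [hbad, hN3, badPairs_three h3] at key
  have key2 : U.card.choose 3 * (U.card - k) ≤
      k.choose 3 * (4 * count (U.powersetCard 4) fun A => ¬ I A) := by
    refine le_of_mul_le_mul_left (a := (indepSets U I k).card) ?_ (Finset.card_pos.2 hpos)
    linarith
  calc U.card.choose 3 * (U.card - α) ≤ U.card.choose 3 * (U.card - k) := by gcongr
    _ ≤ _ := key2
    _ ≤ _ := by gcongr

end Turan

end Good4

namespace Good4

/-! ### The mistake bound -/

section Bound

variable {V : Type*} {G : SimpleGraph V} {y : V → Bool}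

theorem mistakes_append (τ τ' : List (Trial V)) :
    mistakes (τ ++ τ') = mistakes τ + mistakes τ' :=
  List.countP_append

theorem mistakes_cons_le (t : Trial V) (τ : List (Trial V)) :
    mistakes (t :: τ) ≤ mistakes τ + 1 := by
  rw [mistakes, mistakes, List.countP_cons]
  split_ifs <;> omega

theorem mistakes_cons_correct (v : V) (p : Bool) (τ : List (Trial V)) :
    mistakes (⟨v, p, p⟩ :: τ) = mistakes τ := by
  simp [mistakes]

theorem mistakes_le_length (τ : List (Trial V)) : mistakes τ ≤ τ.length :=
  List.countP_le_length

/-- By convexity a common node of the two intervals carries the label of each pair. -/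
theorem Good.label_eq (hy : IsConvexBipartition G y) {a b c d : V} (h : Good G a b c d)
    (hab : y a = y b) (hcd : y c = y d) : y a = y c := by
  have H : ∀ z u v x, y u = z → y v = z → x ∈ interval G u v → y x = z := by
    rintro (_ | _) u v x hu hv hx
    exacts [hy.2 u hu v hv hx, hy.1 u hu v hv hx]
  obtain ⟨-, x, hx, hx'⟩ := h
  rw [← H (y a) a b x rfl hab.symm hx, ← H (y c) c d x rfl hcd.symm hx']

theorem goodQuads_mono {U U' : Finset V} (h : U ⊆ U') : goodQuads G U ⊆ goodQuads G U' := by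
  rintro q ⟨a, ha, b, hb, c, hc, d, hd, hq⟩
  exact ⟨a, h ha, b, h hb, c, h hc, d, h hd, hq⟩

variable [DecidableEq V]

/-! ### Mistakes and removed nodes along a run -/

theorem Scan.subset {score : V → ℕ} {guess : Bool} {U U' : Finset V} {τ : List (Trial V)}
    {r : Option V} (h : Scan y score guess U τ U' r) : U' ⊆ U := by
  induction h with
  | done => exact subset_rfl
  | correct U v τ U' r _ _ _ _ ih => exact ih.trans (Finset.erase_subset _ _)
  | mistake U v => exact Finset.erase_subset _ _

theorem Scan.length_add_card {score : V → ℕ} {guess : Bool} {U U' : Finset V}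
    {τ : List (Trial V)} {r : Option V} (h : Scan y score guess U τ U' r) :
    τ.length + U'.card = U.card := by
  induction h with
  | done => rfl
  | correct U v τ U' r hv _ _ _ ih =>
    rw [List.length_cons, ← Finset.card_erase_add_one hv]
    omega
  | mistake U v hv => rw [← Finset.card_erase_add_one hv, List.length_singleton, add_comm]

theorem Scan.of_none {score : V → ℕ} {guess : Bool} {U U' : Finset V} {τ : List (Trial V)}
    (h : Scan y score guess U τ U' none) : U' = ∅ ∧ mistakes τ = 0 := by
  generalize hr : (none : Option V) = r at h
  induction h with
  | done => exact ⟨rfl, rfl⟩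
  | correct U v τ U' r _ _ hyv _ ih =>
    obtain ⟨h1, h2⟩ := ih hr
    refine ⟨h1, ?_⟩
    rw [hyv, mistakes_cons_correct, h2]
  | mistake U v => simp at hr

/-- The score of `b` dominates only the nodes left over; nodes scanned before `b` may have larger
scores and must be charged as removed. -/
theorem Scan.of_some {score : V → ℕ} {guess : Bool} {U U' : Finset V} {τ : List (Trial V)}
    {b : V} (h : Scan y score guess U τ U' (some b)) :
    b ∈ U ∧ b ∉ U' ∧ y b ≠ guess ∧ mistakes τ ≤ 1 ∧ ∀ v ∈ U', score v ≤ score b := by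
  generalize hr : some b = r at h
  induction h with
  | done => simp at hr
  | correct U v τ U' r _ _ hyv _ ih =>
    obtain ⟨h1, h2, h3, h4, h5⟩ := ih hr
    refine ⟨Finset.mem_of_mem_erase h1, h2, h3, ?_, h5⟩
    rwa [hyv, mistakes_cons_correct]
  | mistake U v hv hmax hyv =>
    obtain rfl := Option.some.inj hr
    exact ⟨hv, Finset.notMem_erase _ _, hyv, mistakes_le_length _,
      fun w hw => hmax w (Finset.mem_of_mem_erase hw)⟩

theorem Sweep.length_add_card {guess : Bool} {D U U' : Finset V} {τ : List (Trial V)}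
    (h : Sweep y guess D U τ U') (hD : D ⊆ U) : τ.length + U'.card = U.card := by
  induction h with
  | done => simp
  | correct D U d τ U' hd _ _ ih =>
    have := ih (Finset.erase_subset_erase _ hD)
    rw [List.length_cons, ← Finset.card_erase_add_one (hD hd)]
    omega
  | mistake D U d hd =>
    rw [← Finset.card_erase_add_one (hD hd), List.length_singleton, add_comm]

/-- A sweep without a mistake can stop only when `D` is exhausted, so it removes all of `D`. -/
theorem Sweep.of_correct {guess : Bool} {D U U' : Finset V} {τ : List (Trial V)}
    (h : Sweep y guess D U τ U') (hD : D ⊆ U) (hy : ∀ d ∈ D, y d = guess) :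
    mistakes τ = 0 ∧ D.card + U'.card = U.card := by
  induction h with
  | done => simp [mistakes]
  | correct D U d τ U' hd hyd _ ih =>
    obtain ⟨h1, h2⟩ := ih (Finset.erase_subset_erase _ hD)
      fun e he => hy e (Finset.mem_of_mem_erase he)
    rw [← Finset.card_erase_add_one (hD hd), ← Finset.card_erase_add_one hd, hyd,
      mistakes_cons_correct]
    exact ⟨h1, by omega⟩
  | mistake D U d hd hyd => exact absurd (hy d hd) hyd

theorem Rest.length_eq {U : Finset V} {τ : List (Trial V)} (h : Rest y U τ) :
    τ.length = U.card := by
  induction h with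
  | done => rfl
  | predict U v guess τ hv _ ih => rw [List.length_cons, ih, Finset.card_erase_add_one hv]

theorem Round.length_add_card {U U' : Finset V} {τ : List (Trial V)} (h : Round G y U τ U') :
    τ.length + U'.card = U.card := by
  cases h with
  | stop₂ a guess τ₂ _ ha _ h2 =>
    have := h2.length_add_card
    rw [List.length_cons, ← Finset.card_erase_add_one ha]
    omega
  | stop₃ a guess τ₂ U₂ b τ₃ _ ha _ h2 h3 =>
    have := h2.length_add_card
    have := h3.length_add_card
    rw [List.length_cons, List.length_append, ← Finset.card_erase_add_one ha]
    omega
  | full a guess τ₂ U₂ b τ₃ U₃ c D τ₄ _ ha _ h2 h3 hD h4 =>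
    have := h2.length_add_card
    have := h3.length_add_card
    have := h4.length_add_card fun d hd => ((hD d).1 hd).1
    rw [List.length_cons, List.length_append, List.length_append,
      ← Finset.card_erase_add_one ha]
    omega

theorem Loop.length_eq {U : Finset V} {τ : List (Trial V)} (h : Loop G y U τ) :
    τ.length = U.card := by
  induction h with
  | finish U τ _ h => exact h.length_eq
  | round U U' τ τ' _ h _ ih => rw [List.length_append, ih, h.length_add_card]

/-! ### Scores compared with the number of removed nodes -/

theorem count_le_add {α : Type*} [DecidableEq α] (U W : Finset α) (P : α → Prop) :
    count U P ≤ count W P + (U \ W).card := by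
  classical
  rw [count_eq U P, count_eq W P]
  refine (Finset.card_le_card (t := W.filter P ∪ (U \ W)) fun x hx => ?_).trans
    (Finset.card_union_le _ _)
  rw [Finset.mem_filter] at hx
  by_cases hxW : x ∈ W <;> simp [hxW, hx]

theorem sum_le_of_subset {α : Type*} [DecidableEq α] {U W : Finset α} (hW : W ⊆ U) {f : α → ℕ}
    {x z : ℕ} (hx : ∀ u ∈ W, f u ≤ x) (hz : ∀ u ∈ U, f u ≤ z) :
    ∑ u ∈ U, f u ≤ U.card * x + (U \ W).card * z := by
  rw [← Finset.sum_sdiff hW, add_comm]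
  refine Nat.add_le_add ?_ ?_
  · refine (Finset.sum_le_card_nsmul _ _ _ hx).trans ?_
    rw [smul_eq_mul]
    exact Nat.mul_le_mul_right _ (Finset.card_le_card hW)
  · exact (Finset.sum_le_card_nsmul _ _ _ fun u hu => hz u (Finset.mem_sdiff.1 hu).1).trans_eq
      (smul_eq_mul _ _)

/-- If the scans of a round leave `U₂` and `U₃`, then the score of the first node is bounded by
the number of nodes that the round removes. -/
theorem two_mul_score₁_le {U U₂ U₃ : Finset V} {a b c : V} (ha : a ∈ U) (hb : b ∈ U)
    (hc : c ∈ U₂) (hU₂ : U₂ ⊆ U) (hU₃ : U₃ ⊆ U₂)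
    (h2 : ∀ v ∈ U₂, score₂ G U a v ≤ score₂ G U a b)
    (h3 : ∀ v ∈ U₃, score₃ G (insert a (insert b U₂)) a b v ≤
      score₃ G (insert a (insert b U₂)) a b c) :
    2 * score₁ G U a ≤
      U.card ^ 2 * (3 * (U \ U₂).card + 2 * (U₂ \ U₃).card + count U₃ (Good G a b c)) := by
  set m := U.card with hm
  set S := insert a (insert b U₂) with hS
  have haS : a ∈ S := by simp [hS]
  have hbS : b ∈ S := by simp [hS]
  have hUS : U₂ ⊆ S := fun x hx => by simp [hS, hx]
  have hle : ∀ v, ∑ c ∈ U, count U (Good G a v c) ≤ m * m := fun v =>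
    (Finset.sum_le_card_nsmul _ _ _ fun u _ => count_le_card U _).trans_eq (smul_eq_mul _ _)
  -- Partners in `U₂` score at most as much as `b`; the removed ones get the trivial bound `m * m`.
  have e1 : 2 * score₁ G U a ≤ m * (2 * score₂ G U a b) + (U \ U₂).card * (m * m) := by
    rw [score₁_eq ha, Finset.mul_sum]
    refine sum_le_of_subset hU₂ (fun v hv => Nat.mul_le_mul_left _ (h2 v hv)) fun v hv => ?_
    rw [two_mul_score₂ ha hv]
    exact hle v
  -- Beyond `U₂` the set `S` contains only `a` and `b`, and neither can serve as `d`.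
  have hcS : score₃ G S a b c ≤ count U₃ (Good G a b c) + (U₂ \ U₃).card := by
    rw [score₃_eq haS hbS (hUS hc)]
    refine le_trans ?_ (count_le_add U₂ U₃ _)
    classical
    rw [count_eq S (Good G a b c), count_eq U₂ (Good G a b c)]
    refine Finset.card_le_card fun d hd => ?_
    rw [Finset.mem_filter] at hd ⊢
    have hne := hd.2.ne
    have := hd.1
    simp only [hS, Finset.mem_insert, hne.2.2.1.symm, hne.2.2.2.2.1.symm, false_or] at this
    exact ⟨this, hd.2⟩
  have e2 : ∑ v ∈ U₂, count U₂ (Good G a b v) ≤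
      m * (count U₃ (Good G a b c) + (U₂ \ U₃).card) + (U₂ \ U₃).card * m := by
    refine (sum_le_of_subset hU₃ (x := count U₃ (Good G a b c) + (U₂ \ U₃).card) (z := m)
      (fun v hv => ?_) fun v hv => (count_le_card _ _).trans (Finset.card_le_card hU₂)).trans ?_
    · refine le_trans ?_ ((h3 v hv).trans hcS)
      rw [score₃_eq haS hbS (hUS (hU₃ hv))]
      exact count_mono hUS fun _ _ h => h
    · gcongr
      exact Finset.card_le_card hU₂
  -- Restricting `c` and `d` to `U₂` costs at most `m` per removed node in each of the two
  -- coordinates.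
  have e3 : 2 * score₂ G U a b ≤
      ∑ v ∈ U₂, count U₂ (Good G a b v) + 2 * m * (U \ U₂).card := by
    rw [two_mul_score₂ ha hb, ← Finset.sum_sdiff hU₂]
    have f1 : ∑ v ∈ U \ U₂, count U (Good G a b v) ≤ (U \ U₂).card * m :=
      (Finset.sum_le_card_nsmul _ _ _ fun u _ => count_le_card U _).trans_eq (smul_eq_mul _ _)
    have f2 : ∑ v ∈ U₂, count U (Good G a b v) ≤
        ∑ v ∈ U₂, count U₂ (Good G a b v) + m * (U \ U₂).card := by
      calc ∑ v ∈ U₂, count U (Good G a b v)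
          ≤ ∑ v ∈ U₂, (count U₂ (Good G a b v) + (U \ U₂).card) :=
            Finset.sum_le_sum fun v _ => count_le_add U U₂ _
        _ = ∑ v ∈ U₂, count U₂ (Good G a b v) + U₂.card * (U \ U₂).card := by
            rw [Finset.sum_add_distrib, Finset.sum_const, smul_eq_mul]
        _ ≤ _ := by
            gcongr
            exact Finset.card_le_card hU₂
    linarith
  calc 2 * score₁ G U a ≤ m * (2 * score₂ G U a b) + (U \ U₂).card * (m * m) := e1
    _ ≤ m * ((m * (count U₃ (Good G a b c) + (U₂ \ U₃).card) + (U₂ \ U₃).card * m) +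
          2 * m * (U \ U₂).card) + (U \ U₂).card * (m * m) := by
        gcongr
        exact e3.trans (by gcongr)
    _ = _ := by ring

theorem Round.bound (hy : IsConvexBipartition G y) {U U' : Finset V} {τ : List (Trial V)}
    (h : Round G y U τ U') :
    mistakes τ ≤ 3 ∧ (U' = ∅ ∨ ∃ a ∈ U, (∀ a' ∈ U, score₁ G U a' ≤ score₁ G U a) ∧
      2 * score₁ G U a ≤ 3 * U.card ^ 2 * (U.card - U'.card)) := by
  cases h with
  | stop₂ a guess τ₂ _ ha _ h2 =>
    obtain ⟨h, h'⟩ := h2.of_none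
    have := mistakes_cons_le ⟨a, guess, y a⟩ τ₂
    exact ⟨by omega, Or.inl h⟩
  | stop₃ a guess τ₂ U₂ b τ₃ _ ha _ h2 h3 =>
    obtain ⟨h, h'⟩ := h3.of_none
    have := mistakes_cons_le ⟨a, guess, y a⟩ (τ₂ ++ τ₃)
    have := mistakes_append τ₂ τ₃
    have := h2.of_some.2.2.2.1
    exact ⟨by omega, Or.inl h⟩
  | full a guess τ₂ U₂ b τ₃ U₃ c D τ₄ _ ha hmax h2 h3 hD h4 =>
    rw [Finset.insert_erase ha] at h2
    obtain ⟨hb, hbU, hyb, hm2, hs2⟩ := h2.of_some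
    obtain ⟨hc, hcU, hyc, hm3, hs3⟩ := h3.of_some
    have hyab : y a = y b := by
      revert hyb
      cases y a <;> cases y b <;> simp
    have hDU : D ⊆ U₃ := fun d hd => ((hD d).1 hd).1
    have hDg : ∀ d ∈ D, Good G a b c d := fun d hd =>
      (mem_goodQuads.1 ((hD d).1 hd).2).2.2.2.2
    -- Step 4 cannot err: otherwise `(a, b)` and `(c, d)` would be monochromatic with opposite
    -- labels although their intervals meet.
    have hyd : ∀ d ∈ D, y d = y a := by
      intro d hd
      by_contra hne
      have hcd : y c = y d := by
        revert hne hyc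
        cases y a <;> cases y c <;> cases y d <;> simp
      exact hyc ((hDg d hd).label_eq hy hyab hcd).symm
    obtain ⟨hm4, hcard⟩ := h4.of_correct hDU hyd
    have hU₂ : U₂ ⊆ U := h2.subset.trans (Finset.erase_subset _ _)
    refine ⟨?_, Or.inr ⟨a, ha, hmax, ?_⟩⟩
    · have := mistakes_cons_le ⟨a, guess, y a⟩ (τ₂ ++ τ₃ ++ τ₄)
      rw [mistakes_append, mistakes_append] at this
      omega
    · have hcount : count U₃ (Good G a b c) ≤ D.card := by
        classical
        rw [count_eq U₃ (Good G a b c)]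
        refine Finset.card_le_card fun d hd => ?_
        rw [Finset.mem_filter] at hd
        refine (hD d).2 ⟨hd.1, mem_goodQuads.2 ?_⟩
        simp [hd]
      refine (two_mul_score₁_le ha (Finset.mem_of_mem_erase hb) hc hU₂ h3.subset hs2 hs3).trans ?_
      have e2 := Finset.card_sdiff_add_card_eq_card hU₂
      have e3 := Finset.card_sdiff_add_card_eq_card h3.subset
      rw [mul_comm 3 (U.card ^ 2), mul_assoc]
      refine Nat.mul_le_mul_left _ ?_
      omega

/-- Every four-element set with a good quadruple gives rise to eight ordered ones. -/
theorem eight_mul_le (U : Finset V) :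
    8 * count (U.powersetCard 4) (fun A => ¬ goodQuads G A = ∅) ≤
      ∑ a ∈ U, 2 * score₁ G U a := by
  classical
  set T := (U ×ˢ U ×ˢ U ×ˢ U).filter fun p => Good G p.1 p.2.1 p.2.2.1 p.2.2.2 with hT
  have hsum : ∑ a ∈ U, 2 * score₁ G U a = T.card := by
    rw [hT, Finset.card_filter, Finset.sum_product]
    refine Finset.sum_congr rfl fun a ha => ?_
    rw [score₁_eq ha, Finset.mul_sum, Finset.sum_product]
    refine Finset.sum_congr rfl fun b hb => ?_
    rw [two_mul_score₂ ha hb, Finset.sum_product]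
    refine Finset.sum_congr rfl fun c hc => ?_
    rw [count_eq, Finset.card_filter]
  -- The ordered good quadruples are grouped by their underlying four-sets; each fibre contains the
  -- eight symmetric images of one quadruple.
  rw [hsum, count_eq, Finset.card_eq_sum_card_fiberwise (s := T)
    (f := fun p => ({p.1, p.2.1, p.2.2.1, p.2.2.2} : Finset V))
    (t := (U.powersetCard 4).filter fun A => ¬ goodQuads G A = ∅), mul_comm, ← smul_eq_mul]
  · refine Finset.card_nsmul_le_sum _ _ _ fun A hA => ?_
    simp only [Finset.mem_filter, Finset.mem_powersetCard, goodQuads_eq_empty] at hA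
    obtain ⟨⟨hAU, hAc⟩, hA⟩ := hA
    push Not at hA
    obtain ⟨a, ha, b, hb, c, hc, d, hd, hg⟩ := hA
    obtain ⟨n1, n2, n3, n4, n5, n6⟩ := hg.ne
    have hsets : ∀ p ∈ A ×ˢ A ×ˢ A ×ˢ A, Good G p.1 p.2.1 p.2.2.1 p.2.2.2 →
        p ∈ T.filter fun p => ({p.1, p.2.1, p.2.2.1, p.2.2.2} : Finset V) = A := by
      rintro ⟨p, q, u, v⟩ hmem hp
      simp only [Finset.mem_product] at hmem
      obtain ⟨n1, n2, n3, n4, n5, n6⟩ := hp.ne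
      simp only [hT, Finset.mem_filter, Finset.mem_product]
      refine ⟨⟨⟨hAU hmem.1, hAU hmem.2.1, hAU hmem.2.2.1, hAU hmem.2.2.2⟩, hp⟩,
        Finset.eq_of_subset_of_card_le (fun x hx => ?_) ?_⟩
      · simp only [Finset.mem_insert, Finset.mem_singleton] at hx
        rcases hx with rfl | rfl | rfl | rfl
        exacts [hmem.1, hmem.2.1, hmem.2.2.1, hmem.2.2.2]
      · simp only at n1 n2 n3 n4 n5 n6
        rw [hAc]
        simp [n1, n2, n3, n4, n5, n6]
    have hg1 := Good.comm_left.1 hg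
    have hg2 := Good.comm_right.1 hg
    have hg3 := Good.comm_right.1 hg1
    have h8 : ({(a, b, c, d), (b, a, c, d), (a, b, d, c), (b, a, d, c), (c, d, a, b),
        (c, d, b, a), (d, c, a, b), (d, c, b, a)} : Finset (V × V × V × V)).card = 8 := by
      simp [n1, n2, n3, n4, n5, n6, n1.symm, n2.symm, n3.symm, n4.symm, n5.symm, n6.symm]
    rw [← h8]
    refine Finset.card_le_card fun p hp => ?_
    simp only [Finset.mem_insert, Finset.mem_singleton] at hp
    rcases hp with rfl | rfl | rfl | rfl | rfl | rfl | rfl | rfl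
    · exact hsets _ (by simp [ha, hb, hc, hd]) hg
    · exact hsets _ (by simp [ha, hb, hc, hd]) hg1
    · exact hsets _ (by simp [ha, hb, hc, hd]) hg2
    · exact hsets _ (by simp [ha, hb, hc, hd]) hg3
    · exact hsets _ (by simp [ha, hb, hc, hd]) (Good.swap.1 hg)
    · exact hsets _ (by simp [ha, hb, hc, hd]) (Good.swap.1 hg1)
    · exact hsets _ (by simp [ha, hb, hc, hd]) (Good.swap.1 hg2)
    · exact hsets _ (by simp [ha, hb, hc, hd]) (Good.swap.1 hg3)
  · intro p hp
    simp only [hT, Finset.coe_filter, Finset.mem_product, Set.mem_ofPred_eq] at hp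
    obtain ⟨⟨ha, hb, hc, hd⟩, hg⟩ := hp
    obtain ⟨n1, n2, n3, n4, n5, n6⟩ := hg.ne
    simp only [Finset.coe_filter, Finset.mem_powersetCard, Set.mem_ofPred_eq]
    refine ⟨⟨?_, by simp [n1, n2, n3, n4, n5, n6]⟩, fun h => ?_⟩
    · intro x hx
      simp only [Finset.mem_insert, Finset.mem_singleton] at hx
      rcases hx with rfl | rfl | rfl | rfl <;> assumption
    · exact goodQuads_eq_empty.1 h _ (by simp) _ (by simp) _ (by simp) _ (by simp) hg

/-- A lower bound for the number of ordered good quadruples. -/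
theorem choose_three_mul_le_sum_score₁ [Fintype V] (hG : G.Connected)
    (hV : 2 ≤ Fintype.card V) (U : Finset V) :
    2 * (U.card.choose 3 * (U.card - (2 * hadwiger G - 1))) ≤
      (2 * hadwiger G - 1).choose 3 * ∑ a ∈ U, 2 * score₁ G U a := by
  have h := choose_three_mul_le (U := U) (I := fun A => goodQuads G A = ∅)
    (fun A B hAB hB => Set.subset_eq_empty (goodQuads_mono hAB) hB) ?_ ?_
    (α := 2 * hadwiger G - 1) ?_
  · calc _ ≤ 2 * ((2 * hadwiger G - 1).choose 3 *
          (4 * count (U.powersetCard 4) fun A => ¬ goodQuads G A = ∅)) := by gcongr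
      _ = (2 * hadwiger G - 1).choose 3 *
          (8 * count (U.powersetCard 4) fun A => ¬ goodQuads G A = ∅) := by ring
      _ ≤ _ := by
        gcongr
        exact eight_mul_le U
  · intro A hA
    rw [goodQuads_eq_empty]
    intro a ha b hb c hc d hd hg
    obtain ⟨n1, n2, n3, n4, n5, n6⟩ := hg.ne
    have : ({a, b, c, d} : Finset V).card ≤ A.card := by
      refine Finset.card_le_card fun x hx => ?_
      simp only [Finset.mem_insert, Finset.mem_singleton] at hx
      rcases hx with rfl | rfl | rfl | rfl <;> assumption
    simp [n1, n2, n3, n4, n5, n6] at this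
    omega
  -- A good quadruple created by adding `v` contains `v`. The symmetries move `v` to the front, and
  -- the other three nodes form `T`.
  · intro A v hv hA hvA
    have key : ∀ b c d, b ∈ insert v A → c ∈ insert v A → d ∈ insert v A → Good G v b c d →
        ∃ T ⊆ A, T.card = 3 ∧ ¬ goodQuads G (insert v T) = ∅ := by
      intro b c d hb hc hd hg
      obtain ⟨n1, n2, n3, n4, n5, n6⟩ := hg.ne
      refine ⟨{b, c, d}, ?_, by simp [n4, n5, n6], fun h => ?_⟩
      · intro x hx
        simp only [Finset.mem_insert, Finset.mem_singleton] at hx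
        rcases hx with rfl | rfl | rfl
        exacts [Finset.mem_of_mem_insert_of_ne hb n1.symm,
          Finset.mem_of_mem_insert_of_ne hc n2.symm, Finset.mem_of_mem_insert_of_ne hd n3.symm]
      · exact goodQuads_eq_empty.1 h v (by simp) b (by simp) c (by simp) d (by simp) hg
    rw [goodQuads_eq_empty] at hvA hA
    push Not at hvA
    obtain ⟨a, ha, b, hb, c, hc, d, hd, hg⟩ := hvA
    by_cases h1 : a = v
    · subst h1
      exact key b c d hb hc hd hg
    by_cases h2 : b = v
    · subst h2
      exact key a c d ha hc hd (Good.comm_left.1 hg)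
    by_cases h3 : c = v
    · subst h3
      exact key d a b hd ha hb (Good.swap.1 hg)
    by_cases h4 : d = v
    · subst h4
      exact key c a b hc ha hb (Good.swap.1 (Good.comm_right.1 hg))
    exact absurd hg (hA a (Finset.mem_of_mem_insert_of_ne ha h1)
      b (Finset.mem_of_mem_insert_of_ne hb h2) c (Finset.mem_of_mem_insert_of_ne hc h3)
      d (Finset.mem_of_mem_insert_of_ne hd h4))
  · intro A _ hA
    have := card_lt_of_goodQuads_eq_empty hG hV hA
    omega

/-! ### The fraction of nodes removed by a round -/

theorem six_mul_choose_three (k : ℕ) :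
    (6 * k.choose 3 : ℝ) = k * (k - 1) * (k - 2) := by
  rw [Nat.cast_choose_eq_descPochhammer_div]
  simp [descPochhammer_succ_right, Nat.factorial]
  ring

/-- The arithmetic behind the number of nodes that a round removes. -/
theorem le_pow_mul_of_choose {h m r s : ℕ} (hh : 2 ≤ h) (hm : (h + 1) ^ 4 < m)
    (h1 : 2 * (m.choose 3 * (m - (2 * h - 1))) ≤ (2 * h - 1).choose 3 * (m * s))
    (h2 : s ≤ 3 * m ^ 2 * r) : (m : ℝ) ≤ ((h : ℝ) + 1) ^ 4 * r := by
  by_contra! hcon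
  have hmh : 2 * h - 1 ≤ m := by
    have : 2 * (h + 1) ≤ (h + 1) ^ 4 := by
      rw [pow_succ]
      have : 2 ≤ (h + 1) ^ 3 := le_trans (by omega) (Nat.le_self_pow (by norm_num) (h + 1))
      gcongr
    omega
  have h1' : (2 * (m.choose 3 * (m - (2 * h - 1))) : ℝ) ≤ (2 * h - 1 : ℕ).choose 3 * (m * s) := by
    have := h1
    rify [hmh] at this
    rwa [Nat.cast_sub (by omega : 1 ≤ 2 * h), Nat.cast_mul, Nat.cast_ofNat, Nat.cast_one] at this
  have h2' : (s : ℝ) ≤ 3 * m ^ 2 * r := by exact_mod_cast h2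
  have c1 := six_mul_choose_three m
  have c2 := six_mul_choose_three (2 * h - 1)
  push_cast [show 1 ≤ 2 * h by omega] at c2
  -- In the variable x = h - 2 the relevant polynomials in h have nonnegative coefficients.
  obtain ⟨H, rfl⟩ : ∃ H, h = H + 2 := ⟨h - 2, by omega⟩
  have hmr : (((H + 2 : ℕ) : ℝ) + 1) ^ 4 < m := by exact_mod_cast hm
  push_cast at hmr hcon h1' c2
  set x : ℝ := (H : ℝ) with hx
  have hx0 : 0 ≤ x := Nat.cast_nonneg _
  set z : ℝ := (m : ℝ) with hz
  set M : ℝ := (x + 2 + 1) ^ 4 with hM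
  have hM0 : 0 < M := by positivity
  have hz0 : 0 < z := hM0.trans hmr
  set P : ℝ := (2 * x + 3) * (2 * x + 2) * (2 * x + 1) with hP
  have hP0 : 0 < P := by positivity
  have hc2 : (6 * (2 * (H + 2) - 1 : ℕ).choose 3 : ℝ) = P := by
    rw [c2, hP]
    ring
  have e1 : 2 * (z * (z - 1) * (z - 2)) * (z - (2 * x + 3)) ≤ P * (z * s) := by
    rw [← c1, ← hc2]
    linarith
  have e2 : P * (z * s) ≤ P * (z * (3 * z ^ 2 * r)) := by gcongr
  have e3 : M * (P * (z * (3 * z ^ 2 * r))) ≤ 3 * P * z ^ 4 := by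
    have : 3 * P * z ^ 3 * (M * r) ≤ 3 * P * z ^ 3 * z := by gcongr
    linarith
  -- The numbers 1, 2 and 2x+3 add up to 2x+6, and the remaining terms of the expansion are
  -- nonnegative.
  have e4 : z * z ^ 2 * (z - (2 * x + 6)) ≤ z * (z - 1) * (z - 2) * (z - (2 * x + 3)) := by
    have : z * (z - 1) * (z - 2) * (z - (2 * x + 3)) - z * z ^ 2 * (z - (2 * x + 6)) =
        z * (3 * z * (2 * x + 3) + 2 * (z - (2 * x + 3))) := by ring
    have hzx : 2 * x + 3 ≤ z := by
      refine le_trans ?_ hmr.le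
      rw [hM]
      nlinarith [sq_nonneg (x + 3), pow_nonneg hx0 3, pow_nonneg hx0 4, pow_nonneg hx0 2]
    have : 0 ≤ z * (3 * z * (2 * x + 3) + 2 * (z - (2 * x + 3))) :=
      mul_nonneg hz0.le (add_nonneg (by positivity) (by linarith))
    linarith
  have e5 : z ^ 3 * (2 * M * (z - (2 * x + 6))) ≤ z ^ 3 * (3 * P * z) := by
    have := mul_le_mul_of_nonneg_left (e1.trans e2) hM0.le
    have := mul_le_mul_of_nonneg_left e4 (by positivity : 0 ≤ 2 * M)
    linarith
  have e6 := le_of_mul_le_mul_left e5 (by positivity)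
  -- The cubic terms cancel. What is left exceeds 2(2x+6), the most that `e6` permits given M < z.
  have e7 : 2 * M - 3 * P = 2 * x ^ 4 + 36 * x ^ 2 + 150 * x + 144 := by
    rw [hM, hP]
    ring
  have e8 : M * (2 * M - 3 * P) ≤ z * (2 * M - 3 * P) :=
    mul_le_mul_of_nonneg_right hmr.le (by rw [e7]; positivity)
  have e9 : M * (2 * M - 3 * P) ≤ M * (2 * (2 * x + 6)) := by linarith
  have e10 := le_of_mul_le_mul_left e9 hM0
  rw [e7] at e10
  nlinarith [pow_nonneg hx0 4, pow_nonneg hx0 2]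

/-- As long as more than `(h + 1) ^ 4` nodes are unlabeled, every round labels at least the
fraction `1 / (h + 1) ^ 4` of them. -/
theorem Round.card_le [Fintype V] (hG : G.Connected) (hV : 2 ≤ Fintype.card V)
    (hy : IsConvexBipartition G y) {U U' : Finset V} {τ : List (Trial V)} (h : Round G y U τ U')
    (hU : (hadwiger G + 1) ^ 4 < U.card) :
    (U.card : ℝ) ≤ ((hadwiger G : ℝ) + 1) ^ 4 * (U.card - U'.card) := by
  have hUU := h.length_add_card
  have hcast : ((U.card - U'.card : ℕ) : ℝ) = (U.card : ℝ) - U'.card :=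
    Nat.cast_sub (by omega)
  rw [← hcast]
  rcases (h.bound hy).2 with rfl | ⟨a, ha, hmax, hs⟩
  · have : (1 : ℝ) ≤ ((hadwiger G : ℝ) + 1) ^ 4 := one_le_pow₀ (by simp)
    rw [Finset.card_empty, Nat.sub_zero]
    exact le_mul_of_one_le_left (Nat.cast_nonneg _) this
  · refine le_pow_mul_of_choose (two_le_hadwiger hG hV) hU
      ((choose_three_mul_le_sum_score₁ hG hV U).trans ?_) hs
    gcongr
    exact (Finset.sum_le_card_nsmul _ _ _ fun v hv =>
      Nat.mul_le_mul_left 2 (hmax v hv)).trans_eq (smul_eq_mul _ _)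

theorem Loop.mistakes_le [Fintype V] (hG : G.Connected) (hV : 2 ≤ Fintype.card V)
    (hy : IsConvexBipartition G y) {U : Finset V} {τ : List (Trial V)} (h : Loop G y U τ)
    (hU : 2 ≤ U.card) :
    (mistakes τ : ℝ) ≤ 3 * ((hadwiger G : ℝ) + 1) ^ 4 * Real.log U.card := by
  set M : ℝ := ((hadwiger G : ℝ) + 1) ^ 4 with hM
  have hh := two_le_hadwiger hG hV
  have hM81 : 81 ≤ M := by
    have : (2 : ℝ) ≤ hadwiger G := by exact_mod_cast hh
    calc (81 : ℝ) = (2 + 1) ^ 4 := by norm_num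
      _ ≤ M := by
        rw [hM]
        gcongr
  have hlog2 := Real.log_two_gt_d9
  -- The factor 3 suffices here because log 2 > 1/3.
  have hlog : ∀ k : ℕ, 2 ≤ k → M ≤ 3 * M * Real.log k := by
    intro k hk
    have : Real.log 2 ≤ Real.log k := Real.log_le_log (by norm_num) (by exact_mod_cast hk)
    nlinarith
  have hsmall : ∀ (W : Finset V) (σ : List (Trial V)), Loop G y W σ → 2 ≤ W.card →
      W.card ≤ (hadwiger G + 1) ^ 4 → (mistakes σ : ℝ) ≤ 3 * M * Real.log W.card := by
    intro W σ hσ hW hWM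
    refine le_trans ?_ (hlog _ hW)
    have h1 := mistakes_le_length σ
    rw [hσ.length_eq] at h1
    rw [hM]
    exact_mod_cast h1.trans hWM
  induction h with
  | finish U τ hq hr =>
    refine hsmall U τ (.finish U τ hq hr) hU ?_
    have h1 := card_lt_of_goodQuads_eq_empty hG hV hq
    have h2 : 2 ≤ (hadwiger G + 1) ^ 3 :=
      le_trans (by omega) (Nat.le_self_pow (by norm_num) (hadwiger G + 1))
    calc U.card ≤ 2 * (hadwiger G + 1) := by omega
      _ ≤ (hadwiger G + 1) ^ 3 * (hadwiger G + 1) := by gcongr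
      _ = _ := by ring
  | round U U' τ τ' hq hr hl ih =>
    rcases Nat.lt_or_ge ((hadwiger G + 1) ^ 4) U.card with hbig | hle
    swap
    · exact hsmall U _ (.round U U' τ τ' hq hr hl) hU hle
    have h3 := (hr.bound hy).1
    have hρ := hr.card_le hG hV hy hbig
    rw [← hM] at hρ
    have hm : (mistakes (τ ++ τ') : ℝ) ≤ 3 + mistakes τ' := by
      rw [mistakes_append]
      push_cast
      gcongr
      exact_mod_cast h3
    refine hm.trans ?_
    rcases Nat.lt_or_ge U'.card 2 with hlt | hge
    -- The induction hypothesis needs two nodes. With at most one left there are at most four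
    -- mistakes in all, well below `M`.
    · have h1 := mistakes_le_length τ'
      rw [hl.length_eq] at h1
      have h2 : (mistakes τ' : ℝ) ≤ 1 := by exact_mod_cast (by omega : mistakes τ' ≤ 1)
      linarith [hlog _ hU]
    · have hU0 : (0 : ℝ) < U.card := by exact_mod_cast (by omega : 0 < U.card)
      have hU0' : (0 : ℝ) < U'.card := by exact_mod_cast (by omega : 0 < U'.card)
      -- By log t ≤ t - 1 the removed fraction lowers `M * log` by at least 1, which pays for the
      -- three mistakes of the round.
      have h1 := Real.log_le_sub_one_of_pos (div_pos hU0' hU0)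
      rw [Real.log_div hU0'.ne' hU0.ne'] at h1
      have h2 : 1 ≤ M * (1 - (U'.card : ℝ) / U.card) := by
        rw [one_sub_div hU0.ne', ← mul_div_assoc, le_div_iff₀ hU0, one_mul]
        exact hρ
      have h4 : M * (Real.log U'.card - Real.log U.card) ≤ M * ((U'.card : ℝ) / U.card - 1) :=
        mul_le_mul_of_nonneg_left h1 (by linarith)
      linarith [ih hge]

end Bound

end Good4

namespace Good4

/-! ### Runs of the algorithm, trial by trial -/

section Phases

variable {V : Type*}

/-- The phases of the algorithm between two trials, together with the data that determine the
scores: the set `S` of unlabeled nodes at the start of Step 2, and the set `W` of unlabeled nodes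
just before `b` was selected in Step 2. -/
inductive Phase (V : Type*) where
  | start
  | scan₂ (a : V) (S : Finset V)
  | scan₃ (a b : V) (W : Finset V)
  | sweep (a b c : V)

theorem goodQuads_empty (G : SimpleGraph V) : goodQuads G (∅ : Finset V) = ∅ :=
  goodQuads_eq_empty.2 (by simp)

variable [DecidableEq V]

/-- The trials `τ` complete a run of the algorithm that has reached the given phase with the
unlabeled set `U`. -/
def Completes (G : SimpleGraph V) (y : V → Bool) : Phase V → Finset V → List (Trial V) → Prop
  | .start, U, τ => Loop G y U τ
  | .sweep a b c, U, τ => ∃ D τ₄ U₄ τ', (∀ d, d ∈ D ↔ d ∈ U ∧ Good G a b c d) ∧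
      Sweep y (y a) D U τ₄ U₄ ∧ Loop G y U₄ τ' ∧ τ = τ₄ ++ τ'
  | .scan₃ a b W, U, τ => ∃ τ₃ U₃ r τ', Scan y (score₃ G (insert a W) a b) (y a) U τ₃ U₃ r ∧
      τ = τ₃ ++ τ' ∧ ((r = none ∧ Loop G y U₃ τ') ∨
        ∃ c, r = some c ∧ Completes G y (.sweep a b c) U₃ τ')
  | .scan₂ a S, U, τ => ∃ τ₂ U₂ r τ', Scan y (score₂ G S a) (!y a) U τ₂ U₂ r ∧
      τ = τ₂ ++ τ' ∧ ((r = none ∧ Loop G y U₂ τ') ∨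
        ∃ b, r = some b ∧ Completes G y (.scan₃ a b (insert b U₂)) U₂ τ')
termination_by ph => match ph with
  | .start => 0
  | .sweep .. => 1
  | .scan₃ .. => 2
  | .scan₂ .. => 3

variable {G : SimpleGraph V} {y : V → Bool} {U : Finset V} {τ : List (Trial V)}

/-- In every phase the run may end when no node is left, so the program needs no special treatment
of the end. -/
theorem completes_nil (ph : Phase V) : Completes G y ph ∅ [] := by
  have hl : Loop G y ∅ [] := .finish _ _ (goodQuads_empty G) .done
  cases ph with
  | start => simpa only [Completes] using hl
  | sweep a b c =>
    rw [Completes]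
    exact ⟨∅, [], ∅, [], by simp, .done _, hl, rfl⟩
  | scan₃ a b W =>
    rw [Completes]
    exact ⟨[], ∅, none, [], .done, rfl, .inl ⟨rfl, hl⟩⟩
  | scan₂ a S =>
    rw [Completes]
    exact ⟨[], ∅, none, [], .done, rfl, .inl ⟨rfl, hl⟩⟩

theorem completes_sweep_of_forall_not {a b c : V} (h : ∀ d ∈ U, ¬ Good G a b c d)
    (hτ : Completes G y .start U τ) : Completes G y (.sweep a b c) U τ := by
  rw [Completes] at hτ
  rw [Completes]
  refine ⟨∅, [], U, τ, fun d => ?_, .done _, hτ, rfl⟩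
  simp only [Finset.notMem_empty, false_iff, not_and]
  exact h d

theorem completes_sweep_correct {a b c d : V} (hd : d ∈ U) (hg : Good G a b c d)
    (hyd : y d = y a) (hτ : Completes G y (.sweep a b c) (U.erase d) τ) :
    Completes G y (.sweep a b c) U (⟨d, y a, y d⟩ :: τ) := by
  rw [Completes] at hτ ⊢
  obtain ⟨D, τ₄, U₄, τ', hD, hs, hl, rfl⟩ := hτ
  have hdD : d ∉ D := by simp [hD]
  refine ⟨insert d D, _, U₄, τ', fun e => ?_, .correct (insert d D) U d τ₄ U₄ (by simp) hyd ?_,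
    hl, rfl⟩
  · by_cases hed : e = d
    · simp [hed, hd, hg]
    · simp [hed, hD]
  · rwa [Finset.erase_insert hdD]

open scoped Classical in
theorem completes_sweep_mistake {a b c d : V} (hd : d ∈ U) (hg : Good G a b c d)
    (hyd : y d ≠ y a) (hτ : Completes G y .start (U.erase d) τ) :
    Completes G y (.sweep a b c) U (⟨d, y a, y d⟩ :: τ) := by
  rw [Completes] at hτ
  rw [Completes]
  refine ⟨U.filter (Good G a b c), _, _, τ, by simp, .mistake _ U d ?_ hyd, hτ, rfl⟩
  simp [hd, hg]

theorem completes_scan₃_correct {a b c : V} {W : Finset V} (hc : c ∈ U)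
    (hmax : ∀ v ∈ U, score₃ G (insert a W) a b v ≤ score₃ G (insert a W) a b c)
    (hyc : y c = y a) (hτ : Completes G y (.scan₃ a b W) (U.erase c) τ) :
    Completes G y (.scan₃ a b W) U (⟨c, y a, y c⟩ :: τ) := by
  rw [Completes] at hτ ⊢
  obtain ⟨τ₃, U₃, r, τ', hs, rfl, h⟩ := hτ
  exact ⟨_, U₃, r, τ', .correct _ _ _ _ _ hc hmax hyc hs, rfl, h⟩

theorem completes_scan₃_mistake {a b c : V} {W : Finset V} (hc : c ∈ U)
    (hmax : ∀ v ∈ U, score₃ G (insert a W) a b v ≤ score₃ G (insert a W) a b c)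
    (hyc : y c ≠ y a) (hτ : Completes G y (.sweep a b c) (U.erase c) τ) :
    Completes G y (.scan₃ a b W) U (⟨c, y a, y c⟩ :: τ) := by
  rw [Completes]
  exact ⟨_, _, _, τ, .mistake _ _ hc hmax hyc, rfl, .inr ⟨c, rfl, hτ⟩⟩

theorem completes_scan₂_correct {a b : V} {S : Finset V} (hb : b ∈ U)
    (hmax : ∀ v ∈ U, score₂ G S a v ≤ score₂ G S a b) (hyb : y b = !y a)
    (hτ : Completes G y (.scan₂ a S) (U.erase b) τ) :
    Completes G y (.scan₂ a S) U (⟨b, !y a, y b⟩ :: τ) := by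
  rw [Completes] at hτ ⊢
  obtain ⟨τ₃, U₃, r, τ', hs, rfl, h⟩ := hτ
  exact ⟨_, U₃, r, τ', .correct _ _ _ _ _ hb hmax hyb hs, rfl, h⟩

theorem completes_scan₂_mistake {a b : V} {S : Finset V} (hb : b ∈ U)
    (hmax : ∀ v ∈ U, score₂ G S a v ≤ score₂ G S a b) (hyb : y b ≠ !y a)
    (hτ : Completes G y (.scan₃ a b U) (U.erase b) τ) :
    Completes G y (.scan₂ a S) U (⟨b, !y a, y b⟩ :: τ) := by
  rw [Completes]
  refine ⟨_, _, _, τ, .mistake _ _ hb hmax hyb, rfl, .inr ⟨b, rfl, ?_⟩⟩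
  rwa [Finset.insert_erase hb]

/-- If there are no good quadruples, the same trials count as the final arbitrary predictions;
otherwise the phases are assembled into a round. Hence a program may always begin a new round
without testing for good quadruples. -/
theorem completes_start {a : V} {guess : Bool} (ha : a ∈ U)
    (hmax : ∀ v ∈ U, score₁ G U v ≤ score₁ G U a)
    (hτ : Completes G y (.scan₂ a U) (U.erase a) τ) (hrest : Rest y U (⟨a, guess, y a⟩ :: τ)) :
    Completes G y .start U (⟨a, guess, y a⟩ :: τ) := by
  rw [Completes]
  rcases Set.eq_empty_or_nonempty (goodQuads G U) with hq | hq
  · exact .finish _ _ hq hrest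
  rw [Completes] at hτ
  obtain ⟨τ₂, U₂, r, τ', hs, rfl, ⟨rfl, hl⟩ | ⟨b, rfl, hτ⟩⟩ := hτ
  · exact .round U U₂ (⟨a, guess, y a⟩ :: τ₂) τ' hq
      (.stop₂ U a guess τ₂ U₂ ha hmax (by rwa [Finset.insert_erase ha])) hl
  rw [Completes] at hτ
  obtain ⟨τ₃, U₃, r, τ', hs', rfl, ⟨rfl, hl⟩ | ⟨c, rfl, hτ⟩⟩ := hτ
  · rw [← List.append_assoc]
    exact .round U U₃ (⟨a, guess, y a⟩ :: (τ₂ ++ τ₃)) τ' hq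
      (.stop₃ U a guess τ₂ U₂ b τ₃ U₃ ha hmax (by rwa [Finset.insert_erase ha]) hs') hl
  rw [Completes] at hτ
  obtain ⟨D, τ₄, U₄, τ', hD, hs'', hl, rfl⟩ := hτ
  rw [← List.append_assoc, ← List.append_assoc]
  refine .round U U₄ (⟨a, guess, y a⟩ :: (τ₂ ++ τ₃ ++ τ₄)) τ' hq
    (.full U a guess τ₂ U₂ b τ₃ U₃ c D τ₄ U₄ ha hmax (by rwa [Finset.insert_erase ha]) hs'
      (fun d => ?_) hs'') hl
  rw [hD, mem_goodQuads]
  simp +contextual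

end Phases

end Good4

namespace Good4

/-! ### Expressions for the scores -/

section Expressions

namespace Exp

/-- Negation; expressions serve as conditions by being nonzero. -/
def not (a : Exp) : Exp := .sub (.const 1) a

/-- Conjunction. -/
def and (a b : Exp) : Exp := .ite a b (.const 0)

/-- The comparison `a ≤ b`. -/
def le (a b : Exp) : Exp := not (.sub a b)

/-- The condition `a ≠ b`. -/
def ne (a b : Exp) : Exp := .add (.sub a b) (.sub b a)

/-- The value `1` if the condition `a` holds, and `0` otherwise. -/
def bit (a : Exp) : Exp := .ite a (.const 1) (.const 0)

/-- The address at which the entry `(u, v)` of the distance matrix is stored, for variables `u`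
and `v`. -/
def cell (u v : ℕ) : Exp :=
  .add (.add (.var 0) (.sum 20 (.ite (.sub (.var u) (.var 20)) (.var 0) (.const 0)))) (.var v)

/-- Node `x` is on a shortest path between `p` and `q`. The matrix stores `n` minus the distance. -/
def between (p x q : ℕ) : Exp :=
  not (ne (.add (.load (cell p x)) (.load (cell x q))) (.add (.var 0) (.load (cell p q))))

/-- The indicator of `{(p, q), (u, w)}` being a good quadruple. -/
def good (p q u w : ℕ) : Exp :=
  bit (and (ne (.var p) (.var q)) (and (ne (.var p) (.var u)) (and (ne (.var p) (.var w))
    (and (ne (.var q) (.var u)) (and (ne (.var q) (.var w)) (and (ne (.var u) (.var w))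
      (.sum 21 (and (between p 21 q) (between u 21 w)))))))))

/-- Node `v` was unlabeled at time `T`: the memory cell of a node holds `0` as long as the node is
unlabeled, and then the time at which it was labeled, where time runs backwards. -/
def unlabeled (v T : ℕ) : Exp := le (.load (.var v)) (.var T)

/-- The sum of `a` over all nodes `i` that were unlabeled at time `T`. -/
def sumOver (i T : ℕ) (a : Exp) : Exp := .sum i (and (unlabeled i T) a)

/-- The least value of the variable `25` for which the condition `a` holds. -/
def first (a : Exp) : Exp :=
  .sum 26 (not (.sum 25 (and (le (.var 25) (.var 26)) a)))

/-- The first node of maximal `key` among the nodes that were unlabeled at time `2`. -/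
def argmax (key : ℕ → Exp) : Exp :=
  first (and (unlabeled 25 2) (not (sumOver 27 2 (.sub (key 27) (key 25)))))

end Exp

variable {n : ℕ} {G : SimpleGraph (Fin n)} {m : ℕ → ℕ} {ρ : ℕ → ℕ}

/-! ### Values of the expressions -/

theorem Exp.eval_not (a : Exp) : a.not.eval G m ρ = 1 - a.eval G m ρ := rfl

theorem Exp.eval_not_ne_zero {a : Exp} : a.not.eval G m ρ ≠ 0 ↔ a.eval G m ρ = 0 := by
  rw [eval_not]
  omega

theorem Exp.eval_and_ne_zero {a b : Exp} :
    (a.and b).eval G m ρ ≠ 0 ↔ a.eval G m ρ ≠ 0 ∧ b.eval G m ρ ≠ 0 := by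
  simp only [Exp.and, eval]
  split_ifs with h <;> simp [h]

theorem Exp.eval_le_ne_zero {a b : Exp} :
    (a.le b).eval G m ρ ≠ 0 ↔ a.eval G m ρ ≤ b.eval G m ρ := by
  rw [Exp.le, eval_not_ne_zero]
  simp only [eval]
  omega

theorem Exp.eval_ne_ne_zero {a b : Exp} :
    (a.ne b).eval G m ρ ≠ 0 ↔ a.eval G m ρ ≠ b.eval G m ρ := by
  simp only [Exp.ne, eval]
  omega

theorem Exp.eval_sum_ne_zero {i : ℕ} {a : Exp} :
    (Exp.sum i a).eval G m ρ ≠ 0 ↔ ∃ v : Fin n, a.eval G m (Function.update ρ i v) ≠ 0 := by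
  simp only [eval, ne_eq, Finset.sum_range, Finset.sum_eq_zero_iff, Finset.mem_univ, true_imp_iff,
    not_forall]

theorem Exp.eval_unlabeled_ne_zero {v T : ℕ} :
    (Exp.unlabeled v T).eval G m ρ ≠ 0 ↔ m (ρ v) ≤ ρ T := by
  rw [Exp.unlabeled, eval_le_ne_zero]
  rfl

/-- There is no multiplication, so the product is obtained by adding `n` once for every `k < ρ u`;
`ρ u ≤ n` keeps all these `k` in the range of summation. -/
theorem Exp.eval_cell {u v : ℕ} (h0 : ρ 0 = n) (hu : u ≠ 20) (hun : ρ u ≤ n) :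
    (Exp.cell u v).eval G m ρ = n + ρ u * n + ρ v := by
  simp only [Exp.cell, eval, Function.update_self, Function.update_of_ne hu, h0,
    Function.update_of_ne (show 0 ≠ 20 by decide)]
  have : ∀ k ∈ Finset.range n, (if ρ u - k = 0 then 0 else n) = if k < ρ u then n else 0 := by
    intro k _
    split_ifs <;> omega
  rw [Finset.sum_congr rfl this, ← Finset.sum_filter, Finset.sum_const, smul_eq_mul]
  congr 3
  rw [show (Finset.range n).filter (· < ρ u) = Finset.range (ρ u) by
    ext k
    simp only [Finset.mem_filter, Finset.mem_range]
    omega, Finset.card_range]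

/-- The memory holds the distance matrix of `G`. -/
def StoresDist (G : SimpleGraph (Fin n)) (m : ℕ → ℕ) : Prop :=
  ∀ u v : Fin n, m (n + u * n + v) = n - G.dist u v

theorem dist_lt_card (hG : G.Connected) (u v : Fin n) : G.dist u v < n := by
  obtain ⟨p, hp, hp'⟩ := hG.exists_path_of_dist u v
  simpa [hp'] using hp.length_lt

theorem Exp.eval_load_cell (hm : StoresDist G m) (h0 : ρ 0 = n) {u v : ℕ} (hu : u ≠ 20)
    {p q : Fin n} (hp : ρ u = p) (hq : ρ v = q) :
    (Exp.load (.cell u v)).eval G m ρ = n - G.dist p q := by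
  simp only [eval]
  rw [eval_cell h0 hu (by omega), hp, hq, hm]

/-- In terms of the stored values `n - dist`, the distance equation says that two entries add up to
`n` plus the third. Truncation is harmless since distances are below `n`. -/
theorem Exp.eval_between_ne_zero (hG : G.Connected) (hm : StoresDist G m) (h0 : ρ 0 = n)
    {i j k : ℕ} (hi : i ≠ 20) (hj : j ≠ 20) {p x q : Fin n} (hp : ρ i = p) (hx : ρ j = x)
    (hq : ρ k = q) : (Exp.between i j k).eval G m ρ ≠ 0 ↔ x ∈ interval G p q := by
  have h1 := dist_lt_card hG p x
  have h2 := dist_lt_card hG x q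
  have h3 := dist_lt_card hG p q
  have e : ∀ a b : Exp, (Exp.add a b).eval G m ρ = a.eval G m ρ + b.eval G m ρ := fun _ _ => rfl
  rw [Exp.between, eval_not_ne_zero, ← not_iff_not, ← ne_eq, eval_ne_ne_zero, e, e,
    eval_load_cell hm h0 hi hp hx, eval_load_cell hm h0 hj hx hq, eval_load_cell hm h0 hi hp hq,
    mem_interval_iff hG]
  simp only [eval, h0]
  omega

open scoped Classical in
theorem Exp.eval_good (hG : G.Connected) (hm : StoresDist G m) (h0 : ρ 0 = n)
    {i j k l : ℕ} (hi : i ≠ 20 ∧ i ≠ 21) (hj : j ≠ 20 ∧ j ≠ 21) (hk : k ≠ 20 ∧ k ≠ 21)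
    (hl : l ≠ 20 ∧ l ≠ 21)
    {a b c d : Fin n} (ha : ρ i = a) (hb : ρ j = b) (hc : ρ k = c) (hd : ρ l = d) :
    (Exp.good i j k l).eval G m ρ = if Good G a b c d then 1 else 0 := by
  have key : ∀ e : Exp, (e.eval G m ρ ≠ 0 ↔ Good G a b c d) →
      e.bit.eval G m ρ = if Good G a b c d then 1 else 0 := by
    intro e he
    simp only [Exp.bit, eval]
    by_cases h : Good G a b c d
    · rw [if_neg (he.2 h), if_pos h]
    · rw [if_neg h, if_pos (not_not.1 (mt he.1 h))]
  refine key _ ?_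
  simp only [eval_and_ne_zero, eval_ne_ne_zero, eval_sum_ne_zero]
  have hsum : (∃ v : Fin n,
      (Exp.between i 21 j).eval G m (Function.update ρ 21 v) ≠ 0 ∧
      (Exp.between k 21 l).eval G m (Function.update ρ 21 v) ≠ 0) ↔
      (interval G a b ∩ interval G c d).Nonempty := by
    refine exists_congr fun v => ?_
    rw [eval_between_ne_zero hG hm (p := a) (x := v) (q := b) (by simpa using h0) hi.1
      (by decide) (by simpa [hi.2] using ha) (by simp) (by simpa [hj.2] using hb),
      eval_between_ne_zero hG hm (p := c) (x := v) (q := d) (by simpa using h0) hk.1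
      (by decide) (by simpa [hk.2] using hc) (by simp) (by simpa [hl.2] using hd)]
    rfl
  rw [hsum]
  simp only [eval, ha, hb, hc, hd, Good, ne_eq, Fin.val_inj]
  simp [and_assoc]

theorem Exp.eval_sumOver {W : Finset (Fin n)} {i T : ℕ} (hiT : T ≠ i)
    (hW : ∀ v : Fin n, v ∈ W ↔ m v ≤ ρ T) {a : Exp} {f : Fin n → ℕ}
    (hf : ∀ v ∈ W, a.eval G m (Function.update ρ i v) = f v) :
    (Exp.sumOver i T a).eval G m ρ = ∑ v ∈ W, f v := by
  classical
  have h : ∀ v : Fin n, ((Exp.unlabeled i T).and a).eval G m (Function.update ρ i v) =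
      if v ∈ W then f v else 0 := by
    intro v
    have hu := Exp.eval_unlabeled_ne_zero (G := G) (m := m) (ρ := Function.update ρ i v)
      (v := i) (T := T)
    rw [Function.update_self, Function.update_of_ne hiT, ← hW] at hu
    simp only [Exp.and, eval]
    by_cases hv : v ∈ W
    · rw [if_neg (hu.2 hv), if_pos hv, hf v hv]
    · rw [if_pos (not_not.1 (mt hu.1 hv)), if_neg hv]
  simp only [Exp.sumOver, eval, Finset.sum_range] at h ⊢
  simp only [h, ← Finset.sum_filter, Finset.filter_mem_eq_inter, Finset.univ_inter]

/-- The number of good quadruples `{(a, b), (c, d)}` with `d` among the nodes that were unlabeled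
at time `T`. -/
def Exp.countGood (T a b c : ℕ) : Exp := sumOver 24 T (good a b c 24)

theorem Exp.eval_countGood (hG : G.Connected) (hm : StoresDist G m) (h0 : ρ 0 = n)
    {i j k T : ℕ} (hi : i ≠ 20 ∧ i ≠ 21 ∧ i ≠ 24) (hj : j ≠ 20 ∧ j ≠ 21 ∧ j ≠ 24)
    (hk : k ≠ 20 ∧ k ≠ 21 ∧ k ≠ 24) (hT : T ≠ 24) {a b c : Fin n} (ha : ρ i = a) (hb : ρ j = b)
    (hc : ρ k = c) {W : Finset (Fin n)} (hW : ∀ v : Fin n, v ∈ W ↔ m v ≤ ρ T) :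
    (Exp.countGood T i j k).eval G m ρ = count W (Good G a b c) := by
  classical
  rw [count_eq, Finset.card_filter, Exp.countGood]
  refine eval_sumOver hT hW fun v _ => ?_
  have hu : ∀ l, l ≠ 24 → Function.update ρ 24 (v : ℕ) l = ρ l :=
    fun l hl => Function.update_of_ne hl _ _
  rw [eval_good hG hm (a := a) (b := b) (c := c) (d := v) (by rw [hu 0 (by decide), h0])
    (by omega) (by omega) (by omega) (by decide) (by rw [hu i (by omega), ha])
    (by rw [hu j (by omega), hb]) (by rw [hu k (by omega), hc]) (Function.update_self _ _ _)]

/-- Twice the score of Step 1. -/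
def Exp.key₁ (v : ℕ) : Exp := sumOver 22 2 (sumOver 23 2 (countGood 2 v 22 23))

/-- Twice the score of Step 2. -/
def Exp.key₂ (v : ℕ) : Exp := sumOver 23 8 (countGood 8 4 v 23)

/-- The score of Step 3. -/
def Exp.key₃ (v : ℕ) : Exp := countGood 9 4 5 v

theorem Exp.eval_key₁ (hG : G.Connected) (hm : StoresDist G m) (h0 : ρ 0 = n)
    {i : ℕ} (hi : 24 < i) {v : Fin n} (hv : ρ i = v) {U : Finset (Fin n)}
    (hU : ∀ v : Fin n, v ∈ U ↔ m v ≤ ρ 2) (hvU : v ∈ U) :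
    (Exp.key₁ i).eval G m ρ = 2 * score₁ G U v := by
  rw [Exp.key₁, score₁_eq hvU, Finset.mul_sum]
  refine eval_sumOver (by decide) hU fun b hb => ?_
  rw [two_mul_score₂ hvU hb]
  refine eval_sumOver (by decide) (by simpa using hU) fun c _ => ?_
  refine eval_countGood hG hm (by simpa using h0) (by omega) (by omega) (by omega) (by decide)
    ?_ (by simp) (by simp) (by simpa using hU)
  simp [show i ≠ 22 by omega, show i ≠ 23 by omega, hv]

theorem Exp.eval_key₂ (hG : G.Connected) (hm : StoresDist G m) (h0 : ρ 0 = n)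
    {i : ℕ} (hi : 24 < i) {a v : Fin n} (ha : ρ 4 = a) (hv : ρ i = v) {S : Finset (Fin n)}
    (hS : ∀ v : Fin n, v ∈ S ↔ m v ≤ ρ 8) (haS : a ∈ S) (hvS : v ∈ S) :
    (Exp.key₂ i).eval G m ρ = 2 * score₂ G S a v := by
  rw [Exp.key₂, two_mul_score₂ haS hvS]
  refine eval_sumOver (by decide) hS fun c _ => ?_
  refine eval_countGood hG hm (by simpa using h0) (by decide) (by omega) (by decide) (by decide)
    (by simpa using ha) ?_ (by simp) (by simpa using hS)
  simp [show i ≠ 23 by omega, hv]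

/-- Summing over `W` instead of `insert a W` changes nothing, since `d = a` is never good. -/
theorem Exp.eval_key₃ (hG : G.Connected) (hm : StoresDist G m) (h0 : ρ 0 = n)
    {i : ℕ} (hi : 24 < i) {a b v : Fin n} (ha : ρ 4 = a) (hb : ρ 5 = b) (hv : ρ i = v)
    {W : Finset (Fin n)} (hW : ∀ v : Fin n, v ∈ W ↔ m v ≤ ρ 9) (hbW : b ∈ W) (hvW : v ∈ W) :
    (Exp.key₃ i).eval G m ρ = score₃ G (insert a W) a b v := by
  classical
  rw [Exp.key₃, score₃_eq (Finset.mem_insert_self _ _) (Finset.mem_insert_of_mem hbW)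
    (Finset.mem_insert_of_mem hvW), eval_countGood hG hm h0 (by decide) (by decide) (by omega)
    (by decide) ha hb hv hW]
  refine le_antisymm (count_mono (Finset.subset_insert _ _) fun _ _ h => h) ?_
  rw [count_eq, count_eq]
  refine Finset.card_le_card fun d hd => ?_
  rw [Finset.mem_filter, Finset.mem_insert] at hd
  exact Finset.mem_filter.2 ⟨hd.1.resolve_left hd.2.ne.2.2.1.symm, hd.2⟩

/-- The outer sum counts the `k` with no solution up to `k`, which are exactly the numbers below the
least solution. The condition is tested with changed bound variables, so `ha` refers only to
registers below 20 and to the variable 25. -/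
theorem Exp.exists_eval_first {a : Exp} {P : Fin n → Prop}
    (ha : ∀ v : Fin n, ∀ ρ', (∀ j < 20, ρ' j = ρ j) → ρ' 25 = (v : ℕ) → (a.eval G m ρ' ≠ 0 ↔ P v))
    (hP : ∃ v, P v) : ∃ v, P v ∧ (Exp.first a).eval G m ρ = v := by
  classical
  obtain ⟨w, hw⟩ := hP
  obtain ⟨v, hv, hmin⟩ := (Finset.univ.filter P).exists_minimal ⟨w, by simpa using hw⟩
  simp only [Finset.mem_filter, Finset.mem_univ, true_and] at hv hmin
  refine ⟨v, hv, ?_⟩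
  have h : ∀ k ∈ Finset.range n,
      (Exp.not (.sum 25 (and (le (.var 25) (.var 26)) a))).eval G m (Function.update ρ 26 k) =
      if k < v then 1 else 0 := by
    intro k _
    have hs : (Exp.sum 25 (and (le (.var 25) (.var 26)) a)).eval G m (Function.update ρ 26 k) ≠ 0
        ↔ v ≤ k := by
      rw [eval_sum_ne_zero]
      have hiff : ∀ u : Fin n, (and (le (.var 25) (.var 26)) a).eval G m
          (Function.update (Function.update ρ 26 k) 25 (u : ℕ)) ≠ 0 ↔ (u : ℕ) ≤ k ∧ P u := by
        intro u
        rw [eval_and_ne_zero, eval_le_ne_zero, ha u _ (fun j hj => by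
          rw [Function.update_of_ne (by omega), Function.update_of_ne (by omega)]) (by simp)]
        simp [eval]
      simp only [hiff]
      constructor
      · rintro ⟨u, huk, hu⟩
        rcases le_total v u with h | h
        · exact (Fin.le_def.1 h).trans huk
        · exact (Fin.le_def.1 (hmin hu h)).trans huk
      · exact fun h => ⟨v, h, hv⟩
    rw [eval_not]
    by_cases hvk : (v : ℕ) ≤ k
    · have := hs.2 hvk
      rw [if_neg (by omega)]
      omega
    · have := not_not.1 (mt hs.1 hvk)
      rw [if_pos (by omega), this]
  have he : (Exp.first a).eval G m ρ = ∑ k ∈ Finset.range n,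
      (Exp.not (.sum 25 (and (le (.var 25) (.var 26)) a))).eval G m (Function.update ρ 26 k) := rfl
  rw [he, Finset.sum_congr rfl h, ← Finset.sum_filter, Finset.sum_const, smul_eq_mul, mul_one,
    show (Finset.range n).filter (· < (v : ℕ)) = Finset.range v by
      ext k
      simp only [Finset.mem_filter, Finset.mem_range]
      omega, Finset.card_range]

/-- Maximality of a key is the vanishing of a sum of truncated differences. -/
theorem Exp.exists_eval_argmax {U : Finset (Fin n)} (hU : ∀ v : Fin n, v ∈ U ↔ m v ≤ ρ 2)
    (hne : U.Nonempty) {key : ℕ → Exp} {f : Fin n → ℕ}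
    (hkey : ∀ i, 24 < i → ∀ v ∈ U, ∀ ρ', (∀ j < 20, ρ' j = ρ j) → ρ' i = (v : ℕ) →
      (key i).eval G m ρ' = f v) :
    ∃ v ∈ U, (∀ v' ∈ U, f v' ≤ f v) ∧ (Exp.argmax key).eval G m ρ = v := by
  obtain ⟨w, hwU, hw⟩ := U.exists_max_image f hne
  have hP : ∀ v : Fin n, ∀ ρ', (∀ j < 20, ρ' j = ρ j) → ρ' 25 = (v : ℕ) →
      ((and (unlabeled 25 2) (not (sumOver 27 2 (.sub (key 27) (key 25))))).eval G m ρ' ≠ 0 ↔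
        v ∈ U ∧ ∀ v' ∈ U, f v' ≤ f v) := by
    intro v ρ' h25 hv
    rw [eval_and_ne_zero, eval_unlabeled_ne_zero, hv, h25 2 (by decide), ← hU, eval_not_ne_zero]
    refine and_congr_right fun hvU => ?_
    rw [eval_sumOver (W := U) (f := fun u => f u - f v) (by decide)
      (by simpa [h25 2 (by decide)] using hU), Finset.sum_eq_zero_iff]
    · exact forall₂_congr fun u _ => tsub_eq_zero_iff_le
    · intro u hu
      have e : ∀ a b : Exp, ∀ ρ, (Exp.sub a b).eval G m ρ = a.eval G m ρ - b.eval G m ρ :=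
        fun _ _ _ => rfl
      rw [e, hkey 27 (by decide) u hu _ (fun j hj => by
          simp [show j ≠ 27 by omega, h25 j hj]) (by simp),
        hkey 25 (by decide) v hvU _ (fun j hj => by
          simp [show j ≠ 27 by omega, h25 j hj]) (by simp [hv])]
  obtain ⟨v, ⟨hv, hv'⟩, he⟩ := Exp.exists_eval_first hP ⟨w, hwU, hw⟩
  exact ⟨v, hv, hv', he⟩

end Expressions

end Good4

namespace Good4

/-! ### Computing the distances -/

section Distances

/-- One relaxation step for the node pair `(13, 15)` and the last edge `(16, 15)`. As the matrix
stores `n` minus the distance, this is a maximum, and `0` is a correct initial value. -/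
def Stmt.relax : Stmt :=
  .store (.cell 13 15) <| .add (.load (.cell 13 15)) <|
    .ite (.adj (.var 16) (.var 15))
      (.sub (.sub (.load (.cell 13 16)) (.const 1)) (.load (.cell 13 15))) (.const 0)

/-- The computation of the distance matrix. -/
def Stmt.distances : Stmt :=
  .seq (.loop 13 (.store (.cell 13 13) (.var 0)))
    (.loop 14 (.loop 13 (.loop 15 (.loop 16 .relax))))

variable {n : ℕ} {G : SimpleGraph (Fin n)} {y : Fin n → Bool}

/-- The invariant of the computation of the distances. -/
structure Sound (G : SimpleGraph (Fin n)) (s : State n) : Prop where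
  reg_zero : s.reg 0 = n
  reg_mode : s.reg 3 = 0
  trials : s.trials = []
  mem_eq_zero : ∀ p < n, s.mem p = 0
  mem_le : ∀ u v : Fin n, s.mem (n + u * n + v) ≤ n - G.dist u v
  lt₁ : s.reg 13 < n
  lt₂ : s.reg 15 < n
  lt₃ : s.reg 16 < n

/-- The state `s'` is a sound extension of `s` with changes only to the registers in `X`. -/
structure Extends (G : SimpleGraph (Fin n)) (X : Finset ℕ) (s s' : State n) : Prop where
  sound : Sound G s'
  mono : ∀ p, s.mem p ≤ s'.mem p
  frame : ∀ j ∉ X, s'.reg j = s.reg j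

theorem Extends.trans {X : Finset ℕ} {s s' s'' : State n} (h : Extends G X s s')
    (h' : Extends G X s' s'') : Extends G X s s'' :=
  ⟨h'.sound, fun p => (h.mono p).trans (h'.mono p),
    fun j hj => (h'.frame j hj).trans (h.frame j hj)⟩

theorem Extends.mono_frame {X Y : Finset ℕ} {s s' : State n} (h : Extends G X s s') (hXY : X ⊆ Y) :
    Extends G Y s s' :=
  ⟨h.sound, h.mono, fun j hj => h.frame j fun hX => hj (hXY hX)⟩

theorem Sound.extends_set {s : State n} (hs : Sound G s) {i k : ℕ} (hi : i ∈ Finset.Icc 13 16)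
    (hk : k < n) (X : Finset ℕ) : Extends G (insert i X) s (s.set i k) := by
  rw [Finset.mem_Icc] at hi
  have hlt : ∀ j, s.reg j < n → (s.set i k).reg j < n := by
    intro j hj
    by_cases hji : j = i <;> simp [State.set, hji, hk, hj]
  refine ⟨⟨?_, ?_, hs.trials, hs.mem_eq_zero, hs.mem_le, hlt _ hs.lt₁, hlt _ hs.lt₂,
    hlt _ hs.lt₃⟩, fun p => le_rfl, fun j hj => ?_⟩
  · simpa [State.set, show 0 ≠ i by omega] using hs.reg_zero
  · simpa [State.set, show 3 ≠ i by omega] using hs.reg_mode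
  · simp only [Finset.mem_insert, not_or] at hj
    simp [State.set, hj.1]

theorem iter_extends {X : Finset ℕ} {f : ℕ → State n → State n} {N : ℕ}
    (hf : ∀ k < N, ∀ s, Sound G s → Extends G X s (f k s)) {s : State n} (hs : Sound G s) :
    ∀ j ≤ N, Extends G X s (iter f j s) := by
  intro j hj
  induction j with
  | zero => exact ⟨hs, fun _ => le_rfl, fun _ _ => rfl⟩
  | succ j ih => exact (ih (by omega)).trans (hf j (by omega) _ (ih (by omega)).sound)

/-- One pass is isolated. Everything before and after it only raises entries, so a lower bound
established in that pass persists. -/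
theorem iter_reaches {X : Finset ℕ} {f : ℕ → State n → State n} {N : ℕ}
    (hf : ∀ k < N, ∀ s, Sound G s → Extends G X s (f k s)) {s : State n} (hs : Sound G s)
    {k : ℕ} (hk : k < N) :
    ∃ s', Extends G X s s' ∧ Extends G X (f k s') (iter f N s) := by
  refine ⟨iter f k s, iter_extends hf hs k hk.le, ?_⟩
  suffices H : ∀ j, k + 1 ≤ j → j ≤ N → Extends G X (f k (iter f k s)) (iter f j s) from
    H N hk le_rfl
  intro j hkj
  induction j, hkj using Nat.le_induction with
  | base => exact fun h => ⟨(iter_extends hf hs (k + 1) h).sound, fun _ => le_rfl, fun _ _ => rfl⟩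
  | succ j hkj ih =>
    exact fun h => (ih (by omega)).trans
      (hf j (by omega) _ (iter_extends hf hs j (by omega)).sound)

/-- The loop body `S` changes only registers in `X` and preserves soundness. -/
def Preserves (G : SimpleGraph (Fin n)) (y : Fin n → Bool) (X : Finset ℕ) (S : Stmt) : Prop :=
  ∀ s, Sound G s → Extends G X s (S.run G y s)

theorem Preserves.step {X : Finset ℕ} {S : Stmt} (h : Preserves G y X S) {i : ℕ}
    (hi : i ∈ Finset.Icc 13 16) {k : ℕ} (hk : k < n) {s : State n} (hs : Sound G s) :
    Extends G (insert i X) s (S.run G y (s.set i k)) :=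
  (hs.extends_set hi hk X).trans
    ((h _ (hs.extends_set hi hk X).sound).mono_frame (Finset.subset_insert _ _))

theorem Preserves.loop {X : Finset ℕ} {S : Stmt} (h : Preserves G y X S) {i : ℕ}
    (hi : i ∈ Finset.Icc 13 16) : Preserves G y (insert i X) (.loop i S) := fun _ hs =>
  iter_extends (fun _ hk _ hs => h.step hi hk hs) hs n le_rfl

/-- A loop runs its body with any prescribed value of the loop variable. -/
theorem Preserves.reaches {X : Finset ℕ} {S : Stmt} (h : Preserves G y X S) {i : ℕ}
    (hi : i ∈ Finset.Icc 13 16) {k : ℕ} (hk : k < n) {s : State n} (hs : Sound G s) :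
    ∃ s', Extends G (insert i X) s s' ∧ s'.reg i = k ∧
      Extends G (insert i X) (S.run G y s') ((Stmt.loop i S).run G y s) := by
  obtain ⟨s', h1, h2⟩ := iter_reaches (X := insert i X)
    (f := fun k s => S.run G y (s.set i k)) (fun _ hk _ hs => h.step hi hk hs) hs hk
  exact ⟨s'.set i k, h1.trans (h1.sound.extends_set hi hk X), by simp [State.set], h2⟩

theorem cell_injective {u v u' v' : Fin n}
    (h : n + (u : ℕ) * n + v = n + (u' : ℕ) * n + v') : u = u' ∧ v = v' := by
  have h' : (finProdFinEquiv (u, v) : ℕ) = finProdFinEquiv (u', v') := by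
    simp only [finProdFinEquiv_apply_val]
    rw [mul_comm n, mul_comm n]
    omega
  simpa using finProdFinEquiv.injective (Fin.ext h')

/-- Raising one entry of the matrix to a sound value. -/
theorem Sound.extends_put {s : State n} (hs : Sound G s) {u v : Fin n} {x : ℕ}
    (hx : s.mem (n + u * n + v) ≤ x) (hx' : x ≤ n - G.dist u v) :
    Extends G ∅ s (s.put (n + u * n + v) x) := by
  refine ⟨⟨hs.reg_zero, hs.reg_mode, hs.trials, fun p hp => ?_, fun u' v' => ?_, hs.lt₁, hs.lt₂,
    hs.lt₃⟩, fun p => ?_, fun _ _ => rfl⟩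
  · simp only [State.put]
    rw [Function.update_of_ne (by omega)]
    exact hs.mem_eq_zero p hp
  · simp only [State.put]
    by_cases h : n + (u' : ℕ) * n + v' = n + u * n + v
    · obtain ⟨rfl, rfl⟩ := cell_injective h
      simpa using hx'
    · rw [Function.update_of_ne h]
      exact hs.mem_le u' v'
  · simp only [State.put]
    by_cases h : p = n + u * n + v
    · simpa [h] using hx
    · simp [h]

-- Through truncated subtraction the update along an edge is the maximum of the old entry and the
-- entry at `w` minus one.
open scoped Classical in
theorem Stmt.run_relax {s : State n} (h0 : s.reg 0 = n) {u v w : Fin n} (hu : s.reg 13 = u)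
    (hv : s.reg 15 = v) (hw : s.reg 16 = w) :
    Stmt.relax.run G y s = s.put (n + u * n + v) (s.mem (n + u * n + v) +
      if G.Adj w v then s.mem (n + u * n + w) - 1 - s.mem (n + u * n + v) else 0) := by
  have e1 : (Exp.cell 13 15).eval G s.mem s.reg = n + u * n + v := by
    rw [Exp.eval_cell h0 (by decide) (by omega), hu, hv]
  have e2 : (Exp.cell 13 16).eval G s.mem s.reg = n + u * n + w := by
    rw [Exp.eval_cell h0 (by decide) (by omega), hu, hw]
  simp only [relax, run, State.val, Exp.eval, e1, e2, hv, hw, adjBit, Fin.is_lt, exists_const,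
    Fin.eta]
  by_cases h : G.Adj w v <;> simp [h]

theorem preserves_relax (hG : G.Connected) : Preserves G y ∅ .relax := by
  classical
  intro s hs
  rw [Stmt.run_relax hs.reg_zero (u := ⟨_, hs.lt₁⟩) (v := ⟨_, hs.lt₂⟩) (w := ⟨_, hs.lt₃⟩)
    rfl rfl rfl]
  refine hs.extends_put (Nat.le_add_right _ _) ?_
  have h1 := hs.mem_le ⟨_, hs.lt₁⟩ ⟨_, hs.lt₂⟩
  have h2 := hs.mem_le ⟨_, hs.lt₁⟩ ⟨_, hs.lt₃⟩
  split_ifs with h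
  · have h3 := hG.dist_triangle (u := ⟨_, hs.lt₁⟩) (v := ⟨_, hs.lt₃⟩) (w := ⟨_, hs.lt₂⟩)
    rw [SimpleGraph.dist_eq_one_iff_adj.2 h] at h3
    omega
  · exact h1

theorem run_init_cell {s : State n} (hs : Sound G s) {u : Fin n} (hu : s.reg 13 = u) :
    (Stmt.store (.cell 13 13) (.var 0)).run G y s = s.put (n + u * n + u) n := by
  simp only [Stmt.run, State.val]
  rw [Exp.eval_cell hs.reg_zero (by decide) (by omega), hu]
  simp only [Exp.eval, hs.reg_zero]

theorem preserves_init : Preserves G y ∅ (.store (.cell 13 13) (.var 0)) := by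
  intro s hs
  rw [run_init_cell hs (u := ⟨_, hs.lt₁⟩) rfl]
  exact hs.extends_put ((hs.mem_le _ _).trans (Nat.sub_le _ _)) (by simp)

/-- Bellman–Ford: entries never exceed the true value, and after k rounds those of pairs at distance
at most k have reached it. Since distances are below n, n rounds are enough. -/
theorem distances_spec (hG : G.Connected) :
    Sound G (Stmt.distances.run G y (State.init n)) ∧
      StoresDist G (Stmt.distances.run G y (State.init n)).mem := by
  have hn : 0 < n := Fin.pos_iff_nonempty.2 hG.nonempty
  have hs0 : Sound G (State.init n) := by
    refine ⟨rfl, rfl, rfl, fun _ _ => rfl, fun _ _ => Nat.zero_le _, hn, hn, hn⟩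
  have p1 := preserves_relax (y := y) hG
  have p2 := p1.loop (i := 16) (by decide)
  have p3 := p2.loop (i := 15) (by decide)
  have p4 := p3.loop (i := 13) (by decide)
  set s1 := (Stmt.loop 13 (.store (.cell 13 13) (.var 0))).run G y (State.init n) with hs1
  have hsound : Sound G s1 := (preserves_init.loop (i := 13) (by decide) _ hs0).sound
  have hdiag : ∀ u : Fin n, n ≤ s1.mem (n + u * n + u) := by
    intro u
    obtain ⟨s', h1, h2, h3⟩ := preserves_init.reaches (y := y) (i := 13) (by decide) u.2 hs0
    refine le_trans ?_ (h3.mono _)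
    rw [run_init_cell h1.sound h2]
    simp [State.put]
  set f : ℕ → State n → State n := fun k s =>
    (Stmt.loop 13 (.loop 15 (.loop 16 .relax))).run G y (s.set 14 k) with hf
  have hrun : Stmt.distances.run G y (State.init n) = iter f n s1 := rfl
  rw [hrun]
  have hfs : ∀ k < n, ∀ s, Sound G s → Extends G {14, 13, 15, 16} s (f k s) :=
    fun k hk s hs => p4.step (i := 14) (by decide) hk hs
  have hext := iter_extends hfs hsound
  have hcomplete : ∀ k ≤ n, ∀ u v : Fin n, G.dist u v ≤ k →
      n - G.dist u v ≤ (iter f k s1).mem (n + u * n + v) := by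
    intro k hk
    induction k with
    | zero =>
      intro u v huv
      obtain rfl := hG.dist_eq_zero_iff.1 (Nat.le_zero.1 huv)
      exact (Nat.sub_le _ _).trans (hdiag u)
    | succ k ih =>
      intro u v huv
      have hsk := (hext k (by omega)).sound
      have hfk := hfs k (by omega) _ hsk
      rcases Nat.lt_or_ge k (G.dist u v) with hlt | hge
      swap
      · exact (ih (by omega) u v hge).trans (hfk.mono _)
      -- The predecessor of `v` on a shortest path from `u`.
      obtain ⟨w, hw, hwv⟩ : ∃ w, G.dist u w ≤ k ∧ G.Adj w v := by
        obtain ⟨p, hp⟩ := (hG v u).exists_walk_length_eq_dist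
        cases p with
        | nil => simp at hlt
        | cons hvw q =>
          rename_i w
          refine ⟨w, ?_, hvw.symm⟩
          rw [SimpleGraph.Walk.length_cons, SimpleGraph.dist_comm] at hp
          rw [SimpleGraph.dist_comm]
          exact (SimpleGraph.dist_le q).trans (by omega)
      have hwk := ih (by omega) u w hw
      -- The three inner loops reach the triple `(u, v, w)` at some moment of this round, when the
      -- entry for `(u, w)` is still at least as large as before.
      have e0 := hsk.extends_set (i := 14) (by decide) (show k < n by omega) {13, 15, 16}
      obtain ⟨t1, a1, b1, c1⟩ := p3.reaches (i := 13) (by decide) u.2 e0.sound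
      obtain ⟨t2, a2, b2, c2⟩ := p2.reaches (i := 15) (by decide) v.2 a1.sound
      obtain ⟨t3, a3, b3, c3⟩ := p1.reaches (i := 16) (by decide) w.2 a2.sound
      have r15 : t3.reg 15 = v := (a3.frame 15 (by decide)).trans b2
      have r13 : t3.reg 13 = u :=
        (a3.frame 13 (by decide)).trans ((a2.frame 13 (by decide)).trans b1)
      have hm := (e0.mono (n + u * n + w)).trans
        ((a1.mono _).trans ((a2.mono _).trans (a3.mono _)))
      refine le_trans ?_ ((c3.mono _).trans ((c2.mono _).trans (c1.mono _)))
      rw [Stmt.run_relax a3.sound.reg_zero r13 r15 b3, if_pos hwv]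
      simp only [State.put, Function.update_self]
      omega
  refine ⟨(hext n le_rfl).sound, fun u v => ?_⟩
  exact le_antisymm ((hext n le_rfl).sound.mem_le u v)
    (hcomplete n le_rfl u v (dist_lt_card hG u v).le)

end Distances

end Good4

namespace Good4

/-! ### The program -/

section Program

namespace Stmt

/-- Step 1 of a round. -/
def stepStart : Stmt :=
  .seq (.assign 10 (.argmax Exp.key₁)) <| .seq (.predict 12 (.var 10) (.const 0)) <|
  .seq (.assign 4 (.var 10)) <| .seq (.assign 7 (.var 12)) <| .seq (.assign 8 (.var 2)) <|
  .assign 3 (.const 1)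

/-- One trial of Step 2. -/
def stepScan₂ : Stmt :=
  .seq (.assign 10 (.argmax Exp.key₂)) <| .seq (.predict 12 (.var 10) (.not (.var 7))) <|
  -- Register 11 is never read; assigning to it stands for doing nothing.
  .ite (.ne (.var 12) (.var 7)) (.assign 11 (.const 0)) <|
  .seq (.assign 5 (.var 10)) <| .seq (.assign 9 (.var 2)) <| .assign 3 (.const 2)

/-- One trial of Step 3. -/
def stepScan₃ : Stmt :=
  .seq (.assign 10 (.argmax Exp.key₃)) <| .seq (.predict 12 (.var 10) (.var 7)) <|
  .ite (.ne (.var 12) (.var 7)) (.seq (.assign 6 (.var 10)) (.assign 3 (.const 3))) <|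
  .assign 11 (.const 0)

/-- One trial of Step 4. -/
def stepSweep : Stmt :=
  .seq (.assign 10 (.first (.and (.unlabeled 25 2) (.good 4 5 6 25)))) <|
  .seq (.predict 12 (.var 10) (.var 7)) <|
  .ite (.ne (.var 12) (.var 7)) (.assign 3 (.const 0)) (.assign 11 (.const 0))

/-- End Step 4 if it has no nodes left. -/
def endSweep : Stmt :=
  .ite (.le (.const 3) (.var 3))
    (.ite (.sum 25 (.and (.unlabeled 25 2) (.good 4 5 6 25))) (.assign 11 (.const 0))
      (.assign 3 (.const 0)))
    (.assign 11 (.const 0))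

/-- One trial. Register `2` holds the time, which runs backwards, and register `3` the phase. -/
def trial : Stmt :=
  .seq (.assign 2 (.sub (.var 0) (.var 1))) <| .seq endSweep <|
  .seq (.ite (.var 3) (.ite (.sub (.var 3) (.const 1)) (.ite (.sub (.var 3) (.const 2))
    stepSweep stepScan₃) stepScan₂) stepStart) <|
  .store (.var 10) (.var 2)

/-- The complete algorithm. -/
def algorithm : Stmt := .seq distances (.loop 1 trial)

theorem algorithm_wf : algorithm.wf = true := by decide +kernel

end Stmt

variable {n : ℕ} {G : SimpleGraph (Fin n)} {y : Fin n → Bool}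

/-- The registers represent the phase at time `T`. -/
def RepresentsPhase (y : Fin n → Bool) (s : State n) (T : ℕ) : Phase (Fin n) → Prop
  | .start => s.reg 3 = 0
  | .scan₂ a S => s.reg 3 = 1 ∧ s.reg 4 = a ∧ s.reg 7 = (y a).toNat ∧ T ≤ s.reg 8 ∧
      (∀ v : Fin n, v ∈ S ↔ s.mem v ≤ s.reg 8) ∧ a ∈ S
  | .scan₃ a b W => s.reg 3 = 2 ∧ s.reg 4 = a ∧ s.reg 7 = (y a).toNat ∧ s.reg 5 = b ∧
      T ≤ s.reg 9 ∧ (∀ v : Fin n, v ∈ W ↔ s.mem v ≤ s.reg 9) ∧ b ∈ W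
  | .sweep a b c => s.reg 3 = 3 ∧ s.reg 4 = a ∧ s.reg 7 = (y a).toNat ∧ s.reg 5 = b ∧
      s.reg 6 = c

/-- The state represents the set `U` of unlabeled nodes and the distances at time `T`. -/
structure RepresentsSet (G : SimpleGraph (Fin n)) (s : State n) (T : ℕ) (U : Finset (Fin n)) :
    Prop where
  reg_zero : s.reg 0 = n
  dist : StoresDist G s.mem
  mem_eq_zero : ∀ v ∈ U, s.mem v = 0
  lt_mem : ∀ v ∉ U, T < s.mem v

theorem RepresentsSet.mem_iff {s : State n} {T : ℕ} {U : Finset (Fin n)}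
    (h : RepresentsSet G s T U) (v : Fin n) : v ∈ U ↔ s.mem v ≤ T := by
  refine ⟨fun hv => by simp [h.mem_eq_zero v hv], fun hv => ?_⟩
  by_contra hvU
  have := h.lt_mem v hvU
  omega

theorem RepresentsSet.erase {s s' : State n} {T : ℕ} {U : Finset (Fin n)}
    (h : RepresentsSet G s (T + 1) U) {v : Fin n}
    (hm : s'.mem = Function.update s.mem v (T + 1)) (h0 : s'.reg 0 = s.reg 0) :
    RepresentsSet G s' T (U.erase v) := by
  refine ⟨h0.trans h.reg_zero, fun u w => ?_, fun w hw => ?_, fun w hw => ?_⟩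
  · rw [hm, Function.update_of_ne (by omega)]
    exact h.dist u w
  · rw [Finset.mem_erase] at hw
    rw [hm, Function.update_of_ne (fun h => hw.1 (Fin.ext h))]
    exact h.mem_eq_zero w hw.2
  · rw [hm]
    by_cases hwv : w = v
    · simp [hwv]
    · rw [Function.update_of_ne (fun h => hwv (Fin.ext h))]
      have := h.lt_mem w fun hwU => hw (Finset.mem_erase.2 ⟨hwv, hwU⟩)
      omega

/-- Labeling a node does not change the set of nodes that were unlabeled earlier. -/
theorem RepresentsSet.update_iff {s : State n} {T x : ℕ} {U S : Finset (Fin n)}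
    (h : RepresentsSet G s T U) {v : Fin n} (hv : v ∈ U) (hx : T ≤ x)
    (hS : ∀ w : Fin n, w ∈ S ↔ s.mem w ≤ x) (w : Fin n) :
    w ∈ S ↔ Function.update s.mem (v : ℕ) T w ≤ x := by
  rw [hS]
  by_cases hwv : w = v
  · simp [hwv, h.mem_eq_zero v hv, hx]
  · rw [Function.update_of_ne (fun h => hwv (Fin.ext h))]

theorem State.ask_val (s : State n) (i : ℕ) (v : Fin n) (x : ℕ) :
    s.ask y i v x = { s with
      reg := Function.update s.reg i (y v).toNat
      trials := s.trials ++ [⟨v, decide (x ≠ 0), y v⟩] } := by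
  simp [State.ask]

/-- The statement `S` performs one trial: from the phase `ph` with the unlabeled set `U` at time
`T + 1`. -/
def Performs (G : SimpleGraph (Fin n)) (y : Fin n → Bool) (T : ℕ) (U : Finset (Fin n))
    (ph : Phase (Fin n)) (s s' : State n) : Prop :=
  ∃ v ∈ U, ∃ p ph', s'.trials = s.trials ++ [⟨v, p, y v⟩] ∧
    RepresentsSet G s' T (U.erase v) ∧ RepresentsPhase y s' T ph' ∧
    ∀ τ, Rest y (U.erase v) τ → Completes G y ph' (U.erase v) τ →
      Completes G y ph U (⟨v, p, y v⟩ :: τ)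

/-! ### One trial in each phase -/

section Steps

variable {s : State n} {T : ℕ} {U : Finset (Fin n)}

theorem performs_stepStart (hG : G.Connected) (hs : RepresentsSet G s (T + 1) U)
    (hT : s.reg 2 = T + 1) (hU : U.Nonempty) :
    Performs G y T U .start s ((Stmt.seq .stepStart (.store (.var 10) (.var 2))).run G y s) := by
  have hmem : ∀ v : Fin n, v ∈ U ↔ s.mem v ≤ s.reg 2 := by
    rw [hT]
    exact hs.mem_iff
  obtain ⟨v, hv, hmax, he⟩ := Exp.exists_eval_argmax (G := G) (m := s.mem) (ρ := s.reg) hmem hU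
    (key := Exp.key₁) (f := fun v => 2 * score₁ G U v) fun i hi v hv ρ' hρ hi' =>
      Exp.eval_key₁ hG hs.dist (by rw [hρ 0 (by decide), hs.reg_zero]) hi hi'
        (by simpa [hρ 2 (by decide)] using hmem) hv
  simp only [Stmt.stepStart, Stmt.run, State.val, he]
  simp only [Exp.eval, State.set, State.put, Function.update_self, State.ask_val]
  -- The node is labelled at the very time saved in register 8, so the threshold set still contains
  -- it and equals `U`.
  refine ⟨v, hv, false, .scan₂ v U, by simp, hs.erase (v := v) (by simp [hT]) (by simp), ?_,
    fun τ hr hc => ?_⟩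
  · refine ⟨by simp, by simp, by simp, by simp [hT], ?_, hv⟩
    simpa [hT] using hs.update_iff hv le_rfl hs.mem_iff
  · exact completes_start hv (fun v' hv' => by simpa using hmax v' hv') hc
      (.predict _ _ _ _ hv hr)

theorem toNat_ne_toNat {b b' : Bool} : b.toNat - b'.toNat + (b'.toNat - b.toNat) = 0 ↔ b = b' := by
  cases b <;> cases b' <;> simp

theorem performs_stepScan₂ (hG : G.Connected) (hs : RepresentsSet G s (T + 1) U)
    (hT : s.reg 2 = T + 1) (hU : U.Nonempty) {a : Fin n} {S : Finset (Fin n)}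
    (hp : RepresentsPhase y s (T + 1) (.scan₂ a S)) :
    Performs G y T U (.scan₂ a S) s
      ((Stmt.seq .stepScan₂ (.store (.var 10) (.var 2))).run G y s) := by
  obtain ⟨h3, h4, h7, h8, hS, haS⟩ := hp
  have hmem : ∀ v : Fin n, v ∈ U ↔ s.mem v ≤ s.reg 2 := by
    rw [hT]
    exact hs.mem_iff
  obtain ⟨v, hv, hmax, he⟩ := Exp.exists_eval_argmax (G := G) (m := s.mem) (ρ := s.reg) hmem hU
    (key := Exp.key₂) (f := fun v => 2 * score₂ G S a v) fun i hi v hv ρ' hρ hi' =>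
      Exp.eval_key₂ hG hs.dist (by rw [hρ 0 (by decide), hs.reg_zero]) hi
        (by rw [hρ 4 (by decide), h4]) hi' (by simpa [hρ 8 (by decide)] using hS) haS
        ((hS v).2 (by simp [hs.mem_eq_zero v hv]))
  have hmax' : ∀ v' ∈ U, score₂ G S a v' ≤ score₂ G S a v := fun v' hv' => by
    simpa using hmax v' hv'
  have hpred : decide (1 - (y a).toNat ≠ 0) = !y a := by cases y a <;> rfl
  simp only [Stmt.stepScan₂, Stmt.run, State.val, he]
  simp only [Exp.eval, Exp.eval_not, Exp.ne, State.set, Function.update_self, State.ask_val,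
    Function.update_of_ne (show 7 ≠ 10 by decide), Function.update_of_ne (show 7 ≠ 12 by decide),
    h7, hpred, toNat_ne_toNat]
  -- Equal labels are the mistake here, since `!y a` was predicted.
  by_cases hy : y v = y a
  · rw [if_pos hy]
    refine ⟨v, hv, !y a, .scan₃ a v U, by simp [State.put],
      hs.erase (v := v) (by simp [State.put, hT]) (by simp [State.put]), ?_, fun τ hr hc => ?_⟩
    · refine ⟨by simp [State.put], by simp [State.put, h4], by simp [State.put, h7],
        by simp [State.put], by simp [State.put, hT], ?_, hv⟩
      simpa [State.put, hT] using hs.update_iff hv le_rfl hs.mem_iff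
    · exact completes_scan₂_mistake hv hmax' (by simp [hy]) hc
  · rw [if_neg hy]
    refine ⟨v, hv, !y a, .scan₂ a S, by simp [State.put],
      hs.erase (v := v) (by simp [State.put, hT]) (by simp [State.put]), ?_, fun τ hr hc => ?_⟩
    · refine ⟨by simp [State.put, h3], by simp [State.put, h4], by simp [State.put, h7],
        by simp [State.put]; omega, ?_, haS⟩
      simpa [State.put, hT] using hs.update_iff hv h8 hS
    · exact completes_scan₂_correct hv hmax' (Bool.eq_not_of_ne hy) hc

theorem performs_stepScan₃ (hG : G.Connected) (hs : RepresentsSet G s (T + 1) U)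
    (hT : s.reg 2 = T + 1) (hU : U.Nonempty) {a b : Fin n} {W : Finset (Fin n)}
    (hp : RepresentsPhase y s (T + 1) (.scan₃ a b W)) :
    Performs G y T U (.scan₃ a b W) s
      ((Stmt.seq .stepScan₃ (.store (.var 10) (.var 2))).run G y s) := by
  obtain ⟨h3, h4, h7, h5, h9, hW, hbW⟩ := hp
  have hmem : ∀ v : Fin n, v ∈ U ↔ s.mem v ≤ s.reg 2 := by
    rw [hT]
    exact hs.mem_iff
  obtain ⟨v, hv, hmax, he⟩ := Exp.exists_eval_argmax (G := G) (m := s.mem) (ρ := s.reg) hmem hU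
    (key := Exp.key₃) (f := fun v => score₃ G (insert a W) a b v) fun i hi v hv ρ' hρ hi' =>
      Exp.eval_key₃ hG hs.dist (by rw [hρ 0 (by decide), hs.reg_zero]) hi
        (by rw [hρ 4 (by decide), h4]) (by rw [hρ 5 (by decide), h5]) hi'
        (by simpa [hρ 9 (by decide)] using hW) hbW ((hW v).2 (by simp [hs.mem_eq_zero v hv]))
  have hpred : decide ((y a).toNat ≠ 0) = y a := by cases y a <;> rfl
  simp only [Stmt.stepScan₃, Stmt.run, State.val, he]
  simp only [Exp.eval, Exp.ne, State.set, Function.update_self, State.ask_val,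
    Function.update_of_ne (show 7 ≠ 10 by decide), Function.update_of_ne (show 7 ≠ 12 by decide),
    h7, hpred, toNat_ne_toNat]
  by_cases hy : y v = y a
  · rw [if_pos hy]
    refine ⟨v, hv, y a, .scan₃ a b W, by simp [State.put],
      hs.erase (v := v) (by simp [State.put, hT]) (by simp [State.put]), ?_, fun τ hr hc => ?_⟩
    · refine ⟨by simp [State.put, h3], by simp [State.put, h4], by simp [State.put, h7],
        by simp [State.put, h5], by simp [State.put]; omega, ?_, hbW⟩
      simpa [State.put, hT] using hs.update_iff hv h9 hW
    · exact completes_scan₃_correct hv hmax hy hc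
  · rw [if_neg hy]
    refine ⟨v, hv, y a, .sweep a b v, by simp [State.put],
      hs.erase (v := v) (by simp [State.put, hT]) (by simp [State.put]), ?_, fun τ hr hc => ?_⟩
    · exact ⟨by simp [State.put], by simp [State.put, h4], by simp [State.put, h7],
        by simp [State.put, h5], by simp [State.put]⟩
    · exact completes_scan₃_mistake hv hmax hy hc

/-- The condition for a trial of Step 4. -/
theorem eval_sweep_ne_zero (hG : G.Connected) (hs : RepresentsSet G s (T + 1) U)
    (hT : s.reg 2 = T + 1) {a b c : Fin n} (hp : RepresentsPhase y s (T + 1) (.sweep a b c))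
    {ρ : ℕ → ℕ} (hρ : ∀ j < 20, ρ j = s.reg j) {v : Fin n} (hv : ρ 25 = v) :
    (Exp.and (.unlabeled 25 2) (.good 4 5 6 25)).eval G s.mem ρ ≠ 0 ↔
      v ∈ U ∧ Good G a b c v := by
  classical
  obtain ⟨h3, h4, h7, h5, h6⟩ := hp
  rw [Exp.eval_and_ne_zero, Exp.eval_unlabeled_ne_zero, hv, hρ 2 (by decide), hT, ← hs.mem_iff,
    Exp.eval_good hG hs.dist (by rw [hρ 0 (by decide), hs.reg_zero]) (by decide) (by decide)
      (by decide) (by decide) (by rw [hρ 4 (by decide), h4]) (by rw [hρ 5 (by decide), h5])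
      (by rw [hρ 6 (by decide), h6]) hv]
  simp

theorem performs_stepSweep (hG : G.Connected) (hs : RepresentsSet G s (T + 1) U)
    (hT : s.reg 2 = T + 1) {a b c : Fin n}
    (hp : RepresentsPhase y s (T + 1) (.sweep a b c)) (hU : ∃ d ∈ U, Good G a b c d) :
    Performs G y T U (.sweep a b c) s
      ((Stmt.seq .stepSweep (.store (.var 10) (.var 2))).run G y s) := by
  obtain ⟨v, ⟨hv, hg⟩, he⟩ := Exp.exists_eval_first (G := G) (m := s.mem) (ρ := s.reg)
    (fun v ρ hρ hv => eval_sweep_ne_zero hG hs hT hp hρ hv) hU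
  obtain ⟨h3, h4, h7, h5, h6⟩ := hp
  have hpred : decide ((y a).toNat ≠ 0) = y a := by cases y a <;> rfl
  simp only [Stmt.stepSweep, Stmt.run, State.val, he]
  simp only [Exp.eval, Exp.ne, State.set, Function.update_self, State.ask_val,
    Function.update_of_ne (show 7 ≠ 10 by decide), Function.update_of_ne (show 7 ≠ 12 by decide),
    h7, hpred, toNat_ne_toNat]
  by_cases hy : y v = y a
  · rw [if_pos hy]
    refine ⟨v, hv, y a, .sweep a b c, by simp [State.put],
      hs.erase (v := v) (by simp [State.put, hT]) (by simp [State.put]), ?_, fun τ hr hc => ?_⟩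
    · exact ⟨by simp [State.put, h3], by simp [State.put, h4], by simp [State.put, h7],
        by simp [State.put, h5], by simp [State.put, h6]⟩
    · exact completes_sweep_correct hv hg hy hc
  · rw [if_neg hy]
    refine ⟨v, hv, y a, .start, by simp [State.put],
      hs.erase (v := v) (by simp [State.put, hT]) (by simp [State.put]), ?_, fun τ hr hc => ?_⟩
    · simp [RepresentsPhase, State.put]
    · exact completes_sweep_mistake hv hg hy hc

end Steps

/-- Running `endSweep`. -/
theorem Stmt.run_ite_of_eq_zero {c : Exp} {S S' : Stmt} {s : State n} (h : s.val G c = 0) :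
    (Stmt.ite c S S').run G y s = S'.run G y s := if_pos h

theorem Stmt.run_ite_of_ne_zero {c : Exp} {S S' : Stmt} {s : State n} (h : s.val G c ≠ 0) :
    (Stmt.ite c S S').run G y s = S.run G y s := if_neg h

/-- Only a sweep can run out of candidates while unlabelled nodes remain, so this is the only change
of phase without a trial. Afterwards a sweep phase is guaranteed a node to select. -/
theorem exists_run_endSweep (hG : G.Connected) {s : State n} {T : ℕ} {U : Finset (Fin n)}
    (hs : RepresentsSet G s (T + 1) U) (hT : s.reg 2 = T + 1) {ph : Phase (Fin n)}
    (hp : RepresentsPhase y s (T + 1) ph) :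
    ∃ ph', RepresentsSet G (Stmt.endSweep.run G y s) (T + 1) U ∧
      RepresentsPhase y (Stmt.endSweep.run G y s) (T + 1) ph' ∧
      (Stmt.endSweep.run G y s).reg 2 = T + 1 ∧
      (Stmt.endSweep.run G y s).trials = s.trials ∧
      (∀ a b c, ph' = .sweep a b c → ∃ d ∈ U, Good G a b c d) ∧
      ∀ τ, Completes G y ph' U τ → Completes G y ph U τ := by
  have hset : ∀ i x, i ≠ 0 → RepresentsSet G (s.set i x) (T + 1) U := fun i x hi =>
    ⟨by simpa [State.set, hi.symm] using hs.reg_zero, hs.dist, hs.mem_eq_zero, hs.lt_mem⟩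
  have hnop : RepresentsPhase y (s.set 11 0) (T + 1) ph := by
    cases ph <;> simpa [RepresentsPhase, State.set] using hp
  have hle : (Exp.le (.const 3) (.var 3)).eval G s.mem s.reg = 0 ↔ ¬ 3 ≤ s.reg 3 := by
    rw [← not_iff_not, not_not, ← ne_eq, Exp.eval_le_ne_zero]
    rfl
  have hlow : ¬ 3 ≤ s.reg 3 → Stmt.endSweep.run G y s = s.set 11 0 := by
    intro h
    exact (Stmt.run_ite_of_eq_zero (hle.2 h)).trans rfl
  by_cases h3 : 3 ≤ s.reg 3
  swap
  · rw [hlow h3]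
    refine ⟨ph, hset _ _ (by decide), hnop, by simpa [State.set] using hT, rfl, ?_,
      fun _ h => h⟩
    rintro a b c rfl
    exact absurd hp.1.ge h3
  obtain ⟨a, b, c, rfl⟩ : ∃ a b c, ph = .sweep a b c := by
    cases ph with
    | start => simp only [RepresentsPhase] at hp; omega
    | scan₂ a S => have := hp.1; omega
    | scan₃ a b W => have := hp.1; omega
    | sweep a b c => exact ⟨a, b, c, rfl⟩
  have hex : (Exp.sum 25 (.and (.unlabeled 25 2) (.good 4 5 6 25))).eval G s.mem s.reg ≠ 0 ↔
      ∃ d ∈ U, Good G a b c d := by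
    rw [Exp.eval_sum_ne_zero]
    exact exists_congr fun v => eval_sweep_ne_zero hG hs hT hp
      (fun j hj => Function.update_of_ne (by omega) _ _) (Function.update_self _ _ _)
  by_cases hd : ∃ d ∈ U, Good G a b c d
  · have hr : Stmt.endSweep.run G y s = s.set 11 0 := by
      exact (Stmt.run_ite_of_ne_zero fun h => hle.1 h h3).trans
        (Stmt.run_ite_of_ne_zero (hex.2 hd))
    rw [hr]
    refine ⟨_, hset _ _ (by decide), hnop, by simpa [State.set] using hT, rfl, ?_, fun _ h => h⟩
    rintro a' b' c' ⟨⟩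
    exact hd
  · have hr : Stmt.endSweep.run G y s = s.set 3 0 := by
      exact (Stmt.run_ite_of_ne_zero fun h => hle.1 h h3).trans
        (Stmt.run_ite_of_eq_zero (not_not.1 (mt hex.1 hd)))
    rw [hr]
    refine ⟨.start, hset _ _ (by decide), by simp [RepresentsPhase, State.set],
      by simpa [State.set] using hT, rfl, by simp, fun τ h => ?_⟩
    push Not at hd
    exact completes_sweep_of_forall_not hd h

theorem performs_trial (hG : G.Connected) {s : State n} {T : ℕ} {U : Finset (Fin n)}
    (hs : RepresentsSet G s (T + 1) U) (ht : n - s.reg 1 = T + 1) (hU : U.Nonempty)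
    {ph : Phase (Fin n)} (hp : RepresentsPhase y s (T + 1) ph) :
    Performs G y T U ph s (Stmt.trial.run G y s) := by
  set s1 := s.set 2 (T + 1) with hs1
  have hs1' : RepresentsSet G s1 (T + 1) U :=
    ⟨by simpa [hs1, State.set] using hs.reg_zero, hs.dist, hs.mem_eq_zero, hs.lt_mem⟩
  have hp1 : RepresentsPhase y s1 (T + 1) ph := by
    cases ph <;> simpa [RepresentsPhase, hs1, State.set] using hp
  obtain ⟨ph', h1, h2, h3, h4, h5, h6⟩ :=
    exists_run_endSweep (y := y) hG hs1' (by simp [hs1, State.set]) hp1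
  set s2 := Stmt.endSweep.run G y s1 with hs2
  have hrun : Stmt.trial.run G y s =
      (Stmt.seq (.ite (.var 3) (.ite (.sub (.var 3) (.const 1)) (.ite (.sub (.var 3) (.const 2))
        .stepSweep .stepScan₃) .stepScan₂) .stepStart) (.store (.var 10) (.var 2))).run G y s2 := by
    have : s.set 2 (s.val G (.sub (.var 0) (.var 1))) = s1 := by
      simp only [State.val, Exp.eval, hs.reg_zero, ht, hs1]
    simp only [Stmt.trial, Stmt.run, this, hs2]
  suffices H : Performs G y T U ph' s2 (Stmt.trial.run G y s) by
    obtain ⟨v, hv, p, ph'', g1, g2, g3, g4⟩ := H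
    refine ⟨v, hv, p, ph'', ?_, g2, g3, fun τ hr hc => h6 _ (g4 τ hr hc)⟩
    rw [g1, h4]
    rfl
  rw [hrun]
  have hseq : ∀ S S' : Stmt, S.run G y s2 = S'.run G y s2 → ∀ S'' : Stmt,
      (S.seq S'').run G y s2 = (S'.seq S'').run G y s2 := fun S S' h S'' => by
    rw [Stmt.run, Stmt.run, h]
  have h0 : s2.val G (.var 3) = s2.reg 3 := rfl
  have h1' : s2.val G (.sub (.var 3) (.const 1)) = s2.reg 3 - 1 := rfl
  have h2' : s2.val G (.sub (.var 3) (.const 2)) = s2.reg 3 - 2 := rfl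
  cases ph' with
  | start =>
    rw [hseq _ _ (Stmt.run_ite_of_eq_zero (by rw [h0, show s2.reg 3 = 0 from h2]))]
    exact performs_stepStart hG h1 h3 hU
  | scan₂ a S =>
    rw [hseq _ _ ((Stmt.run_ite_of_ne_zero (by rw [h0, h2.1]; decide)).trans <|
      Stmt.run_ite_of_eq_zero (by rw [h1', h2.1]))]
    exact performs_stepScan₂ hG h1 h3 hU h2
  | scan₃ a b W =>
    rw [hseq _ _ ((Stmt.run_ite_of_ne_zero (by rw [h0, h2.1]; decide)).trans <|
      (Stmt.run_ite_of_ne_zero (by rw [h1', h2.1]; decide)).trans <|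
      Stmt.run_ite_of_eq_zero (by rw [h2', h2.1]))]
    exact performs_stepScan₃ hG h1 h3 hU h2
  | sweep a b c =>
    rw [hseq _ _ ((Stmt.run_ite_of_ne_zero (by rw [h0, h2.1]; decide)).trans <|
      (Stmt.run_ite_of_ne_zero (by rw [h1', h2.1]; decide)).trans <|
      Stmt.run_ite_of_ne_zero (by rw [h2', h2.1]; decide))]
    exact performs_stepSweep hG h1 h3 h2 (h5 a b c rfl)

/-- The main loop performs a run of the algorithm. -/
theorem completes_iter (hG : G.Connected) {f : ℕ → State n → State n}
    (hf : f = fun k s => Stmt.trial.run G y (s.set 1 k)) :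
    ∀ T k, T + k = n → ∀ s U ph, U.card = T → RepresentsSet G s T U → RepresentsPhase y s T ph →
      ∃ τ, Rest y U τ ∧ Completes G y ph U τ ∧
        ∀ s0, iter f k s0 = s → (iter f n s0).trials = s.trials ++ τ := by
  -- The induction is on the number of nodes still unlabelled, since completing a phase refers to
  -- all later trials.
  intro T
  induction T with
  | zero =>
    intro k hk s U ph hU hs hp
    obtain rfl := Finset.card_eq_zero.1 hU
    obtain rfl : k = n := by omega
    exact ⟨[], .done, completes_nil ph, fun s0 h => by simp [h]⟩
  | succ T ih =>
    intro k hk s U ph hU hs hp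
    have hs1 : RepresentsSet G (s.set 1 k) (T + 1) U :=
      ⟨by simpa [State.set] using hs.reg_zero, hs.dist, hs.mem_eq_zero, hs.lt_mem⟩
    have hp1 : RepresentsPhase y (s.set 1 k) (T + 1) ph := by
      cases ph <;> simpa [RepresentsPhase, State.set] using hp
    obtain ⟨v, hv, p, ph', g1, g2, g3, g4⟩ := performs_trial hG hs1
      (by simp only [State.set, Function.update_self]; omega)
      (Finset.card_pos.1 (by omega)) hp1
    obtain ⟨τ, h1, h2, h3⟩ := ih (k + 1) (by omega) _ _ ph'
      (by rw [Finset.card_erase_of_mem hv, hU]; rfl) g2 g3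
    refine ⟨_, .predict U v p τ hv h1, g4 τ h1 h2, fun s0 h0 => ?_⟩
    rw [h3 s0 (by rw [iter, h0, hf]), g1]
    simp [State.set]

theorem isRun_algorithm (hG : G.Connected) (y : Fin n → Bool) :
    IsRun G y (Stmt.algorithm.run G y (State.init n)).trials := by
  obtain ⟨h1, h2⟩ := distances_spec (y := y) hG
  set s := Stmt.distances.run G y (State.init n) with hs
  -- The distance computation leaves the label cells and the phase register at `0`, which represents
  -- the start with every node unlabelled.
  obtain ⟨τ, -, h3, h4⟩ := completes_iter (y := y) hG rfl n 0 rfl s Finset.univ .start (by simp)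
    ⟨h1.reg_zero, h2, fun v _ => h1.mem_eq_zero v v.2, fun v hv => absurd (Finset.mem_univ v) hv⟩
    h1.reg_mode
  have h5 := h4 s rfl
  rw [h1.trials, List.nil_append] at h5
  rw [Completes] at h3
  rw [← h5] at h3
  exact h3

end Program

end Good4

theorem mainTheorem1 :
    (∃ (P : Good4.Prog) (p : Polynomial ℕ),
      ∀ (n : ℕ) (G : SimpleGraph (Fin n)), G.Connected → ∀ y : Fin n → Bool,
        ∃ (t : ℕ) (s : Good4.State n),
          Good4.Exec G y P (Good4.State.init n) t s ∧
          t ≤ p.eval n ∧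
          Good4.IsRun G y s.trials) ∧
    (∀ (V : Type*) [Fintype V] [DecidableEq V] (G : SimpleGraph V),
      G.Connected → 2 ≤ Fintype.card V →
      ∀ y : V → Bool, Good4.IsConvexBipartition G y →
      ∀ τ : List (Good4.Trial V), Good4.IsRun G y τ →
        (Good4.mistakes τ : ℝ) ≤
          3 * ((Good4.hadwiger G : ℝ) + 1) ^ 4 * Real.log (Fintype.card V)) := by
  refine ⟨⟨Good4.Stmt.algorithm.compile Good4.numVars, Good4.Stmt.algorithm.time,
    fun n G hG y => ?_⟩, ?_⟩
  · obtain ⟨t, s, h1, h2, h3⟩ := Good4.Stmt.exec_compile Good4.Stmt.algorithm_wf G y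
    exact ⟨t, s, h1, h2, h3 ▸ Good4.isRun_algorithm hG y⟩
  · intro V _ _ G hG hV y hy τ hτ
    exact Good4.Loop.mistakes_le hG hV hy hτ hV
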